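/- **Setting.** Let $X$ be a scheme over $\mathbb{C}$ that is a global normal crossing variety of dimension $n$ with components $X_i$, $i\in I$ ($I$ a finite totally ordered set): the $X_i\subset X$ are closed subschemes, and every point of $X$ has an affine open neighbourhood $U$ with an étale morphism to $\{x_1\cdots x_k=0\}\subset\mathbb{A}^{n+1}$ for some $1\le k\le n+1$, such that the $k$ subschemes $\{x_j=0\}\subset U$ are the traces on $U$ of $k$ distinct $X_i$'s and the other $X_i$ do not meet $U$. Put $X^{[1]}=\coprod_i X_i$, $X^{[2]}=\coprod_{i<j}X_i\cap X_j$, $X^{[3]}=\coprod_{i<j<k}X_i\cap X_j\cap X_k$, with the natural maps $a=a_1,a_2,a_3$ to $X$. Let $\xi\in\operatorname{Ext}^1_{\mathcal{O}_X}(\Omega^1_X,\mathcal{O}_X)$ be nowhere vanishing, that is, for every $x\in X$ the image of $\xi$ generates the $\mathcal{O}_{X,x}$-module $\operatorname{Ext}^1_{\mathcal{O}_{X,x}}(\Omega^1_{X,x},\mathcal{O}_{X,x})$ (this sheaf is a line bundle on $D=X_{\rm sing}$, so this says that the induced section has no zero on $D$). Let $0\to\mathcal{O}_X\xrightarrow{i}\mathcal{F}\to\Omega^1_X\to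 0$ be any extension of class $\xi$, let $\pi:\mathcal{X}_\xi\to\Delta_\varepsilon=\operatorname{Spec}\mathbb{C}[\varepsilon]/(\varepsilon^2)$ be the corresponding first-order deformation of $X$, with underlying space that of $X$, structure sheaf $\mathcal{O}_X\times_{\Omega^1_X}\mathcal{F}$ (fibre product over $d:\mathcal{O}_X\to\Omega^1_X$, with product $(a,m)(b,n)=(ab,an+bm)$), and $\varepsilon=(0,i(1))$. Write $\Omega^1_{\Delta}=\Omega^1_{\mathbb{C}[\varepsilon]/\mathbb{C}}$, and let $\Omega^1_{\Delta}(\log 0)$ be the free $\mathbb{C}[\varepsilon]$-module on $d\varepsilon/\varepsilon$. All $\otimes\,\mathcal{O}_X$ are over $\mathcal{O}_{\mathcal{X}_\xi}$. * $\Omega^1_{\mathcal{X}_\xi}(\log X)\otimes\mathcal{O}_X$ is the $\mathcal{O}_X$-module generated by $\Omega^1_{\mathcal{X}_\xi}\otimes\mathcal{O}_X$, symbols $dm/m$ for the local generators $m\in\mathcal{O}_{\mathcal{X}_\xi}$ of the ideals of the $X_i$ in $\mathcal{X}_\xi$, and a symbol $d\varepsilon/\varepsilon$, with the relations $dm=m\cdot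 dm/m$; $d(um)/(um)=dm/m+du/u$ for units $u$; and $d\varepsilon/\varepsilon=\sum_i dm_i/m_i$ whenever $m_i$ generates the ideal of $X_i$ for each $i$ and $\prod_i m_i=\varepsilon$. * $\Omega^1_{\mathcal{X}_\xi/\Delta_\varepsilon}(\log X)\otimes\mathcal{O}_X$ is the quotient of this module by the image of $\pi^*\Omega^1_{\Delta}(\log 0)\otimes\mathcal{O}_X$, i.e. by $d\varepsilon/\varepsilon$. * The residue $\operatorname{Res}:\Omega^1_{\mathcal{X}_\xi}(\log X)\otimes\mathcal{O}_X\to a_*\mathcal{O}_{X^{[1]}}$ is $0$ on the image of $\Omega^1_{\mathcal{X}_\xi}\otimes\mathcal{O}_X$, sends $dm/m$ to the function $1$ on $X_i$ (and $0$ on the other components) if $m$ is a generator of the ideal of $X_i$, and sends $d\varepsilon/\varepsilon$ to $1$. The residue $\operatorname{Res}:\pi^*\Omega^1_\Delta(\log 0)\otimes\mathcal{O}_X\to\mathcal{O}_X$ sends $d\varepsilon/\varepsilon$ to $1$. * $a_*\mathcal{O}_{X^{[1]}}\to a_{2*}\mathcal{O}_{X^{[2]}}\to a_{3*}\mathcal{O}_{X^{[3]}}$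 are the maps $(u_i)\mapsto(u_j-u_i)_{i<j}$ and $(u_{ij})\mapsto(u_{jk}-u_{ik}+u_{ij})_{i<j<k}$, with restrictions understood. **Proposition (Basic Diagram).** There are morphisms $r:\Omega^1_X\to\Omega^1_{\mathcal{X}_\xi/\Delta_\varepsilon}(\log X)\otimes\mathcal{O}_X$ and $\operatorname{Res}:\Omega^1_{\mathcal{X}_\xi/\Delta_\varepsilon}(\log X)\otimes\mathcal{O}_X\to\ker\{a_{2*}\mathcal{O}_{X^{[2]}}\to a_{3*}\mathcal{O}_{X^{[3]}}\}$ such that, with the natural maps and the residues above, the diagram of $\mathcal{O}_X$-modules $$\begin{array}{ccccccccc} 0&\to&\pi^*\Omega^1_{\Delta}\otimes\mathcal{O}_X&\to&\Omega^1_{\mathcal{X}_\xi}\otimes\mathcal{O}_X&\to&\Omega^1_X&\to&0\\ &&&&\downarrow&&\downarrow{\scriptstyle r}&&\\ 0&\to&\pi^*\Omega^1_{\Delta}(\log 0)\otimes\mathcal{O}_X&\to&\Omega^1_{\mathcal{X}_\xi}(\log X)\otimes\mathcal{O}_X&\to&\Omega^1_{\mathcal{X}_\xi/\Delta_\varepsilon}(\log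 X)\otimes\mathcal{O}_X&\to&0\\ &&\downarrow{\scriptstyle\operatorname{Res}}&&\downarrow{\scriptstyle\operatorname{Res}}&&\downarrow{\scriptstyle\operatorname{Res}}&&\\ 0&\to&\mathcal{O}_X&\to&a_*\mathcal{O}_{X^{[1]}}&\to&\ker\{a_{2*}\mathcal{O}_{X^{[2]}}\to a_{3*}\mathcal{O}_{X^{[3]}}\}&\to&0 \end{array}$$ commutes and has the following exactness properties. The three rows are exact. The left residue is an isomorphism. The middle and right columns are exact at the middle row, and their residue maps are surjective (no injectivity at the top of the columns is claimed). Moreover the composite $\pi^*\Omega^1_\Delta\otimes\mathcal{O}_X\to\Omega^1_{\mathcal{X}_\xi}(\log X)\otimes\mathcal{O}_X$ is zero. -/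

import Mathlib

open CategoryTheory AlgebraicGeometry TopologicalSpace Opposite
open scoped TensorProduct

noncomputable section

namespace NormalCrossing

/-! ### Square-zero extensions attached to extensions of the module of differentials -/

/-- Given a derivation `D : A → Ω` and a linear map `p : F → Ω`, the fibre product
`A ×_Ω F = {(a, m) | p m = D a}`. -/
@[ext]
structure SqZero {A Ω F : Type} [CommRing A] [AddCommGroup Ω] [Module A Ω]
    [AddCommGroup F] [Module A F] (D : Derivation ℤ A Ω) (p : F →ₗ[A] Ω) where
  fst : A
  snd : F
  cond : p snd = D fst

namespace SqZero

variable {A Ω F : Type} [CommRing A] [AddCommGroup Ω] [Module A Ω]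
    [AddCommGroup F] [Module A F] {D : Derivation ℤ A Ω} {p : F →ₗ[A] Ω}

instance : Zero (SqZero D p) := ⟨⟨0, 0, by simp⟩⟩
instance : One (SqZero D p) := ⟨⟨1, 0, by simp⟩⟩
instance : Add (SqZero D p) := ⟨fun x y => ⟨x.1 + y.1, x.2 + y.2, by simp [x.cond, y.cond]⟩⟩
instance : Neg (SqZero D p) := ⟨fun x => ⟨-x.1, -x.2, by simp [x.cond]⟩⟩
/-- The multiplication is `(a, m) (b, n) = (a b, a n + b m)`. -/
instance : Mul (SqZero D p) :=
  ⟨fun x y => ⟨x.1 * y.1, x.1 • y.2 + y.1 • x.2, by simp [x.cond, y.cond]⟩⟩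

@[simp] lemma zero_fst : (0 : SqZero D p).fst = 0 := rfl
@[simp] lemma zero_snd : (0 : SqZero D p).snd = 0 := rfl
@[simp] lemma one_fst : (1 : SqZero D p).fst = 1 := rfl
@[simp] lemma one_snd : (1 : SqZero D p).snd = 0 := rfl
@[simp] lemma add_fst (x y : SqZero D p) : (x + y).fst = x.fst + y.fst := rfl
@[simp] lemma add_snd (x y : SqZero D p) : (x + y).snd = x.snd + y.snd := rfl
@[simp] lemma neg_fst (x : SqZero D p) : (-x).fst = -x.fst := rfl
@[simp] lemma neg_snd (x : SqZero D p) : (-x).snd = -x.snd := rfl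
@[simp] lemma mul_fst (x y : SqZero D p) : (x * y).fst = x.fst * y.fst := rfl
@[simp] lemma mul_snd (x y : SqZero D p) :
    (x * y).snd = x.fst • y.snd + y.fst • x.snd := rfl

instance : CommRing (SqZero D p) where
  add_assoc x y z := by ext <;> simp [add_assoc]
  zero_add x := by ext <;> simp
  add_zero x := by ext <;> simp
  add_comm x y := by ext <;> simp [add_comm]
  neg_add_cancel x := by ext <;> simp
  mul_assoc x y z := by
    ext
    · simp [mul_assoc]
    · simp only [mul_snd, mul_fst]; module
  mul_comm x y := by ext <;> simp [mul_comm, add_comm]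
  one_mul x := by ext <;> simp
  mul_one x := by ext <;> simp
  zero_mul x := by ext <;> simp
  mul_zero x := by ext <;> simp
  left_distrib x y z := by
    ext
    · simp [mul_add]
    · simp only [mul_snd, add_snd, add_fst]; module
  right_distrib x y z := by
    ext
    · simp [add_mul]
    · simp only [mul_snd, add_snd, add_fst]; module
  nsmul := nsmulRec
  zsmul := zsmulRec

/-- The projection `(a, m) ↦ a`. -/
@[simps]
def fstHom : SqZero D p →+* A where
  toFun := SqZero.fst
  map_zero' := rfl
  map_one' := rfl
  map_add' _ _ := rfl
  map_mul' _ _ := rfl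

end SqZero

/-! ### Sheaves of modules and Kähler differentials on a complex scheme -/

/-- `Spec ℂ`. -/
abbrev SpecC : Scheme.{0} := Spec (CommRingCat.of ℂ)

section Scheme

variable (X : Scheme.{0})

/-- The constant presheaf of rings `ℂ`. -/
def constC : X.Opensᵒᵖ ⥤ CommRingCat.{0} := (Functor.const _).obj (CommRingCat.of ℂ)

/-- The constants `ℂ → Γ(X, U)` of a scheme over `ℂ`. -/
def scalar (s : X ⟶ SpecC) (U : X.Opens) : CommRingCat.of ℂ ⟶ Γ(X, U) :=
  (Scheme.ΓSpecIso (CommRingCat.of ℂ)).inv ≫ s.appTop ≫ X.presheaf.map (homOfLE le_top).op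

lemma scalar_map (s : X ⟶ SpecC) {U V : X.Opensᵒᵖ} (f : U ⟶ V) :
    scalar X s U.unop ≫ X.presheaf.map f = scalar X s V.unop := by
  simp only [scalar, Category.assoc]
  rw [← Functor.map_comp]
  rfl

/-- The constants, as a morphism of presheaves. -/
def constToO (s : X ⟶ SpecC) : constC X ⟶ X.presheaf where
  app U := scalar X s U.unop
  naturality U V f := by
    exact (Category.id_comp _).trans (scalar_map X s f).symm

/-- Sheafification of presheaves of `𝒪_X`-modules. -/
def shf : X.PresheafOfModules ⥤ X.Modules :=
  PresheafOfModules.sheafification (𝟙 X.ringCatSheaf.obj)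

/-- The map to the sheafification. -/
def toShf (P : X.PresheafOfModules) : P ⟶ ((shf X).obj P).val :=
  (PresheafOfModules.sheafificationAdjunction (𝟙 X.ringCatSheaf.obj)).unit.app P

/-- The structure sheaf as a sheaf of modules. -/
def sheafO : X.Modules := SheafOfModules.unit X.ringCatSheaf

/-- The presheaf `U ↦ Ω¹_{Γ(X, U)/ℂ}`. -/
def preOmega (s : X ⟶ SpecC) : X.PresheafOfModules :=
  PresheafOfModules.DifferentialsConstruction.relativeDifferentials' (constToO X s)

/-- The sheaf of Kähler differentials `Ω¹_X`. -/
def Omega (s : X ⟶ SpecC) : X.Modules := (shf X).obj (preOmega X s)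

instance : HasExt.{1} X.Modules := HasExt.standard _

/-- The universal derivation of `Γ(X, U)`, with values in sections of the sheaf `Ω¹_X`. -/
def dOmega (s : X ⟶ SpecC) (U : X.Opens) :
    Derivation ℤ Γ(X, U) Γ(Omega X s, U) :=
  Derivation.mk'
    (AddMonoidHom.toIntLinearMap
      (AddMonoidHom.mk' (fun a => (toShf X (preOmega X s)).app (op U)
        (CommRingCat.KaehlerDifferential.d (f := (constToO X s).app (op U)) a)) (by
          intro a b
          exact (congrArg _ (ModuleCat.Derivation.d_add _ a b)).trans (map_add _ _ _))))
    (by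
      intro a b
      change (toShf X (preOmega X s)).app (op U) (CommRingCat.KaehlerDifferential.d (f := (constToO X s).app (op U)) (a * b)) = _
      refine (congrArg _ (ModuleCat.Derivation.d_mul _ a b)).trans ?_
      refine (map_add _ _ _).trans ?_
      exact congrArg₂ _ (LinearMap.map_smul ((toShf X (preOmega X s)).app (op U)).hom a _)
        (LinearMap.map_smul ((toShf X (preOmega X s)).app (op U)).hom b _))

lemma dOmega_map (s : X ⟶ SpecC) {U V : X.Opensᵒᵖ} (f : U ⟶ V) (a : X.presheaf.obj U) :
    (Omega X s).presheaf.map f (dOmega X s U.unop a) = dOmega X s V.unop (X.presheaf.map f a) := by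
  change (Omega X s).val.map f ((toShf X (preOmega X s)).app U
    (CommRingCat.KaehlerDifferential.d (f := (constToO X s).app U) a)) =
    (toShf X (preOmega X s)).app V
    (CommRingCat.KaehlerDifferential.d (f := (constToO X s).app V) (X.presheaf.map f a))
  rw [← PresheafOfModules.DifferentialsConstruction.relativeDifferentials'_map_d]
  exact (PresheafOfModules.naturality_apply (toShf X (preOmega X s)) f _).symm

lemma dOmega_scalar (s : X ⟶ SpecC) (U : X.Opens) (c : ℂ) :
    dOmega X s U (scalar X s U c) = 0 := by
  refine (congrArg ((toShf X (preOmega X s)).app (op U))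
    (ModuleCat.Derivation.d_map (CommRingCat.KaehlerDifferential.D ((constToO X s).app (op U))) c)).trans ?_
  exact map_zero _


/-- The `Γ(X, U)`-linear map on sections of a morphism of sheaves of modules. -/
def secMap {X : Scheme.{0}} {M N : X.Modules} (f : M ⟶ N) (U : X.Opens) :
    Γ(M, U) →ₗ[Γ(X, U)] Γ(N, U) where
  toFun m := f.app U m
  map_add' := map_add (f.app U).hom
  map_smul' r m := f.app_smul r m

/-- An extension `0 → 𝒪_X → F → Ω¹_X → 0` of sheaves of `𝒪_X`-modules. -/
structure CotangentExtension (s : X ⟶ SpecC) where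
  F : X.Modules
  i : sheafO X ⟶ F
  p : F ⟶ Omega X s
  w : i ≫ p = 0
  shortExact : (ShortComplex.mk i p w).ShortExact

/-- The class of an extension in `Ext¹(Ω¹_X, 𝒪_X)`. -/
def CotangentExtension.extClass {X : Scheme.{0}} {s : X ⟶ SpecC} (E : CotangentExtension X s) :
    Abelian.Ext (Omega X s) (sheafO X) 1 :=
  E.shortExact.extClass

/-! ### Stalks -/

instance (M : X.Modules) (x : X) : Module (X.presheaf.stalk x) (M.presheaf.stalk x) :=
  PresheafOfModules.instModuleCarrierStalkCommRingCatCarrierAbPresheafOpensCarrier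
    (R := X.presheaf) M.val x

lemma germ_smul (M : X.Modules) (x : X) (U : X.Opens) (hx : x ∈ U) (r : Γ(X, U)) (m : Γ(M, U)) :
    M.presheaf.germ U x hx (r • m) = X.presheaf.germ U x hx r • M.presheaf.germ U x hx m :=
  PresheafOfModules.germ_smul (R := X.presheaf) M.val x U hx r m

/-- The stalk of a sheaf of modules, as a module over the local ring `𝒪_{X, x}`. -/
def stalkMod (M : X.Modules) (x : X) : ModuleCat.{0} (X.presheaf.stalk x) :=
  ModuleCat.of _ (M.presheaf.stalk x)

/-- The map induced on stalks. -/
def stalkMap {X : Scheme.{0}} {M N : X.Modules} (f : M ⟶ N) (x : X) :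
    stalkMod X M x ⟶ stalkMod X N x :=
  ModuleCat.ofHom (X := M.presheaf.stalk x) (Y := N.presheaf.stalk x)
    { toFun := (TopCat.Presheaf.stalkFunctor Ab x).map f.mapPresheaf
      map_add' := map_add ((TopCat.Presheaf.stalkFunctor Ab x).map f.mapPresheaf).hom
      map_smul' := by
        intro r m
        obtain ⟨U, hU, a, rfl⟩ := X.presheaf.exists_germ_eq r
        obtain ⟨V, hV, b, rfl⟩ := M.presheaf.exists_germ_eq m
        rw [← X.presheaf.germ_res_apply (homOfLE inf_le_left : U ⊓ V ⟶ U) x ⟨hU, hV⟩ a,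
          ← M.presheaf.germ_res_apply (homOfLE inf_le_right : U ⊓ V ⟶ V) x ⟨hU, hV⟩ b]
        generalize X.presheaf.map (homOfLE inf_le_left : U ⊓ V ⟶ U).op a = a'
        generalize M.presheaf.map (homOfLE inf_le_right : U ⊓ V ⟶ V).op b = b'
        have h := fun c => TopCat.Presheaf.stalkFunctor_map_germ_apply (U ⊓ V) x ⟨hU, hV⟩
          f.mapPresheaf c
        refine (congrArg _ (germ_smul X M x _ _ a' b').symm).trans ?_
        refine (h _).trans ?_
        refine Eq.trans ?_ (congrArg _ (h _).symm)
        refine Eq.trans ?_ (germ_smul X N x (U ⊓ V) ⟨hU, hV⟩ a' _)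
        exact congrArg _ (f.app_smul a' b') }

lemma stalkMap_comp_zero {X : Scheme.{0}} {M N P : X.Modules} (f : M ⟶ N) (g : N ⟶ P)
    (h : f ≫ g = 0) (x : X) : stalkMap f x ≫ stalkMap g x = 0 := by
  ext m
  have h1 := ConcreteCategory.congr_hom ((TopCat.Presheaf.stalkFunctor Ab x).map_comp
    f.mapPresheaf g.mapPresheaf) m
  refine h1.symm.trans ?_
  have h2 : f.mapPresheaf ≫ g.mapPresheaf = 0 := by
    change (Scheme.Modules.toPresheaf X).map f ≫ (Scheme.Modules.toPresheaf X).map g = 0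
    rw [← Functor.map_comp, h]
    rfl
  rw [h2]
  obtain ⟨V, hV, b, rfl⟩ := M.presheaf.exists_germ_eq m
  refine (TopCat.Presheaf.stalkFunctor_map_germ_apply V x hV
          (0 : M.presheaf ⟶ P.presheaf) b).trans ?_
  exact map_zero _

/-- The stalk at `x` of an extension. -/
def CotangentExtension.stalk {X : Scheme.{0}} {s : X ⟶ SpecC} (E : CotangentExtension X s)
    (x : X) : ShortComplex (ModuleCat.{0} (X.presheaf.stalk x)) :=
  ShortComplex.mk (stalkMap E.i x) (stalkMap E.p x) (stalkMap_comp_zero _ _ E.w x)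

/-- `ξ ∈ Ext¹(Ω¹_X, 𝒪_X)` is nowhere vanishing (smoothing to first order): for every `x`, the
class of the stalk at `x` of an extension of class `ξ`, which is the image of `ξ` in the stalk
`Ext¹(Ω¹_{X, x}, 𝒪_{X, x})` of the sheaf `𝓔xt¹(Ω¹_X, 𝒪_X)`, generates this `𝒪_{X, x}`-module. On a
normal crossing variety `𝓔xt¹(Ω¹_X, 𝒪_X)` is a line bundle on the singular locus `D`, and the
condition says that the section of this line bundle given by `ξ` has no zero on `D`. -/
def NowhereVanishing {X : Scheme.{0}} {s : X ⟶ SpecC}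
    (ξ : Abelian.Ext (Omega X s) (sheafO X) 1) : Prop :=
  ∀ E : CotangentExtension X s, E.extClass = ξ → ∀ x : X,
    ∃ h : (E.stalk x).ShortExact,
      ∀ η : Abelian.Ext (stalkMod X (Omega X s) x) (stalkMod X (sheafO X) x) 1,
        ∃ a : X.presheaf.stalk x, η = a • h.extClass


/-! ### The first-order deformation attached to an extension -/

/-- Restriction of functions. -/
def oRes {U V : X.Opensᵒᵖ} (f : U ⟶ V) : Γ(X, U.unop) →+* Γ(X, V.unop) := (X.presheaf.map f).hom

lemma oRes_id (U : X.Opensᵒᵖ) (a : Γ(X, U.unop)) : oRes X (𝟙 U) a = a :=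
  ConcreteCategory.congr_hom (X.presheaf.map_id U) a

lemma oRes_comp {U V W : X.Opensᵒᵖ} (f : U ⟶ V) (g : V ⟶ W) (a : Γ(X, U.unop)) :
    oRes X (f ≫ g) a = oRes X g (oRes X f a) :=
  ConcreteCategory.congr_hom (X.presheaf.map_comp f g) a

section Deformation

variable {X} {s : X ⟶ SpecC} (E : CotangentExtension X s)

lemma modMap_smul (M : X.Modules) {U V : X.Opensᵒᵖ} (f : U ⟶ V) (r : Γ(X, U.unop))
    (m : Γ(M, U.unop)) :
    M.presheaf.map f (r • m) =
      (show Γ(X, V.unop) from X.presheaf.map f r) • (show Γ(M, V.unop) from M.presheaf.map f m) :=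
  M.map_smul f.unop r m

lemma secMap_map {M N : X.Modules} (g : M ⟶ N) {U V : X.Opensᵒᵖ} (f : U ⟶ V)
    (m : Γ(M, U.unop)) :
    secMap g V.unop (M.presheaf.map f m) = N.presheaf.map f (secMap g U.unop m) :=
  ConcreteCategory.congr_hom (g.mapPresheaf.naturality f) m

/-- The first-order deformation `𝒳 → Spec ℂ[ε]` of `X` given by an extension
`0 → 𝒪_X → F → Ω¹_X → 0` has the same underlying space as `X`, and its structure sheaf is
`𝒪_X ×_{Ω¹_X} F`, the fibre product of the universal derivation `d : 𝒪_X → Ω¹_X` and `F → Ω¹_X`,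
with the product `(a, m) (b, n) = (a b, a n + b m)`. These are its sections over `U`. -/
abbrev CotangentExtension.Sec (U : X.Opens) : Type := SqZero (dOmega X s U) (secMap E.p U)

/-- Restriction of sections. -/
def CotangentExtension.res {U V : X.Opensᵒᵖ} (f : U ⟶ V) : E.Sec U.unop →+* E.Sec V.unop where
  toFun z := ⟨X.presheaf.map f z.fst, E.F.presheaf.map f z.snd, by
    rw [secMap_map, z.cond, dOmega_map]⟩
  map_zero' := by ext <;> exact map_zero _
  map_one' := by
    ext
    · exact map_one _
    · exact map_zero _
  map_add' x y := by ext <;> exact map_add _ _ _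
  map_mul' x y := by
    ext
    · exact map_mul _ _ _
    · refine (map_add _ _ _).trans ?_
      exact congrArg₂ _ (modMap_smul _ f _ _) (modMap_smul _ f _ _)

/-- The structure sheaf of the deformation, as a presheaf of rings on the space of `X`. -/
def CotangentExtension.ring : X.Opensᵒᵖ ⥤ CommRingCat.{0} where
  obj U := CommRingCat.of (E.Sec U.unop)
  map f := CommRingCat.ofHom (E.res f)
  map_id U := by
    ext z : 2
    refine SqZero.ext ?_ ?_
    · exact ConcreteCategory.congr_hom (X.presheaf.map_id U) z.fst
    · exact ConcreteCategory.congr_hom (E.F.presheaf.map_id U) z.snd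
  map_comp f g := by
    ext z : 2
    refine SqZero.ext ?_ ?_
    · exact ConcreteCategory.congr_hom (X.presheaf.map_comp f g) z.fst
    · exact ConcreteCategory.congr_hom (E.F.presheaf.map_comp f g) z.snd

/-- The constants `ℂ → 𝒪`. -/
def CotangentExtension.const (U : X.Opens) : CommRingCat.of ℂ ⟶ CommRingCat.of (E.Sec U) :=
  CommRingCat.ofHom
    { toFun c := ⟨scalar X s U c, 0, by rw [map_zero, dOmega_scalar]⟩
      map_zero' := by
        ext
        · exact map_zero _
        · rfl
      map_one' := by
        ext
        · exact map_one _
        · rfl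
      map_add' x y := by
        ext
        · exact map_add _ _ _
        · exact (add_zero _).symm
      map_mul' x y := by
        ext
        · exact map_mul _ _ _
        · simp }

/-- The constants, as a morphism of presheaves. -/
def CotangentExtension.constToRing : constC X ⟶ E.ring where
  app U := E.const U.unop
  naturality U V f := by
    refine (Category.id_comp _).trans ?_
    ext c : 2
    refine SqZero.ext ?_ ?_
    · exact (ConcreteCategory.congr_hom (scalar_map X s f) c).symm
    · exact (map_zero _).symm

/-- Restriction of functions from the deformation to `X`. -/
def CotangentExtension.proj (U : X.Opens) : E.Sec U →+* Γ(X, U) := SqZero.fstHom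

lemma CotangentExtension.proj_res {U V : X.Opensᵒᵖ} (f : U ⟶ V) (z : E.Sec U.unop) :
    E.proj V.unop (E.res f z) = oRes X f (E.proj U.unop z) := rfl

/-- The element `ε`, the image of `1` under `𝒪_X → F`. -/
def CotangentExtension.eps (U : X.Opens) : E.Sec U :=
  ⟨0, secMap E.i U (1 : Γ(X, U)), by
    rw [map_zero]
    exact ConcreteCategory.congr_hom (congrArg (fun f => Scheme.Modules.Hom.app f U) E.w)
      (1 : Γ(X, U))⟩

lemma CotangentExtension.res_eps {U V : X.Opensᵒᵖ} (f : U ⟶ V) :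
    E.res f (E.eps U.unop) = E.eps V.unop := by
  refine SqZero.ext (map_zero _) ?_
  refine (secMap_map E.i f (1 : Γ(X, U.unop))).symm.trans ?_
  exact congrArg (secMap E.i V.unop) (map_one (X.presheaf.map f).hom)

lemma CotangentExtension.res_const {U V : X.Opensᵒᵖ} (f : U ⟶ V) (c : ℂ) :
    E.res f (E.const U.unop c) = E.const V.unop c :=
  (ConcreteCategory.congr_hom (E.constToRing.naturality f) c).symm

lemma CotangentExtension.eps_mul_eps (U : X.Opens) : E.eps U * E.eps U = 0 := by
  refine SqZero.ext (zero_mul _) ?_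
  change (0 : Γ(X, U)) • _ + (0 : Γ(X, U)) • _ = _
  exact (congrArg₂ (· + ·) (zero_smul _ _) (zero_smul _ _)).trans (add_zero _)

/-- The projection `π : 𝒳 → Δ_ε`, i.e. the ring homomorphism `ℂ[ε] → 𝒪(U)`. -/
def CotangentExtension.dual (U : X.Opens) : DualNumber ℂ →+* E.Sec U where
  toFun z := E.const U z.fst + E.const U z.snd * E.eps U
  map_zero' := by
    rw [TrivSqZeroExt.fst_zero, TrivSqZeroExt.snd_zero, map_zero, zero_mul, add_zero]
  map_one' := by
    rw [TrivSqZeroExt.fst_one, TrivSqZeroExt.snd_one, map_zero, zero_mul, add_zero, map_one]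
  map_add' x y := by
    rw [TrivSqZeroExt.fst_add, TrivSqZeroExt.snd_add, map_add, map_add]
    ring
  map_mul' x y := by
    have h := E.eps_mul_eps U
    rw [TrivSqZeroExt.fst_mul, TrivSqZeroExt.snd_mul, smul_eq_mul, MulOpposite.smul_eq_mul_unop,
      MulOpposite.unop_op, map_mul, map_add, map_mul, map_mul]
    linear_combination -(E.const U x.snd * E.const U y.snd) * h

instance (U : X.Opens) : Algebra (DualNumber ℂ) (E.Sec U) := (E.dual U).toAlgebra

lemma CotangentExtension.res_dual {U V : X.Opensᵒᵖ} (f : U ⟶ V) (z : DualNumber ℂ) :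
    E.res f (E.dual U.unop z) = E.dual V.unop z := by
  change E.res f (E.const _ _ + E.const _ _ * _) = E.const _ _ + E.const _ _ * _
  rw [map_add, map_mul, res_const, res_const, res_eps]

lemma CotangentExtension.res_comp {U V W : X.Opensᵒᵖ} (f : U ⟶ V) (g : V ⟶ W)
    (z : E.Sec U.unop) : E.res (f ≫ g) z = E.res g (E.res f z) :=
  ConcreteCategory.congr_hom (E.ring.map_comp f g) z

lemma CotangentExtension.res_id (U : X.Opensᵒᵖ) (z : E.Sec U.unop) : E.res (𝟙 U) z = z :=
  ConcreteCategory.congr_hom (E.ring.map_id U) z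

/-! ### Presheaves of modules given by families -/

/-- A presheaf of `𝒪_X`-modules, given by a family of modules with semilinear restriction maps. -/
structure ModFamily (X : Scheme.{0}) where
  obj : X.Opensᵒᵖ → Type
  [grp : ∀ U, AddCommGroup (obj U)]
  [mod : ∀ U, Module Γ(X, U.unop) (obj U)]
  res : ∀ {U V : X.Opensᵒᵖ} (f : U ⟶ V), obj U →ₛₗ[oRes X f] obj V
  res_id : ∀ (U : X.Opensᵒᵖ) (m : obj U), res (𝟙 U) m = m
  res_comp : ∀ {U V W : X.Opensᵒᵖ} (f : U ⟶ V) (g : V ⟶ W) (m : obj U),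
    res (f ≫ g) m = res g (res f m)

namespace ModFamily

attribute [instance] ModFamily.grp ModFamily.mod

variable (P Q : ModFamily X)

/-- The associated presheaf of modules. -/
def presheaf : X.PresheafOfModules :=
  letI : ∀ U : X.Opensᵒᵖ, Module (X.ringCatSheaf.obj.obj U) (P.obj U) :=
    fun U => inferInstanceAs (Module Γ(X, U.unop) (P.obj U))
  PresheafOfModules.ofPresheaf (R := X.ringCatSheaf.obj)
    { obj U := AddCommGrpCat.of (P.obj U)
      map f := AddCommGrpCat.ofHom (P.res f).toAddMonoidHom
      map_id U := by ext m; exact P.res_id U m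
      map_comp f g := by ext m; exact P.res_comp f g m }
    (fun _ _ f r m => (P.res f).map_smulₛₗ r m)

/-- The associated sheaf of modules. -/
def sheaf : X.Modules := (shf X).obj P.presheaf

variable {P Q} in
/-- The morphism of sheaves given by linear maps compatible with restrictions. -/
def map (app : ∀ U : X.Opensᵒᵖ, P.obj U →ₗ[Γ(X, U.unop)] Q.obj U)
    (naturality : ∀ {U V : X.Opensᵒᵖ} (f : U ⟶ V) (m : P.obj U),
      app V (P.res f m) = Q.res f (app U m)) : P.sheaf ⟶ Q.sheaf :=
  (shf X).map
    { app := fun U => ModuleCat.ofHom (X := P.presheaf.obj U) (Y := Q.presheaf.obj U)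
        { toFun := app U
          map_add' := map_add (app U)
          map_smul' := (app U).map_smul }
      naturality := fun f => by ext m; exact naturality f m }

variable {P} in
/-- The morphism to a sheaf `M` given by linear maps compatible with restrictions. -/
def toModules {M : X.Modules} (app : ∀ U : X.Opensᵒᵖ, P.obj U →ₗ[Γ(X, U.unop)] Γ(M, U.unop))
    (naturality : ∀ {U V : X.Opensᵒᵖ} (f : U ⟶ V) (m : P.obj U),
      app V (P.res f m) = M.presheaf.map f (app U m)) : P.sheaf ⟶ M :=
  ((PresheafOfModules.sheafificationAdjunction (𝟙 X.ringCatSheaf.obj)).homEquiv P.presheaf M).symm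
    { app := fun U => ModuleCat.ofHom (X := P.presheaf.obj U) (Y := M.val.obj U)
        { toFun := app U
          map_add' := map_add (app U)
          map_smul' := (app U).map_smul }
      naturality := fun f => by ext m; exact naturality f m }

variable {P} in
/-- The morphism `𝒪_X → P` given by a compatible family of elements. -/
def ofSection (t : ∀ U : X.Opensᵒᵖ, P.obj U)
    (ht : ∀ {U V : X.Opensᵒᵖ} (f : U ⟶ V), P.res f (t U) = t V) : sheafO X ⟶ P.sheaf :=
  ⟨P.presheaf.unitHomEquiv.symm
    (PresheafOfModules.sectionsMk (M := P.presheaf) t (fun _ _ f => ht f)) ≫ toShf X P.presheaf⟩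

end ModFamily

/-! ### Differentials of the deformation, restricted to `X` -/

instance (U : X.Opens) : Algebra (E.Sec U) Γ(X, U) := (E.proj U).toAlgebra

/-- Semilinear maps out of `Γ(X, U) ⊗ M`, where `M` is a module over the sections of the
deformation. -/
def CotangentExtension.baseLift {U : X.Opens} {M N R : Type} [AddCommGroup M] [Module (E.Sec U) M]
    [CommRing R] [AddCommGroup N] [Module R N] (ρ : Γ(X, U) →+* R) (g : M →+ N)
    (hg : ∀ z m, g (z • m) = ρ (E.proj U z) • g m) :
    (Γ(X, U) ⊗[E.Sec U] M) →ₛₗ[ρ] N :=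
  let h : (Γ(X, U) ⊗[E.Sec U] M) →+ N :=
    TensorProduct.liftAddHom
      (AddMonoidHom.mk' (fun a => AddMonoidHom.mk' (fun ω => ρ a • g ω)
          (fun x y => by rw [map_add, smul_add]))
        (fun x y => by
          ext ω
          change ρ (x + y) • g ω = ρ x • g ω + ρ y • g ω
          rw [map_add, add_smul]))
      (fun z a ω => by
        change ρ (E.proj U z * a) • g ω = ρ a • g (z • ω)
        rw [hg, map_mul, mul_comm, mul_smul])
  { h with
    map_smul' := by
      intro r m
      change h (r • m) = _ • h m
      induction m using TensorProduct.induction_on with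
      | zero => rw [smul_zero, map_zero, smul_zero]
      | add x y hx hy => rw [smul_add, map_add, hx, hy, map_add, smul_add]
      | tmul a ω =>
        rw [TensorProduct.smul_tmul']
        change ρ (r * a) • g ω = ρ r • ρ a • g ω
        rw [map_mul, mul_smul] }

lemma CotangentExtension.baseLift_tmul {U : X.Opens} {M N R : Type} [AddCommGroup M]
    [Module (E.Sec U) M] [CommRing R] [AddCommGroup N] [Module R N] (ρ : Γ(X, U) →+* R)
    (g : M →+ N) (hg : ∀ z m, g (z • m) = ρ (E.proj U z) • g m) (a : Γ(X, U)) (m : M) :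
    E.baseLift ρ g hg (a ⊗ₜ m) = ρ a • g m := rfl

lemma smul_tmul_sec {U : X.Opens} {M : Type} [AddCommGroup M] [Module (E.Sec U) M]
    (z : E.Sec U) (a : Γ(X, U)) (ω : M) :
    a ⊗ₜ[E.Sec U] (z • ω) = E.proj U z • (a ⊗ₜ[E.Sec U] ω) :=
  (TensorProduct.smul_tmul z a ω).symm

/-- A presheaf of modules over the structure sheaf of the deformation. -/
structure CotangentExtension.SecFamily where
  obj : X.Opensᵒᵖ → Type
  [grp : ∀ U, AddCommGroup (obj U)]
  [mod : ∀ U, Module (E.Sec U.unop) (obj U)]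
  res : ∀ {U V : X.Opensᵒᵖ} (f : U ⟶ V), obj U →ₛₗ[E.res f] obj V
  res_id : ∀ (U : X.Opensᵒᵖ) (m : obj U), res (𝟙 U) m = m
  res_comp : ∀ {U V W : X.Opensᵒᵖ} (f : U ⟶ V) (g : V ⟶ W) (m : obj U),
    res (f ≫ g) m = res g (res f m)

attribute [instance] CotangentExtension.SecFamily.grp CotangentExtension.SecFamily.mod

namespace CotangentExtension

variable {E} in
/-- Restriction maps of `P ⊗ 𝒪_X`. -/
def SecFamily.tensRes (P : E.SecFamily) {U V : X.Opensᵒᵖ} (f : U ⟶ V) :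
    (Γ(X, U.unop) ⊗[E.Sec U.unop] P.obj U) →ₛₗ[oRes X f]
      (Γ(X, V.unop) ⊗[E.Sec V.unop] P.obj V) :=
  E.baseLift (oRes X f) (AddMonoidHom.mk' (fun ω => 1 ⊗ₜ P.res f ω)
      (fun x y => by rw [map_add, TensorProduct.tmul_add]))
    (fun z m => by
      change 1 ⊗ₜ P.res f (z • m) = _ • (1 ⊗ₜ P.res f m)
      rw [LinearMap.map_smulₛₗ, smul_tmul_sec, proj_res])

variable {E} in
lemma SecFamily.tensRes_tmul (P : E.SecFamily) {U V : X.Opensᵒᵖ} (f : U ⟶ V)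
    (a : Γ(X, U.unop)) (m : P.obj U) :
    P.tensRes f (a ⊗ₜ m) = oRes X f a ⊗ₜ[E.Sec V.unop] P.res f m := by
  refine (E.baseLift_tmul _ _ _ a m).trans ?_
  refine (TensorProduct.smul_tmul' _ _ _).trans ?_
  exact congrArg (fun t => t ⊗ₜ[E.Sec V.unop] P.res f m) (mul_one (oRes X f a))

variable {E} in
/-- The restriction to `X`, that is, the presheaf `U ↦ P(U) ⊗ Γ(X, U)`. -/
def SecFamily.restrict (P : E.SecFamily) : ModFamily X where
  obj U := Γ(X, U.unop) ⊗[E.Sec U.unop] P.obj U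
  res f := P.tensRes f
  res_id U m := by
    induction m using TensorProduct.induction_on with
    | zero => exact map_zero _
    | add x y hx hy => rw [map_add, hx, hy]
    | tmul a ω => rw [tensRes_tmul, P.res_id, oRes_id]
  res_comp f g m := by
    induction m using TensorProduct.induction_on with
    | zero => simp only [map_zero]
    | add x y hx hy => simp only [map_add, hx, hy]
    | tmul a ω => rw [tensRes_tmul, P.res_comp, oRes_comp, tensRes_tmul, tensRes_tmul]

variable {E} in
/-- The morphism `P ⊗ 𝒪_X → Q`, `m ⊗ a ↦ a g(m)`. -/
def SecFamily.lift (P : E.SecFamily) {Q : ModFamily X} (g : ∀ U, P.obj U →+ Q.obj U)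
    (hg : ∀ U z m, g U (z • m) = E.proj U.unop z • g U m)
    (hres : ∀ {U V : X.Opensᵒᵖ} (f : U ⟶ V) m, g V (P.res f m) = Q.res f (g U m)) :
    P.restrict.sheaf ⟶ Q.sheaf :=
  ModFamily.map (fun U => E.baseLift (RingHom.id _) (g U) (hg U))
    (fun {U V} f m => by
      change E.baseLift _ _ _ (P.tensRes f m) = _
      induction m using TensorProduct.induction_on with
      | zero =>
        have h1 := (congrArg (E.baseLift (RingHom.id _) (g V) (hg V)) (map_zero (P.tensRes f))).trans
          (map_zero _)
        have h2 := (congrArg (Q.res f) (map_zero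
          (E.baseLift (RingHom.id _) (g U) (hg U)))).trans (map_zero _)
        exact h1.trans h2.symm
      | add x y hx hy =>
        have h1 := (congrArg (E.baseLift (RingHom.id _) (g V) (hg V))
          (map_add (P.tensRes f) x y)).trans (map_add _ _ _)
        have h2 := (congrArg (Q.res f) (map_add
          (E.baseLift (RingHom.id _) (g U) (hg U)) x y)).trans (map_add _ _ _)
        exact h1.trans ((congrArg₂ (fun a b => a + b) hx hy).trans h2.symm)
      | tmul a ω =>
        rw [tensRes_tmul]
        refine (congrArg (fun t => oRes X f a • t) (hres f ω)).trans ?_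
        exact ((Q.res f).map_smulₛₗ a (g U ω)).symm)

variable {E} in
/-- The morphism `P ⊗ 𝒪_X → M`, `m ⊗ a ↦ a g(m)`. -/
def SecFamily.liftModules (P : E.SecFamily) {M : X.Modules} (g : ∀ U, P.obj U →+ Γ(M, U.unop))
    (hg : ∀ U z m, g U (z • m) = E.proj U.unop z • g U m)
    (hres : ∀ {U V : X.Opensᵒᵖ} (f : U ⟶ V) m, g V (P.res f m) = M.presheaf.map f (g U m)) :
    P.restrict.sheaf ⟶ M :=
  ModFamily.toModules (fun U => E.baseLift (RingHom.id _) (g U) (hg U))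
    (fun {U V} f m => by
      change E.baseLift _ _ _ (P.tensRes f m) = _
      induction m using TensorProduct.induction_on with
      | zero =>
        have h1 := (congrArg (E.baseLift (RingHom.id _) (g V) (hg V)) (map_zero (P.tensRes f))).trans
          (map_zero _)
        have h2 := (congrArg (M.presheaf.map f) (map_zero
          (E.baseLift (RingHom.id _) (g U) (hg U)))).trans (map_zero _)
        exact h1.trans h2.symm
      | add x y hx hy =>
        have h1 := (congrArg (E.baseLift (RingHom.id _) (g V) (hg V))
          (map_add (P.tensRes f) x y)).trans (map_add _ _ _)
        have h2 := (congrArg (M.presheaf.map f) (map_add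
          (E.baseLift (RingHom.id _) (g U) (hg U)) x y)).trans (map_add _ _ _)
        exact h1.trans ((congrArg₂ (fun a b => a + b) hx hy).trans h2.symm)
      | tmul a ω =>
        rw [tensRes_tmul]
        refine (congrArg (fun t => oRes X f a • t) (hres f ω)).trans ?_
        exact (modMap_smul M f a (g U ω)).symm)

/-- The presheaf `U ↦ Ω¹_{𝒪(U)/ℂ}` of differentials of the deformation. -/
def preOmega : PresheafOfModules.{0} (E.ring ⋙ forget₂ CommRingCat RingCat) :=
  PresheafOfModules.DifferentialsConstruction.relativeDifferentials' E.constToRing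

/-- `Ω¹_{𝒪(U)/ℂ}`. -/
abbrev Diff (U : X.Opens) : Type := CommRingCat.KaehlerDifferential (E.const U)

/-- The universal derivation of `𝒪(U)`. -/
def d (U : X.Opens) (z : E.Sec U) : E.Diff U :=
  CommRingCat.KaehlerDifferential.d (f := E.const U) z

instance (U : X.Opens) : Module (E.Sec U) (E.Diff U) :=
  (CommRingCat.KaehlerDifferential (E.const U)).isModule

lemma kaehler_induction {A B : CommRingCat.{0}} (f : A ⟶ B)
    {p : CommRingCat.KaehlerDifferential f → Prop} (ω : CommRingCat.KaehlerDifferential f)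
    (h0 : p 0) (hadd : ∀ x y, p x → p y → p (x + y))
    (hd : ∀ (b c : B), p (b • CommRingCat.KaehlerDifferential.d c)) : p ω := by
  let _ := f.hom.toAlgebra
  have h : ω ∈ Submodule.span B (Set.range (KaehlerDifferential.D A B)) := by
    rw [KaehlerDifferential.span_range_derivation]
    trivial
  refine Submodule.closure_induction (R := B) (p := fun ω _ => p ω) h0 (fun x y _ _ => hadd x y) ?_ h
  rintro b _ ⟨c, rfl⟩
  exact hd b c

/-- Restriction of differentials. -/
def diffRes {U V : X.Opensᵒᵖ} (f : U ⟶ V) : E.Diff U.unop →ₛₗ[E.res f] E.Diff V.unop where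
  toFun ω := E.preOmega.map f ω
  map_add' := map_add _
  map_smul' z ω := E.preOmega.map_smul f z ω

lemma diffRes_d {U V : X.Opensᵒᵖ} (f : U ⟶ V) (z : E.Sec U.unop) :
    E.diffRes f (E.d U.unop z) = E.d V.unop (E.res f z) :=
  PresheafOfModules.DifferentialsConstruction.relativeDifferentials'_map_d E.constToRing f z

/-- The presheaf of differentials of the deformation. -/
def diffFamily : E.SecFamily where
  obj U := E.Diff U.unop
  res f := E.diffRes f
  res_id U ω := ConcreteCategory.congr_hom (E.preOmega.presheaf.map_id U) ω
  res_comp f g ω := ConcreteCategory.congr_hom (E.preOmega.presheaf.map_comp f g) ω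

/-- `Γ(X, U) ⊗ Ω¹_{𝒪(U)/ℂ}`. -/
abbrev DiffX (U : X.Opens) : Type := Γ(X, U) ⊗[E.Sec U] E.Diff U

/-- Restriction maps of `DiffX`. -/
abbrev diffXRes {U V : X.Opensᵒᵖ} (f : U ⟶ V) : E.DiffX U.unop →ₛₗ[oRes X f] E.DiffX V.unop :=
  E.diffFamily.tensRes f

lemma diffXRes_tmul {U V : X.Opensᵒᵖ} (f : U ⟶ V) (a : Γ(X, U.unop)) (ω : E.Diff U.unop) :
    E.diffXRes f (a ⊗ₜ ω) = oRes X f a ⊗ₜ[E.Sec V.unop] E.diffRes f ω :=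
  E.diffFamily.tensRes_tmul f a ω

/-- The sheaf `Ω¹_𝒳 ⊗ 𝒪_X`, where `𝒳` is the deformation. -/
def omegaX : X.Modules := E.diffFamily.restrict.sheaf

/-- The map `Ω¹_{𝒪(U)/ℂ} → Ω¹_{Γ(X, U)/ℂ}`, `z dw ↦ z|_X d(w|_X)`. -/
def diffMap (U : X.Opens) :
    E.Diff U →+ CommRingCat.KaehlerDifferential (scalar X s U) :=
  (CommRingCat.KaehlerDifferential.map (f := E.const U) (f' := scalar X s U)
        (g := 𝟙 _) (g' := CommRingCat.ofHom (E.proj U)) rfl).hom.toAddMonoidHom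

lemma diffMap_smul (U : X.Opens) (z : E.Sec U) (ω : E.Diff U) :
    E.diffMap U (z • ω) = E.proj U z • E.diffMap U ω :=
  (CommRingCat.KaehlerDifferential.map (f := E.const U) (f' := scalar X s U)
        (g := 𝟙 _) (g' := CommRingCat.ofHom (E.proj U)) rfl).hom.map_smul z ω

lemma diffMap_d (U : X.Opens) (z : E.Sec U) :
    E.diffMap U (E.d U z) =
      CommRingCat.KaehlerDifferential.d (f := scalar X s U) (E.proj U z) :=
  CommRingCat.KaehlerDifferential.map_d (f := E.const U) (f' := scalar X s U)
        (g := 𝟙 _) (g' := CommRingCat.ofHom (E.proj U)) rfl z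

/-- The map `Ω¹_{𝒪(U)/ℂ} → Γ(Ω¹_X, U)`. -/
def diffToOmega (U : X.Opensᵒᵖ) : E.Diff U.unop →+ Γ(Omega X s, U.unop) :=
  ((toShf X (NormalCrossing.preOmega X s)).app U).hom.toAddMonoidHom.comp (E.diffMap U.unop)

lemma diffToOmega_d (U : X.Opensᵒᵖ) (z : E.Sec U.unop) :
    E.diffToOmega U (E.d U.unop z) = dOmega X s U.unop (E.proj U.unop z) :=
  congrArg ((toShf X (NormalCrossing.preOmega X s)).app U) (E.diffMap_d U.unop z)

lemma diffToOmega_smul (U : X.Opensᵒᵖ) (z : E.Sec U.unop) (ω : E.Diff U.unop) :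
    E.diffToOmega U (z • ω) = E.proj U.unop z • E.diffToOmega U ω := by
  refine (congrArg ((toShf X (NormalCrossing.preOmega X s)).app U) (E.diffMap_smul _ z ω)).trans ?_
  exact LinearMap.map_smul ((toShf X (NormalCrossing.preOmega X s)).app U).hom (E.proj U.unop z) _

lemma diffToOmega_res {U V : X.Opensᵒᵖ} (f : U ⟶ V) (ω : E.Diff U.unop) :
    E.diffToOmega V (E.diffRes f ω) = (Omega X s).presheaf.map f (E.diffToOmega U ω) := by
  induction ω using kaehler_induction with
  | h0 => simp only [map_zero]
  | hadd x y hx hy => simp only [map_add, hx, hy]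
  | hd b c =>
    refine (congrArg (E.diffToOmega V) ((E.diffRes f).map_smulₛₗ b (E.d U.unop c))).trans ?_
    rw [diffRes_d, diffToOmega_smul, diffToOmega_d, proj_res, proj_res]
    refine Eq.trans ?_ (congrArg ((Omega X s).presheaf.map f)
      ((E.diffToOmega_smul U b (E.d U.unop c)).trans
        (congrArg (fun t => E.proj U.unop b • t) (E.diffToOmega_d U c)))).symm
    refine Eq.trans ?_ (modMap_smul (Omega X s) f _ _).symm
    refine congrArg₂ (fun (a : Γ(X, V.unop)) (b : Γ(Omega X s, V.unop)) => a • b) rfl ?_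
    exact (dOmega_map X s f _).symm

/-- The restriction of differentials `Ω¹_𝒳 ⊗ 𝒪_X → Ω¹_X`. -/
def toOmega : E.omegaX ⟶ Omega X s :=
  E.diffFamily.liftModules E.diffToOmega E.diffToOmega_smul E.diffToOmega_res

/-! ### Differentials of the base -/

/-- `Ω¹_Δ` for `Δ = Spec ℂ[ε]`. -/
abbrev OmegaDelta : Type :=
  CommRingCat.KaehlerDifferential (CommRingCat.ofHom (algebraMap ℂ (DualNumber ℂ)))

instance : Module (DualNumber ℂ) OmegaDelta :=
  (CommRingCat.KaehlerDifferential (CommRingCat.ofHom (algebraMap ℂ (DualNumber ℂ)))).isModule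

/-- Restriction of sections as a `ℂ[ε]`-linear map. -/
def resLin {U V : X.Opensᵒᵖ} (f : U ⟶ V) : E.Sec U.unop →ₗ[DualNumber ℂ] E.Sec V.unop where
  toFun := E.res f
  map_add' := map_add _
  map_smul' z w := by
    change E.res f (E.dual _ z * w) = E.dual _ z * E.res f w
    rw [map_mul, res_dual]

variable (N : Type) [AddCommGroup N] [Module (DualNumber ℂ) N]

/-- The pullback of a `ℂ[ε]`-module along `π : 𝒳 → Δ`. -/
def pull : E.SecFamily where
  obj U := E.Sec U.unop ⊗[DualNumber ℂ] N
  res f :=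
    { LinearMap.rTensor N (E.resLin f) with
      map_smul' := by
        intro z m
        change LinearMap.rTensor N (E.resLin f) (z • m) =
          E.res f z • LinearMap.rTensor N (E.resLin f) m
        induction m using TensorProduct.induction_on with
        | zero => simp only [map_zero, smul_zero]
        | add x y hx hy => simp only [map_add, smul_add, hx, hy]
        | tmul a ω =>
          rw [TensorProduct.smul_tmul', LinearMap.rTensor_tmul, LinearMap.rTensor_tmul,
            TensorProduct.smul_tmul']
          exact congrArg (fun t => t ⊗ₜ[DualNumber ℂ] ω) (map_mul (E.res f) z a) }
  res_id U m := by
    change LinearMap.rTensor N (E.resLin (𝟙 U)) m = m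
    have h : E.resLin (𝟙 U) = LinearMap.id := LinearMap.ext (E.res_id U)
    rw [h, LinearMap.rTensor_id]
    rfl
  res_comp f g m := by
    change LinearMap.rTensor N (E.resLin (f ≫ g)) m =
      LinearMap.rTensor N (E.resLin g) (LinearMap.rTensor N (E.resLin f) m)
    have h : E.resLin (f ≫ g) = E.resLin g ∘ₗ E.resLin f := LinearMap.ext (E.res_comp f g)
    rw [h, LinearMap.rTensor_comp]
    rfl

/-- The sheaf `π^* N ⊗ 𝒪_X`. -/
def pullX : X.Modules := (E.pull N).restrict.sheaf

end CotangentExtension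

/-! ### Closed subschemes -/

/-- The sections over `U` of `j_* 𝒪_Z`, where `j : Z → X` is the closed subscheme defined by the
ideal sheaf `J`. -/
def Restr (J : X.IdealSheafData) (U : X.Opens) : Type :=
  Γ(J.subscheme, J.subschemeι ⁻¹ᵁ U)

instance (J : X.IdealSheafData) (U : X.Opens) : CommRing (Restr J U) :=
  inferInstanceAs (CommRing Γ(J.subscheme, J.subschemeι ⁻¹ᵁ U))

instance (J : X.IdealSheafData) (U : X.Opens) : Algebra Γ(X, U) (Restr J U) :=
  (J.subschemeι.app U).hom.toAlgebra

/-- Restriction to a smaller open subset. -/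
def restrRes (J : X.IdealSheafData) {U V : X.Opensᵒᵖ} (f : U ⟶ V) :
    Restr J U.unop →+* Restr J V.unop :=
  (J.subscheme.presheaf.map ((Opens.map J.subschemeι.base).map f.unop).op).hom

lemma restrRes_algebraMap (J : X.IdealSheafData) {U V : X.Opensᵒᵖ} (f : U ⟶ V)
    (a : Γ(X, U.unop)) :
    restrRes J f (algebraMap _ (Restr J U.unop) a) = algebraMap _ (Restr J V.unop) (oRes X f a) :=
  (ConcreteCategory.congr_hom (J.subschemeι.naturality f) a).symm

/-- Restriction to a smaller closed subscheme. -/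
def restrIncl {I J : X.IdealSheafData} (h : I ≤ J) (U : X.Opens) :
    Restr I U →+* Restr J U :=
  ((Scheme.IdealSheafData.inclusion h).appLE (I.subschemeι ⁻¹ᵁ U) (J.subschemeι ⁻¹ᵁ U)
    (by rw [← Scheme.Hom.comp_preimage, Scheme.IdealSheafData.inclusion_subschemeι])).hom

lemma restrIncl_algebraMap {I J : X.IdealSheafData} (h : I ≤ J) (U : X.Opens) (a : Γ(X, U)) :
    restrIncl h U (algebraMap _ (Restr I U) a) = algebraMap _ (Restr J U) a := by
  have h1 : I.subschemeι.app U ≫ (Scheme.IdealSheafData.inclusion h).appLE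
      (I.subschemeι ⁻¹ᵁ U) (J.subschemeι ⁻¹ᵁ U)
      (by rw [← Scheme.Hom.comp_preimage, Scheme.IdealSheafData.inclusion_subschemeι]) =
      J.subschemeι.app U := by
    rw [Scheme.Hom.app_eq_appLE, Scheme.Hom.appLE_comp_appLE, Scheme.Hom.app_eq_appLE]
    simp only [Scheme.IdealSheafData.inclusion_subschemeι]
  exact ConcreteCategory.congr_hom h1 a

lemma restrIncl_res {I J : X.IdealSheafData} (h : I ≤ J) {U V : X.Opensᵒᵖ} (f : U ⟶ V)
    (a : Restr I U.unop) :
    restrIncl h V.unop (restrRes I f a) = restrRes J f (restrIncl h U.unop a) := by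
  have := (Scheme.Hom.map_appLE (Scheme.IdealSheafData.inclusion h) (V := J.subschemeι ⁻¹ᵁ V.unop)
    (by rw [← Scheme.Hom.comp_preimage, Scheme.IdealSheafData.inclusion_subschemeι])
    ((Opens.map I.subschemeι.base).map f.unop).op).trans
    (Scheme.Hom.appLE_map (Scheme.IdealSheafData.inclusion h)
      (by rw [← Scheme.Hom.comp_preimage, Scheme.IdealSheafData.inclusion_subschemeι])
      ((Opens.map J.subschemeι.base).map f.unop).op).symm
  exact ConcreteCategory.congr_hom this a

/-- For a finite family of closed subschemes `Z k`, the presheaf `U ↦ ∏ k, 𝒪(Z k ∩ U)`, that is,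
`a_* 𝒪_Z` with `a : Z = ∐ k, Z k → X`. -/
def closedFamily {κ : Type} (J : κ → X.IdealSheafData) : ModFamily X where
  obj U := ∀ k, Restr (J k) U.unop
  res f :=
    { toFun := fun u k => restrRes (J k) f (u k)
      map_add' := fun u v => by ext k; exact map_add _ _ _
      map_smul' := fun r u => by
        ext k
        change restrRes (J k) f (r • u k) = oRes X f r • restrRes (J k) f (u k)
        rw [Algebra.smul_def, Algebra.smul_def, map_mul, restrRes_algebraMap] }
  res_id U u := by
    ext k
    exact ConcreteCategory.congr_hom ((J k).subscheme.presheaf.map_id _) (u k)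
  res_comp f g u := by
    ext k
    exact ConcreteCategory.congr_hom ((J k).subscheme.presheaf.map_comp
      ((Opens.map (J k).subschemeι.base).map f.unop).op
      ((Opens.map (J k).subschemeι.base).map g.unop).op) (u k)

/-- Restriction of functions along closed immersions, as a linear map. -/
def inclLin {I J : X.IdealSheafData} (h : I ≤ J) (U : X.Opens) : Restr I U →ₗ[Γ(X, U)] Restr J U where
  toFun := restrIncl h U
  map_add' := map_add _
  map_smul' r u := by
    rw [Algebra.smul_def, map_mul, restrIncl_algebraMap, Algebra.smul_def]
    rfl

section Strata

variable {ι : Type} (C : ι → X.IdealSheafData)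

section Order

variable [LinearOrder ι]

/-- The ideal sheaves of `X_i ∩ X_j`, for `i < j`. -/
def double (q : {q : ι × ι // q.1 < q.2}) : X.IdealSheafData := C q.1.1 ⊔ C q.1.2

/-- The ideal sheaves of `X_i ∩ X_j ∩ X_k`, for `i < j < k`. -/
def triple (q : {q : ι × ι × ι // q.1 < q.2.1 ∧ q.2.1 < q.2.2}) : X.IdealSheafData :=
  C q.1.1 ⊔ C q.1.2.1 ⊔ C q.1.2.2

/-- `a_* 𝒪_{X^{[1]}} → a_{2*} 𝒪_{X^{[2]}}`, `u ↦ (u_j - u_i)_{i < j}`. -/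
def cech1 : (closedFamily C).sheaf ⟶ (closedFamily (double C)).sheaf :=
  ModFamily.map
    (fun U => LinearMap.pi fun q =>
      (inclLin (le_sup_right : C q.1.2 ≤ double C q) U.unop).comp (LinearMap.proj q.1.2) -
      (inclLin (le_sup_left : C q.1.1 ≤ double C q) U.unop).comp (LinearMap.proj q.1.1))
    (fun {U V} f u => by
      funext q
      change restrIncl _ _ (restrRes _ f _) - restrIncl _ _ (restrRes _ f _) =
        restrRes _ f (restrIncl _ _ _ - restrIncl _ _ _)
      rw [map_sub, restrIncl_res, restrIncl_res]
      rfl)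

lemma double_le_triple₁ (q : {q : ι × ι × ι // q.1 < q.2.1 ∧ q.2.1 < q.2.2}) :
    double C ⟨(q.1.2.1, q.1.2.2), q.2.2⟩ ≤ triple C q :=
  sup_le (le_sup_right.trans le_sup_left) le_sup_right

lemma double_le_triple₂ (q : {q : ι × ι × ι // q.1 < q.2.1 ∧ q.2.1 < q.2.2}) :
    double C ⟨(q.1.1, q.1.2.2), q.2.1.trans q.2.2⟩ ≤ triple C q :=
  sup_le (le_sup_left.trans le_sup_left) le_sup_right

lemma double_le_triple₃ (q : {q : ι × ι × ι // q.1 < q.2.1 ∧ q.2.1 < q.2.2}) :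
    double C ⟨(q.1.1, q.1.2.1), q.2.1⟩ ≤ triple C q :=
  le_sup_left

/-- `a_{2*} 𝒪_{X^{[2]}} → a_{3*} 𝒪_{X^{[3]}}`, `u ↦ (u_{jk} - u_{ik} + u_{ij})_{i < j < k}`. -/
def cech2 : (closedFamily (double C)).sheaf ⟶ (closedFamily (triple C)).sheaf :=
  ModFamily.map
    (fun U => LinearMap.pi fun q =>
      (inclLin (double_le_triple₁ C q) U.unop).comp (LinearMap.proj _) -
      (inclLin (double_le_triple₂ C q) U.unop).comp (LinearMap.proj _) +
      (inclLin (double_le_triple₃ C q) U.unop).comp (LinearMap.proj _))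
    (fun {U V} f u => by
      funext q
      change restrIncl _ _ (restrRes _ f _) - restrIncl _ _ (restrRes _ f _) +
          restrIncl _ _ (restrRes _ f _) =
        restrRes _ f (restrIncl _ _ _ - restrIncl _ _ _ + restrIncl _ _ _)
      rw [map_add, map_sub, restrIncl_res, restrIncl_res, restrIncl_res]
      rfl)

lemma restrIncl_comp {I J K : X.IdealSheafData} (h : I ≤ J) (h' : J ≤ K) (U : X.Opens)
    (a : Restr I U) : restrIncl h' U (restrIncl h U a) = restrIncl (h.trans h') U a := by
  have := Scheme.Hom.appLE_comp_appLE (Scheme.IdealSheafData.inclusion h')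
    (Scheme.IdealSheafData.inclusion h) (I.subschemeι ⁻¹ᵁ U) (J.subschemeι ⁻¹ᵁ U)
    (K.subschemeι ⁻¹ᵁ U)
    (by rw [← Scheme.Hom.comp_preimage, Scheme.IdealSheafData.inclusion_subschemeι])
    (by rw [← Scheme.Hom.comp_preimage, Scheme.IdealSheafData.inclusion_subschemeι])
  simp only [Scheme.IdealSheafData.inclusion_comp] at this
  exact ConcreteCategory.congr_hom this a

lemma restrIncl_triple {I J K A B D T : X.IdealSheafData} (hJA : J ≤ A) (hKA : K ≤ A)
    (hIB : I ≤ B) (hKB : K ≤ B) (hID : I ≤ D) (hJD : J ≤ D) (hA : A ≤ T) (hB : B ≤ T) (hD : D ≤ T)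
    (U : X.Opens) (a : Restr I U) (b : Restr J U) (c : Restr K U) :
    restrIncl hA U (restrIncl hKA U c - restrIncl hJA U b) -
      restrIncl hB U (restrIncl hKB U c - restrIncl hIB U a) +
      restrIncl hD U (restrIncl hJD U b - restrIncl hID U a) = 0 := by
  simp only [map_sub, restrIncl_comp]
  ring

lemma cech1_comp_cech2 : cech1 C ≫ cech2 C = 0 := by
  have : (shf X).IsLeftAdjoint :=
    (PresheafOfModules.sheafificationAdjunction (𝟙 X.ringCatSheaf.obj)).isLeftAdjoint
  refine ((shf X).map_comp _ _).symm.trans ?_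
  refine Eq.trans (congrArg (shf X).map ?_) ((shf X).map_zero _ _)
  ext U u
  funext q
  exact restrIncl_triple _ _ _ _ _ _ _ _ _ _ _ _ _

end Order

/-- `𝒪_X → a_* 𝒪_{X^{[1]}}`. -/
def toNormalization : sheafO X ⟶ (closedFamily C).sheaf :=
  ModFamily.ofSection (P := closedFamily C) (fun U => (fun i => (1 : Restr (C i) U.unop)))
    (fun f => by
      funext i
      exact map_one (restrRes (C i) f))

end Strata

namespace CotangentExtension

/-! ### Logarithmic differentials -/

variable {ι : Type} (C : ι → X.IdealSheafData)

/-- `z ∈ 𝒪(U)` vanishes on the closed subscheme defined by `J`. -/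
def Vanishes (J : X.IdealSheafData) {U : X.Opens} (z : E.Sec U) : Prop :=
  algebraMap Γ(X, U) (Restr J U) (E.proj U z) = 0

lemma Vanishes.res {J : X.IdealSheafData} {U V : X.Opensᵒᵖ} (f : U ⟶ V) {z : E.Sec U.unop}
    (hz : E.Vanishes J z) : E.Vanishes J (E.res f z) := by
  unfold Vanishes at *
  rw [proj_res, ← restrRes_algebraMap, hz, map_zero]

/-- `m ∈ 𝒪(U)` is a local equation of `C i`: it generates the ideal sheaf of the closed subscheme
`C i` in the deformation. -/
def IsGen (i : ι) (U : X.Opens) (m : E.Sec U) : Prop :=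
  E.Vanishes (C i) m ∧
    ∀ (V : X.Opens) (_ : V ≤ U) (z : E.Sec V), E.Vanishes (C i) z →
      ∀ x ∈ V, ∃ (W : X.Opens) (hWV : W ≤ V) (hWU : W ≤ U) (_ : x ∈ W) (t : E.Sec W),
        E.res (homOfLE hWV).op z = t * E.res (homOfLE hWU).op m

lemma IsGen.res {i : ι} {U V : X.Opensᵒᵖ} (f : U ⟶ V) {m : E.Sec U.unop}
    (h : E.IsGen C i U.unop m) : E.IsGen C i V.unop (E.res f m) := by
  refine ⟨h.1.res E f, fun W hW z hz x hx => ?_⟩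
  obtain ⟨W', h1, h2, h3, t, ht⟩ := h.2 W (hW.trans f.unop.le) z hz x hx
  refine ⟨W', h1, h1.trans hW, h3, t, ht.trans ?_⟩
  congr 1
  exact E.res_comp f (homOfLE (h1.trans hW)).op m

/-- A local equation of one of the components. -/
@[ext]
structure Gens (U : X.Opens) where
  idx : ι
  eqn : E.Sec U
  isGen : E.IsGen C idx U eqn

/-- Restriction of local equations. -/
def gensRes {U V : X.Opensᵒᵖ} (f : U ⟶ V) (g : E.Gens C U.unop) : E.Gens C V.unop :=
  ⟨g.idx, E.res f g.eqn, g.isGen.res E C f⟩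

/-- The module freely generated by `Ω¹_{𝒪(U)/ℂ} ⊗ Γ(X, U)`, the symbols `dm/m` for local equations
`m` of the components, and the symbol `dε/ε`. -/
abbrev LogFree (U : X.Opens) : Type :=
  E.DiffX U × (E.Gens C U →₀ Γ(X, U)) × Γ(X, U)

/-- The symbol `d m / m`. -/
def dlog {U : X.Opens} (g : E.Gens C U) : E.LogFree C U :=
  (0, Finsupp.single g 1, 0)

/-- The differential `dz`. -/
def oneD {U : X.Opens} (z : E.Sec U) : E.LogFree C U :=
  (1 ⊗ₜ[E.Sec U] E.d U z, 0, 0)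

/-- The symbol `dε/ε`. -/
def dlogEps (U : X.Opens) : E.LogFree C U := (0, 0, 1)

/-- The relations between logarithmic differentials: `dm = m (dm/m)`,
`d(um)/(um) = dm/m + du/u` for units `u`, and `dε/ε = ∑ i, dm_i/m_i` for normalized local equations
`m_i` of the components, that is, those with `∏ i, m_i = ε`. -/
inductive LogRel [Fintype ι] (U : X.Opens) : E.LogFree C U → Prop
  | d_eq (i : ι) (m : E.Sec U) (hm : E.IsGen C i U m) :
      LogRel U (E.oneD C m - E.proj U m • E.dlog C ⟨i, m, hm⟩)
  | unit_mul (i : ι) (m m' : E.Sec U) (hm : E.IsGen C i U m) (hm' : E.IsGen C i U m')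
      (u : E.Sec U) (hu : IsUnit u) (h : m' = u * m) :
      LogRel U (E.proj U u • E.dlog C ⟨i, m', hm'⟩ - E.proj U u • E.dlog C ⟨i, m, hm⟩ - E.oneD C u)
  | eps (m : ι → E.Sec U) (hm : ∀ i, E.IsGen C i U (m i)) (h : ∏ i, m i = E.eps U) :
      LogRel U (E.dlogEps C U - ∑ i, E.dlog C ⟨i, m i, hm i⟩)

/-- The submodule of relations. -/
def logRels [Fintype ι] (U : X.Opens) : Submodule Γ(X, U) (E.LogFree C U) :=
  Submodule.span _ {r | E.LogRel C U r}

/-- Restriction maps on combinations of the symbols `dm/m`. -/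
def gensAdd {U V : X.Opensᵒᵖ} (f : U ⟶ V) :
    (E.Gens C U.unop →₀ Γ(X, U.unop)) →+ (E.Gens C V.unop →₀ Γ(X, V.unop)) :=
  (Finsupp.mapDomain.addMonoidHom (E.gensRes C f)).comp
    (Finsupp.mapRange.addMonoidHom (oRes X f).toAddMonoidHom)

lemma gensAdd_single {U V : X.Opensᵒᵖ} (f : U ⟶ V) (g : E.Gens C U.unop)
    (a : Γ(X, U.unop)) :
    E.gensAdd C f (Finsupp.single g a) = Finsupp.single (E.gensRes C f g) (oRes X f a) := by
  change Finsupp.mapDomain _ (Finsupp.mapRange (oRes X f) (map_zero _) _) = _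
  rw [Finsupp.mapRange_single, Finsupp.mapDomain_single]

/-- Restriction maps on combinations of the symbols `dm/m`. -/
def gensLin {U V : X.Opensᵒᵖ} (f : U ⟶ V) :
    (E.Gens C U.unop →₀ Γ(X, U.unop)) →ₛₗ[oRes X f] (E.Gens C V.unop →₀ Γ(X, V.unop)) :=
  { E.gensAdd C f with
    map_smul' r m := by
      change E.gensAdd C f (r • m) = _ • E.gensAdd C f m
      induction m using Finsupp.induction_linear with
      | zero => rw [smul_zero, map_zero, smul_zero]
      | add x y hx hy => rw [smul_add, map_add, hx, hy, map_add, smul_add]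
      | single a b =>
        rw [Finsupp.smul_single, gensAdd_single, gensAdd_single, Finsupp.smul_single, smul_eq_mul,
          map_mul, smul_eq_mul] }

lemma gensLin_single {U V : X.Opensᵒᵖ} (f : U ⟶ V) (g : E.Gens C U.unop)
    (a : Γ(X, U.unop)) :
    E.gensLin C f (Finsupp.single g a) = Finsupp.single (E.gensRes C f g) (oRes X f a) :=
  E.gensAdd_single C f g a

/-- Restriction maps of `LogFree`. -/
def logFreeRes {U V : X.Opensᵒᵖ} (f : U ⟶ V) :
    E.LogFree C U.unop →ₛₗ[oRes X f] E.LogFree C V.unop where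
  toFun t := (E.diffXRes f t.1, E.gensLin C f t.2.1, oRes X f t.2.2)
  map_add' x y := by simp
  map_smul' r x := by simp

lemma logFreeRes_dlog {U V : X.Opensᵒᵖ} (f : U ⟶ V) (g : E.Gens C U.unop) :
    E.logFreeRes C f (E.dlog C g) = E.dlog C (E.gensRes C f g) := by
  refine Prod.ext (map_zero _) (Prod.ext ?_ (map_zero _))
  exact (E.gensLin_single C f g 1).trans (congrArg _ (map_one _))

lemma logFreeRes_oneD {U V : X.Opensᵒᵖ} (f : U ⟶ V) (z : E.Sec U.unop) :
    E.logFreeRes C f (E.oneD C z) = E.oneD C (E.res f z) := by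
  refine Prod.ext ?_ (Prod.ext (map_zero _) (map_zero _))
  refine (E.diffXRes_tmul f 1 _).trans ?_
  rw [map_one, diffRes_d]
  rfl

lemma logFreeRes_eps {U V : X.Opensᵒᵖ} (f : U ⟶ V) :
    E.logFreeRes C f (E.dlogEps C U.unop) = E.dlogEps C V.unop :=
  Prod.ext (map_zero _) (Prod.ext (map_zero _) (map_one _))

lemma logRels_le [Fintype ι] {U V : X.Opensᵒᵖ} (f : U ⟶ V) :
    E.logRels C U.unop ≤ (E.logRels C V.unop).comap (E.logFreeRes C f) := by
  refine Submodule.span_le.2 ?_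
  rintro _ (⟨i, m, hm⟩ | ⟨i, m, m', hm, hm', u, hu, h⟩ | ⟨m, hm, h⟩)
  · refine Submodule.subset_span ?_
    have := LogRel.d_eq (E := E) (C := C) i _ (hm.res E C f)
    rw [map_sub, LinearMap.map_smulₛₗ, logFreeRes_oneD, logFreeRes_dlog, ← proj_res]
    exact this
  · refine Submodule.subset_span ?_
    have := LogRel.unit_mul (E := E) (C := C) i _ _ (hm.res E C f) (hm'.res E C f) (E.res f u)
      (hu.map _) (by rw [h, map_mul])
    rw [map_sub, map_sub, LinearMap.map_smulₛₗ, LinearMap.map_smulₛₗ, logFreeRes_oneD,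
      logFreeRes_dlog, logFreeRes_dlog, ← proj_res]
    exact this
  · refine Submodule.subset_span ?_
    have := LogRel.eps (E := E) (C := C) _ (fun i => (hm i).res E C f)
      (by rw [← map_prod, h, res_eps])
    rw [map_sub, map_sum, logFreeRes_eps]
    simp only [logFreeRes_dlog]
    exact this

/-- The module of logarithmic differentials over `U`. -/
abbrev LogMod [Fintype ι] (U : X.Opens) : Type :=
  E.LogFree C U ⧸ E.logRels C U

/-- Restriction maps of `LogMod`. -/
def logRes [Fintype ι] {U V : X.Opensᵒᵖ} (f : U ⟶ V) :
    E.LogMod C U.unop →ₛₗ[oRes X f] E.LogMod C V.unop :=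
  Submodule.mapQ _ _ (E.logFreeRes C f) (E.logRels_le C f)

lemma gensRes_id (U : X.Opensᵒᵖ) (g : E.Gens C U.unop) :
    E.gensRes C (𝟙 U) g = g := by
  obtain ⟨i, m, hm⟩ := g
  simp [gensRes, res_id]

lemma gensRes_comp {U V W : X.Opensᵒᵖ} (f : U ⟶ V) (g : V ⟶ W)
    (a : E.Gens C U.unop) : E.gensRes C (f ≫ g) a = E.gensRes C g (E.gensRes C f a) := by
  obtain ⟨i, m, hm⟩ := a
  simp [gensRes, res_comp]

lemma logFreeRes_id (U : X.Opensᵒᵖ) (m : E.LogFree C U.unop) :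
    E.logFreeRes C (𝟙 U) m = m := by
  obtain ⟨a, b, c⟩ := m
  refine Prod.ext (E.diffFamily.restrict.res_id U a) (Prod.ext ?_ (oRes_id X U c))
  change E.gensLin C (𝟙 U) b = b
  induction b using Finsupp.induction_linear with
  | zero => exact map_zero _
  | add x y hx hy => rw [map_add, hx, hy]
  | single x y => rw [gensLin_single, gensRes_id, oRes_id]

lemma logFreeRes_comp {U V W : X.Opensᵒᵖ} (f : U ⟶ V) (g : V ⟶ W)
    (m : E.LogFree C U.unop) :
    E.logFreeRes C (f ≫ g) m = E.logFreeRes C g (E.logFreeRes C f m) := by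
  obtain ⟨a, b, c⟩ := m
  refine Prod.ext (E.diffFamily.restrict.res_comp f g a) (Prod.ext ?_ (oRes_comp X f g c))
  change E.gensLin C (f ≫ g) b = E.gensLin C g (E.gensLin C f b)
  induction b using Finsupp.induction_linear with
  | zero => simp only [map_zero]
  | add x y hx hy => simp only [map_add, hx, hy]
  | single x y => simp only [gensLin_single, gensRes_comp, oRes_comp]

/-- The presheaf of logarithmic differentials. -/
def preLog [Fintype ι] : ModFamily X where
  obj U := E.LogMod C U.unop
  res f := E.logRes C f
  res_id U m := by
    obtain ⟨m, rfl⟩ := Submodule.Quotient.mk_surjective _ m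
    exact congrArg _ (E.logFreeRes_id C U m)
  res_comp f g m := by
    obtain ⟨m, rfl⟩ := Submodule.Quotient.mk_surjective _ m
    exact congrArg _ (E.logFreeRes_comp C f g m)

/-- The sheaf `Ω¹_𝒳(log X) ⊗ 𝒪_X`. -/
def omegaLog [Fintype ι] : X.Modules := (E.preLog C).sheaf

/-- The map `Ω¹_𝒳 ⊗ 𝒪_X → Ω¹_𝒳(log X) ⊗ 𝒪_X`. -/
def toLog [Fintype ι] : E.omegaX ⟶ E.omegaLog C :=
  ModFamily.map (P := E.diffFamily.restrict) (Q := E.preLog C)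
    (fun U => (E.logRels C U.unop).mkQ.comp (LinearMap.inl _ _ _))
    (fun {U V} f m => by
      refine congrArg Submodule.Quotient.mk ?_
      exact Prod.ext rfl (Prod.ext (map_zero _).symm (map_zero _).symm))

/-! ### The maps from the base -/

/-- `π^* Ω¹_Δ → Ω¹_𝒳` on sections, `z ⊗ dw ↦ z dw`. -/
def baseDiff (U : X.Opens) : OmegaDelta →+ E.Diff U :=
  (CommRingCat.KaehlerDifferential.map (f := CommRingCat.ofHom (algebraMap ℂ (DualNumber ℂ)))
    (f' := E.const U) (g := 𝟙 _) (g' := CommRingCat.ofHom (E.dual U)) (by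
      ext c : 2
      change E.const U c = E.const U c + E.const U 0 * E.eps U
      rw [map_zero, zero_mul, add_zero])).hom.toAddMonoidHom

lemma baseDiff_smul (U : X.Opens) (z : DualNumber ℂ) (ω : OmegaDelta) :
    E.baseDiff U (z • ω) = E.dual U z • E.baseDiff U ω :=
  (CommRingCat.KaehlerDifferential.map (f := CommRingCat.ofHom (algebraMap ℂ (DualNumber ℂ)))
    (f' := E.const U) (g := 𝟙 _) (g' := CommRingCat.ofHom (E.dual U)) (by
      ext c : 2
      change E.const U c = E.const U c + E.const U 0 * E.eps U
      rw [map_zero, zero_mul, add_zero])).hom.map_smul z ω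

lemma baseDiff_d (U : X.Opens) (z : DualNumber ℂ) :
    E.baseDiff U (CommRingCat.KaehlerDifferential.d
      (f := CommRingCat.ofHom (algebraMap ℂ (DualNumber ℂ))) z) = E.d U (E.dual U z) :=
  CommRingCat.KaehlerDifferential.map_d (f := CommRingCat.ofHom (algebraMap ℂ (DualNumber ℂ)))
    (f' := E.const U) (g := 𝟙 _) (g' := CommRingCat.ofHom (E.dual U)) (by
      ext c : 2
      change E.const U c = E.const U c + E.const U 0 * E.eps U
      rw [map_zero, zero_mul, add_zero]) z

lemma baseDiff_res {U V : X.Opensᵒᵖ} (f : U ⟶ V) (ω : OmegaDelta) :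
    E.diffRes f (E.baseDiff U.unop ω) = E.baseDiff V.unop ω := by
  induction ω using kaehler_induction with
  | h0 => simp only [map_zero]
  | hadd x y hx hy => simp only [map_add, hx, hy]
  | hd b c =>
    refine (congrArg (E.diffRes f) (E.baseDiff_smul U.unop b _)).trans ?_
    refine Eq.trans ?_ (E.baseDiff_smul V.unop b _).symm
    rw [baseDiff_d, baseDiff_d, LinearMap.map_smulₛₗ, diffRes_d, res_dual, res_dual]

/-- Linear maps out of `𝒪(U) ⊗ N` for a `ℂ[ε]`-module `N`. -/
def pullLift {N : Type} [AddCommGroup N] [Module (DualNumber ℂ) N] (U : X.Opens) {M : Type}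
    [AddCommGroup M] [Module (E.Sec U) M] (h : N →+ M)
    (hh : ∀ w n, h (w • n) = E.dual U w • h n) : (E.Sec U ⊗[DualNumber ℂ] N) →ₗ[E.Sec U] M :=
  let g : (E.Sec U ⊗[DualNumber ℂ] N) →+ M :=
    TensorProduct.liftAddHom
      (AddMonoidHom.mk' (fun z => AddMonoidHom.mk' (fun ω => z • h ω)
          (fun x y => by rw [map_add, smul_add]))
        (fun x y => by
          ext ω
          exact add_smul x y _))
      (fun w z ω => by
        change (E.dual U w * z) • h ω = z • h (w • ω)
        rw [hh, smul_smul, mul_comm])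
  { g with
    map_smul' := by
      intro z m
      change g (z • m) = z • g m
      induction m using TensorProduct.induction_on with
      | zero => rw [smul_zero, map_zero, smul_zero]
      | add x y hx hy => rw [smul_add, map_add, hx, hy, map_add, smul_add]
      | tmul w ω => exact mul_smul z w _ }

lemma pullLift_res {N : Type} [AddCommGroup N] [Module (DualNumber ℂ) N] {U V : X.Opensᵒᵖ}
    (f : U ⟶ V) {M M' : Type} [AddCommGroup M] [Module (E.Sec U.unop) M] [AddCommGroup M']
    [Module (E.Sec V.unop) M'] (h : N →+ M) (hh : ∀ w n, h (w • n) = E.dual U.unop w • h n)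
    (h' : N →+ M') (hh' : ∀ w n, h' (w • n) = E.dual V.unop w • h' n)
    (r : M →ₛₗ[E.res f] M') (hr : ∀ n, r (h n) = h' n)
    (m : E.Sec U.unop ⊗[DualNumber ℂ] N) :
    E.pullLift V.unop h' hh' (LinearMap.rTensor N (E.resLin f) m) =
      r (E.pullLift U.unop h hh m) := by
  induction m using TensorProduct.induction_on with
  | zero => simp only [map_zero]
  | add x y hx hy => simp only [map_add, hx, hy]
  | tmul w ω =>
    change E.res f w • h' ω = r (w • h ω)
    rw [LinearMap.map_smulₛₗ, hr]

/-- `π^* Ω¹_Δ → Ω¹_𝒳` on sections, `z ⊗ ω ↦ z π^*ω`. -/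
def pullDiff (U : X.Opensᵒᵖ) : (E.pull OmegaDelta).obj U →ₗ[E.Sec U.unop] E.Diff U.unop :=
  E.pullLift U.unop (E.baseDiff U.unop) (E.baseDiff_smul U.unop)

lemma pullDiff_res {U V : X.Opensᵒᵖ} (f : U ⟶ V) (m : (E.pull OmegaDelta).obj U) :
    E.pullDiff V ((E.pull OmegaDelta).res f m) = E.diffRes f (E.pullDiff U m) :=
  E.pullLift_res f _ _ _ _ (E.diffRes f) (E.baseDiff_res f) m

/-- The map `π^* Ω¹_Δ ⊗ 𝒪_X → Ω¹_𝒳 ⊗ 𝒪_X`. -/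
def inclBase : E.pullX OmegaDelta ⟶ E.omegaX :=
  (E.pull OmegaDelta).lift (Q := E.diffFamily.restrict)
    (fun U => AddMonoidHom.mk' (fun m => (1 ⊗ₜ E.pullDiff U m : E.DiffX U.unop))
      (fun x y => by
        rw [map_add, TensorProduct.tmul_add]
        rfl))
    (fun U z m => by
      change (1 ⊗ₜ E.pullDiff U (z • m) : E.DiffX U.unop) = _ • (1 ⊗ₜ E.pullDiff U m : E.DiffX U.unop)
      rw [map_smul, smul_tmul_sec]
      rfl)
    (fun {U V} f m => by
      change (1 ⊗ₜ E.pullDiff V _ : E.DiffX V.unop) =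
        E.diffXRes f (1 ⊗ₜ E.pullDiff U m : E.DiffX U.unop)
      rw [pullDiff_res, diffXRes_tmul, map_one])

/-- `Ω¹_Δ(log 0)` for `Δ = Spec ℂ[ε]`: the free `ℂ[ε]`-module with basis element `1 = dε/ε`. -/
abbrev OmegaDeltaLog : Type := DualNumber ℂ

/-- `π^* Ω¹_Δ(log 0) → 𝒪_𝒳` on sections, `z ⊗ w dε/ε ↦ z w`. -/
def pullCoeff (U : X.Opensᵒᵖ) : (E.pull OmegaDeltaLog).obj U →ₗ[E.Sec U.unop] E.Sec U.unop :=
  E.pullLift U.unop (E.dual U.unop).toAddMonoidHom (map_mul (E.dual U.unop))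

lemma pullCoeff_res {U V : X.Opensᵒᵖ} (f : U ⟶ V) (m : (E.pull OmegaDeltaLog).obj U) :
    E.pullCoeff V ((E.pull OmegaDeltaLog).res f m) = E.res f (E.pullCoeff U m) :=
  E.pullLift_res f _ _ _ _
    { toFun := E.res f, map_add' := map_add (E.res f), map_smul' := map_mul (E.res f) }
    (E.res_dual f) m

/-- The coefficient of `dε/ε`, restricted to `X`. -/
def pullCoeffX (U : X.Opensᵒᵖ) : (E.pull OmegaDeltaLog).obj U →+ Γ(X, U.unop) :=
  (E.proj U.unop).toAddMonoidHom.comp (E.pullCoeff U).toAddMonoidHom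

lemma pullCoeffX_smul (U : X.Opensᵒᵖ) (z : E.Sec U.unop) (m : (E.pull OmegaDeltaLog).obj U) :
    E.pullCoeffX U (z • m) = E.proj U.unop z • E.pullCoeffX U m :=
  (congrArg (E.proj U.unop) ((E.pullCoeff U).map_smul z m)).trans (map_mul _ _ _)

lemma pullCoeffX_res {U V : X.Opensᵒᵖ} (f : U ⟶ V) (m : (E.pull OmegaDeltaLog).obj U) :
    E.pullCoeffX V ((E.pull OmegaDeltaLog).res f m) = oRes X f (E.pullCoeffX U m) :=
  congrArg (E.proj V.unop) (E.pullCoeff_res f m)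

/-- The map `π^* Ω¹_Δ(log 0) ⊗ 𝒪_X → Ω¹_𝒳(log X) ⊗ 𝒪_X`, `dε/ε ↦ dε/ε`. -/
def inclBaseLog [Fintype ι] : E.pullX OmegaDeltaLog ⟶ E.omegaLog C :=
  (E.pull OmegaDeltaLog).lift (Q := E.preLog C)
    (fun U => AddMonoidHom.mk' (fun m =>
        E.pullCoeffX U m • (Submodule.Quotient.mk (E.dlogEps C U.unop) : E.LogMod C U.unop))
      (fun x y => by
        rw [map_add, add_smul]
        rfl))
    (fun U z m => by
      change E.pullCoeffX U (z • m) • (_ : E.LogMod C U.unop) = _ • E.pullCoeffX U m • _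
      rw [pullCoeffX_smul, smul_eq_mul, mul_smul]
      rfl)
    (fun {U V} f m => by
      change E.pullCoeffX V _ • (_ : E.LogMod C V.unop) = E.logRes C f (E.pullCoeffX U m • _)
      rw [pullCoeffX_res, LinearMap.map_smulₛₗ]
      exact congrArg (fun t => oRes X f (E.pullCoeffX U m) • t)
        (congrArg Submodule.Quotient.mk (E.logFreeRes_eps C f).symm))

/-! ### Residues -/

/-- The residue `π^* Ω¹_Δ(log 0) ⊗ 𝒪_X → 𝒪_X`, `dε/ε ↦ 1`. -/
def residueBase : E.pullX OmegaDeltaLog ⟶ sheafO X :=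
  (E.pull OmegaDeltaLog).liftModules (M := sheafO X) E.pullCoeffX E.pullCoeffX_smul E.pullCoeffX_res

/-- The residue on generators: it annihilates `Ω¹_𝒳`, it maps `dm/m` to the function `1` on the
component of which `m` is a local equation, and `dε/ε` to `1`. -/
def residueFree [DecidableEq ι] (U : X.Opens) :
    E.LogFree C U →ₗ[Γ(X, U)] ∀ i, Restr (C i) U :=
  (Finsupp.linearCombination Γ(X, U)
      (fun g : E.Gens C U => (Pi.single g.idx 1 : ∀ i, Restr (C i) U))).comp
    ((LinearMap.fst _ _ _).comp (LinearMap.snd _ _ _)) +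
  (LinearMap.toSpanSingleton Γ(X, U) (∀ i, Restr (C i) U) 1).comp
    ((LinearMap.snd _ _ _).comp (LinearMap.snd _ _ _))

lemma residueFree_dlog [DecidableEq ι] (U : X.Opens) (g : E.Gens C U) :
    E.residueFree C U (E.dlog C g) = Pi.single g.idx 1 := by
  simp [residueFree, dlog]

lemma residueFree_oneD [DecidableEq ι] (U : X.Opens) (z : E.Sec U) :
    E.residueFree C U (E.oneD C z) = 0 := by
  simp [residueFree, oneD]

lemma residueFree_dlogEps [DecidableEq ι] (U : X.Opens) :
    E.residueFree C U (E.dlogEps C U) = 1 := by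
  simp [residueFree, dlogEps]

lemma residueFree_rels [DecidableEq ι] [Fintype ι] (U : X.Opens) :
    E.logRels C U ≤ LinearMap.ker (E.residueFree C U) := by
  refine Submodule.span_le.2 ?_
  rintro _ (⟨i, m, hm⟩ | ⟨i, m, m', hm, hm', u, hu, h⟩ | ⟨m, hm, h⟩)
  · rw [SetLike.mem_coe, LinearMap.mem_ker, map_sub, map_smul, residueFree_dlog, residueFree_oneD,
      zero_sub, neg_eq_zero]
    funext j
    rcases eq_or_ne j i with rfl | hj
    · rw [Pi.smul_apply, Pi.single_eq_same, Algebra.smul_def, mul_one]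
      exact hm.1
    · rw [Pi.smul_apply, Pi.single_eq_of_ne hj, smul_zero]
      rfl
  · rw [SetLike.mem_coe, LinearMap.mem_ker, map_sub, map_sub, map_smul, map_smul, residueFree_dlog,
      residueFree_dlog, residueFree_oneD, sub_zero, sub_self]
  · rw [SetLike.mem_coe, LinearMap.mem_ker, map_sub, map_sum, residueFree_dlogEps]
    simp only [residueFree_dlog]
    rw [sub_eq_zero]
    exact (Finset.univ_sum_single (1 : ∀ i, Restr (C i) U)).symm

lemma residueFree_res [DecidableEq ι] {U V : X.Opensᵒᵖ} (f : U ⟶ V) (m : E.LogFree C U.unop) :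
    E.residueFree C V.unop (E.logFreeRes C f m) =
      (closedFamily C).res f (E.residueFree C U.unop m) := by
  obtain ⟨a, b, c⟩ := m
  change Finsupp.linearCombination _ _ (E.gensLin C f b) + oRes X f c • (1 : ∀ i, Restr (C i) V.unop)
    = (closedFamily C).res f (Finsupp.linearCombination _ _ b + c • (1 : ∀ i, Restr (C i) U.unop) :
      ∀ i, Restr (C i) U.unop)
  refine Eq.trans ?_ (map_add ((closedFamily C).res f)
    (Finsupp.linearCombination _ _ b : ∀ i, Restr (C i) U.unop) _).symm
  refine congrArg₂ (fun a b : ∀ i, Restr (C i) V.unop => a + b) ?_ ?_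
  · induction b using Finsupp.induction_linear with
    | zero =>
      simp only [map_zero]
      exact (map_zero ((closedFamily C).res f)).symm
    | add x y hx hy =>
      rw [map_add, map_add, hx, hy, map_add]
      exact (map_add ((closedFamily C).res f) _ _).symm
    | single x y =>
      rw [gensLin_single, Finsupp.linearCombination_single, Finsupp.linearCombination_single]
      refine Eq.trans ?_ (((closedFamily C).res f).map_smulₛₗ _ _).symm
      refine congrArg (fun t : ∀ i, Restr (C i) V.unop => oRes X f y • t) ?_
      funext j
      change (Pi.single x.idx 1 : ∀ i, Restr (C i) V.unop) j =
        restrRes (C j) f ((Pi.single x.idx 1 : ∀ i, Restr (C i) U.unop) j)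
      rcases eq_or_ne j x.idx with rfl | hj
      · rw [Pi.single_eq_same, Pi.single_eq_same, map_one]
      · rw [Pi.single_eq_of_ne hj, Pi.single_eq_of_ne hj, map_zero]
  · refine Eq.trans ?_ (((closedFamily C).res f).map_smulₛₗ _ _).symm
    refine congrArg (fun t : ∀ i, Restr (C i) V.unop => oRes X f c • t) ?_
    funext j
    exact (map_one (restrRes (C j) f)).symm

/-- The residue `Ω¹_𝒳(log X) ⊗ 𝒪_X → a_* 𝒪_{X^{[1]}}`. -/
def residue [DecidableEq ι] [Fintype ι] : E.omegaLog C ⟶ (closedFamily C).sheaf :=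
  ModFamily.map (P := E.preLog C) (Q := closedFamily C)
    (fun U => (E.logRels C U.unop).liftQ (E.residueFree C U.unop) (E.residueFree_rels C U.unop))
    (fun {U V} f m => by
      obtain ⟨m, rfl⟩ := Submodule.Quotient.mk_surjective _ m
      exact E.residueFree_res C f m)

/-- The sheaf `Ω¹_{𝒳/Δ}(log X) ⊗ 𝒪_X`, the quotient of `Ω¹_𝒳(log X) ⊗ 𝒪_X` by `dε/ε`. -/
def omegaRelLog [Fintype ι] : X.Modules := Limits.cokernel (E.inclBaseLog C)

/-- The projection `Ω¹_𝒳(log X) ⊗ 𝒪_X → Ω¹_{𝒳/Δ}(log X) ⊗ 𝒪_X`. -/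
def toRelLog [Fintype ι] : E.omegaLog C ⟶ E.omegaRelLog C := Limits.cokernel.π (E.inclBaseLog C)

end CotangentExtension

end Deformation

/-! ### Normal crossing varieties -/

/-- The coordinate ring `ℂ[x_0, …, x_n] / (x_0 ⋯ x_{k-1})` of the local model. -/
abbrev ModelRing (n k : ℕ) (hk : k ≤ n + 1) : Type :=
  MvPolynomial (Fin (n + 1)) ℂ ⧸
    Ideal.span {∏ j : Fin k, (MvPolynomial.X (Fin.castLE hk j) : MvPolynomial (Fin (n + 1)) ℂ)}

/-- `X` is an `n`-dimensional (global, simple) normal crossing variety whose components are the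
closed subschemes `C i`: every point has an affine open neighbourhood `U` with an étale map to
`x_0 ⋯ x_{k-1} = 0` in affine `(n + 1)`-space, such that each `x_j = 0` with `j < k` is the local
equation of exactly one of the `C i`, and the other `C i` do not meet `U`. -/
def IsNormalCrossing {X : Scheme.{0}} (s : X ⟶ SpecC) (n : ℕ) {ι : Type}
    (C : ι → X.IdealSheafData) : Prop :=
  ∀ x : X, ∃ (U : X.affineOpens) (_ : x ∈ U.1) (k : ℕ) (hk : k ≤ n + 1) (c : Fin k ↪ ι)
    (φ : ModelRing n k hk →+* Γ(X, U.1)),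
    φ.Etale ∧
    (∀ z : ℂ, φ (algebraMap ℂ _ z) = scalar X s U.1 z) ∧
    (∀ j : Fin k, (C (c j)).ideal U =
      Ideal.span {φ (Ideal.Quotient.mk _ (MvPolynomial.X (Fin.castLE hk j)))}) ∧
    ∀ i, i ∉ Set.range c → (C i).ideal U = ⊤

end Scheme

end NormalCrossing

end

open NormalCrossing

/-! The statement is local, and it rests on one consequence of the hypothesis on the class: near
every point `ε` is a product `∏ m_i` of generators of the ideals of the components in the
deformation (`CotangentExtension.exists_localEqs`).

This is proved as follows. On a chart étale over `x_1 ⋯ x_k = 0`, let `h_j` be the partial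
derivatives of the equation. Étaleness gives a presentation `0 → 𝒪 → 𝒪^(n+1) → Ω¹_X → 0` whose first
map is the vector `h`. If `f_j ∈ F` lifts `dx_j`, then `∑ h_j f_j = i(u)` for a function `u`, so the
presentation maps to the given extension by multiplication by `u` on `𝒪`. When the class generates
`Ext¹` over the local ring, either `u` is a unit or the presentation splits
(`isUnit_or_exists_retraction`). In the second case some `h_j` is a unit, and `f_j` can be modified
so that `u = 1`. By the Leibniz rule the lifted coordinates `(x_j, f_j)` have product `u ε`, and a
lift of `u⁻¹` is absorbed into one of them.

Given the `m_i`, the logarithmic form of `dε` is `ε ∑ dm_i/m_i`, which is zero on `X`. Hence `Ω¹_𝒳 ⊗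
𝒪_X → Ω¹_{𝒳/Δ}(log X) ⊗ 𝒪_X` factors through the cokernel of `dε`, which is `Ω¹_X`; this is `r`.
Every logarithmic form is locally `ω + ∑ a_i dm_i/m_i` with `ω` free of poles
(`LogForm.of_section`), and its residue is `(a_i|X_i)`. If the residue vanishes, each `a_i` is
locally a multiple of `m_i` on `X`, so the poles cancel: this is the middle column.

The rows do not need the `m_i`. In the first one, `d(a, m) ↦ m` detects multiples of `dε`, and a
derivation killing `ε` descends to `X` because sections vanishing on `X` are local multiples of `ε`.
The third one holds because each component equation is a nonzerodivisor modulo any nonempty set of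
the others (`RegularFamily`), a property of the coordinates of the model which survives flat base
change. Injectivity in the second row follows from the third by taking residues, and the right
column follows from the middle one by a chase of cokernels. -/

noncomputable section

namespace NormalCrossing

/-! ### Sections of sheaves of modules -/

section Sections

variable {X : Scheme.{0}} (M : X.Modules) {N : X.Modules}

/-- Restriction of sections of a sheaf of modules to a smaller open subset. -/
def secRes {U V : X.Opens} (h : V ≤ U) : Γ(M, U) →ₛₗ[oRes X (homOfLE h).op] Γ(M, V) where
  toFun m := M.presheaf.map (homOfLE h).op m
  map_add' := map_add _
  map_smul' r m := modMap_smul M (homOfLE h).op r m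

lemma secRes_trans {U V W : X.Opens} (h : V ≤ U) (h' : W ≤ V) (m : Γ(M, U)) :
    secRes M h' (secRes M h m) = secRes M (h'.trans h) m :=
  (ConcreteCategory.congr_hom (M.presheaf.map_comp (homOfLE h).op (homOfLE h').op) m).symm

lemma secRes_self {U : X.Opens} (h : U ≤ U) (m : Γ(M, U)) : secRes M h m = m :=
  ConcreteCategory.congr_hom (M.presheaf.map_id (op U)) m

variable {M} in
lemma secMap_secRes (g : M ⟶ N) {U V : X.Opens} (h : V ≤ U) (m : Γ(M, U)) :
    secMap g V (secRes M h m) = secRes N h (secMap g U m) :=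
  secMap_map g (homOfLE h).op m

lemma secMap_comp {M N K : X.Modules} (f : M ⟶ N) (g : N ⟶ K) (U : X.Opens) (m : Γ(M, U)) :
    secMap (f ≫ g) U m = secMap g U (secMap f U m) := rfl

lemma secMap_zero (U : X.Opens) (m : Γ(M, U)) : secMap (0 : M ⟶ N) U m = 0 := rfl

variable {M} in
lemma hom_ext_sec {f g : M ⟶ N} (h : ∀ U m, secMap f U m = secMap g U m) : f = g := by
  refine Scheme.Modules.hom_ext f g fun U => ?_
  ext m
  exact h U m

/-- Two sections which agree locally are equal. -/
lemma section_ext {U : X.Opens} {a b : Γ(M, U)}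
    (h : ∀ x ∈ U, ∃ (V : X.Opens) (hV : V ≤ U), x ∈ V ∧ secRes M hV a = secRes M hV b) :
    a = b := by
  choose V hV hx e using h
  refine TopCat.Sheaf.eq_of_locally_eq' ⟨M.presheaf, M.isSheaf⟩
    (fun x : U => V x.1 x.2) U (fun x => homOfLE (hV x.1 x.2)) ?_ a b (fun x => e x.1 x.2)
  intro x hxU
  exact Opens.mem_iSup.2 ⟨⟨x, hxU⟩, hx x hxU⟩

/-- Gluing of sections given by a relation which is stable under restriction and which is
locally functional. -/
lemma exists_glue {U : X.Opens} {κ : Type} (V : κ → X.Opens) (hV : ∀ k, V k ≤ U)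
    (hcov : ∀ x ∈ U, ∃ k, x ∈ V k) (t : ∀ k, Γ(M, V k))
    (ht : ∀ k l, secRes M (inf_le_left : V k ⊓ V l ≤ V k) (t k) =
      secRes M (inf_le_right : V k ⊓ V l ≤ V l) (t l)) :
    ∃ a : Γ(M, U), ∀ k, secRes M (hV k) a = t k := by
  obtain ⟨a, ha, -⟩ := TopCat.Sheaf.existsUnique_gluing' ⟨M.presheaf, M.isSheaf⟩ V U
    (fun k => homOfLE (hV k)) (fun x hx => Opens.mem_iSup.2 (hcov x hx)) t
    (fun k l => ht k l)
  exact ⟨a, ha⟩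

variable {M}

/-- Monomorphisms stay monomorphisms of presheaves of abelian groups, and there they are tested on
each open set. No such global statement holds for epimorphisms, which are treated locally below. -/
lemma secMap_injective_of_mono (f : M ⟶ N) [Mono f] (U : X.Opens) :
    Function.Injective (secMap f U) := by
  have h1 : Mono ((Scheme.Modules.toPresheaf X).map f) := inferInstance
  have h2 := (NatTrans.mono_iff_mono_app ((Scheme.Modules.toPresheaf X).map f)).1 h1 (op U)
  exact (AddCommGrpCat.mono_iff_injective _).1 h2

lemma mono_of_secMap_injective (f : M ⟶ N) (h : ∀ U, Function.Injective (secMap f U)) :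
    Mono f := by
  refine ⟨fun {Z} a b e => hom_ext_sec fun U m => h U ?_⟩
  rw [← secMap_comp, e, secMap_comp]

lemma epi_of_locally_surjective (f : M ⟶ N)
    (h : ∀ (U : X.Opens) (n : Γ(N, U)) (x : X) (_ : x ∈ U), ∃ (V : X.Opens) (hV : V ≤ U),
      x ∈ V ∧ ∃ m, secMap f V m = secRes N hV n) : Epi f := by
  refine ⟨fun {Z} a b e => hom_ext_sec fun U n => section_ext _ fun x hx => ?_⟩
  obtain ⟨V, hV, hxV, m, hm⟩ := h U n x hx
  refine ⟨V, hV, hxV, ?_⟩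
  rw [← secMap_secRes, ← secMap_secRes, ← hm, ← secMap_comp, ← secMap_comp, e]

/-- A complex of sheaves of modules which is exact on sections locally is exact. -/
lemma exact_of_locally_exact {K : X.Modules} (f : M ⟶ N) (g : N ⟶ K) (w : f ≫ g = 0)
    (h : ∀ (U : X.Opens) (n : Γ(N, U)), secMap g U n = 0 → ∀ x ∈ U,
      ∃ (V : X.Opens) (hV : V ≤ U), x ∈ V ∧ ∃ m, secMap f V m = secRes N hV n) :
    (ShortComplex.mk f g w).Exact := by
  rw [ShortComplex.exact_iff_epi_kernel_lift]
  refine epi_of_locally_surjective _ fun U n x hx => ?_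
  obtain ⟨V, hV, hxV, m, hm⟩ := h U (secMap (Limits.kernel.ι g) U n) (by
    rw [← secMap_comp, Limits.kernel.condition, secMap_zero]) x hx
  refine ⟨V, hV, hxV, m, secMap_injective_of_mono (Limits.kernel.ι g) V ?_⟩
  rw [← secMap_comp, secMap_secRes, ← hm]
  congr 2
  exact Limits.kernel.lift_ι _ _ _

/-- Exactness at the middle of a left exact sequence, on sections. -/
lemma exists_of_exact_of_mono {K : X.Modules} {f : M ⟶ N} {g : N ⟶ K} {w : f ≫ g = 0}
    (h : (ShortComplex.mk f g w).Exact) [Mono f] (U : X.Opens) (n : Γ(N, U))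
    (hn : secMap g U n = 0) : ∃ m, secMap f U m = n := by
  -- Here `f` is the kernel of `g`; passing to presheaves and evaluating at `U` are both left exact,
  -- so the kernel is computed on sections.
  let F := Scheme.Modules.toPresheaf X
  have : F.PreservesZeroMorphisms := ⟨fun _ _ => rfl⟩
  have : Limits.PreservesFiniteLimits F := by
    have : Limits.PreservesLimits F := inferInstance
    infer_instance
  have h1 : Limits.IsLimit (Limits.KernelFork.ofι f w) := h.fIsKernel
  let G : TopCat.Presheaf Ab X ⥤ Ab := (evaluation (Opens X)ᵒᵖ Ab).obj (op U)
  have : Limits.PreservesFiniteLimits G :=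
    inferInstanceAs (Limits.PreservesFiniteLimits ((evaluation (Opens X)ᵒᵖ Ab).obj (op U)))
  have : Limits.PreservesFiniteLimits (F ⋙ G) := Limits.comp_preservesFiniteLimits _ _
  have : (F ⋙ G).PreservesZeroMorphisms := ⟨fun _ _ => rfl⟩
  have h2 := Limits.KernelFork.mapIsLimit (Limits.KernelFork.ofι f w) h1 (F ⋙ G)
  have h3 : ((ShortComplex.mk f g w).map (F ⋙ G)).Exact :=
    ShortComplex.exact_of_f_is_kernel _ h2
  exact (ShortComplex.ab_exact_iff _).1 h3 n hn

end Sections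

/-! ### Sections of the sheaf associated with a presheaf of modules -/

section Sheafification

variable {X : Scheme.{0}}

/-- On underlying abelian groups the map is the unit of sheafification. This lemma and the next are
the access to sections of the sheaves under study: they are locally represented by elements of the
presheaf, and two representatives agree after shrinking. -/
lemma toShf_locally_surjective (P : X.PresheafOfModules) (U : X.Opens)
    (m : Γ((shf X).obj P, U)) (x : X) (hx : x ∈ U) :
    ∃ (V : X.Opens) (hV : V ≤ U), x ∈ V ∧ ∃ p : P.obj (op V),
      (toShf X P).app (op V) p = secRes ((shf X).obj P) hV m := by
  have h : Presheaf.IsLocallySurjective (Opens.grothendieckTopology X)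
      (toSheafify (Opens.grothendieckTopology X) P.presheaf) := inferInstance
  have h1 := Presheaf.imageSieve_mem (Opens.grothendieckTopology X)
    (toSheafify (Opens.grothendieckTopology X) P.presheaf) (U := op U) m
  obtain ⟨V, f, ⟨p, hp⟩, hxV⟩ := h1 x hx
  exact ⟨V, f.le, hxV, p, hp⟩

lemma toShf_locally_injective (P : X.PresheafOfModules) (U : X.Opens)
    (p q : P.obj (op U)) (h : (toShf X P).app (op U) p = (toShf X P).app (op U) q) (x : X)
    (hx : x ∈ U) : ∃ (V : X.Opens) (hV : V ≤ U), x ∈ V ∧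
      P.map (homOfLE hV).op p = P.map (homOfLE hV).op q := by
  have h0 : Presheaf.IsLocallyInjective (Opens.grothendieckTopology X)
      (toSheafify (Opens.grothendieckTopology X) P.presheaf) := inferInstance
  have h1 := Presheaf.equalizerSieve_mem (Opens.grothendieckTopology X)
    (toSheafify (Opens.grothendieckTopology X) P.presheaf) (X := op U) p q h
  obtain ⟨V, f, hp, hxV⟩ := h1 x hx
  exact ⟨V, f.le, hxV, hp⟩

namespace ModFamily

variable (P Q : ModFamily X)

instance (U : X.Opens) : Module Γ(X, U) (P.obj (op U)) := P.mod (op U)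

/-- The section of the associated sheaf given by an element. -/
def toSec (U : X.Opens) : P.obj (op U) →ₗ[Γ(X, U)] Γ(P.sheaf, U) where
  toFun m := (toShf X P.presheaf).app (op U) m
  map_add' := map_add ((toShf X P.presheaf).app (op U)).hom
  map_smul' := LinearMap.map_smul ((toShf X P.presheaf).app (op U)).hom

variable {P Q}

lemma secRes_toSec {U V : X.Opens} (h : V ≤ U) (m : P.obj (op U)) :
    secRes P.sheaf h (P.toSec U m) = P.toSec V (P.res (homOfLE h).op m) :=
  (PresheafOfModules.naturality_apply (toShf X P.presheaf) (homOfLE h).op m).symm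

lemma toSec_locally_surjective {U : X.Opens} (m : Γ(P.sheaf, U)) {x : X} (hx : x ∈ U) :
    ∃ (V : X.Opens) (hV : V ≤ U), x ∈ V ∧ ∃ p : P.obj (op V), P.toSec V p = secRes P.sheaf hV m :=
  toShf_locally_surjective P.presheaf U m x hx

lemma toSec_locally_injective {U : X.Opens} (p : P.obj (op U)) (h : P.toSec U p = 0) {x : X}
    (hx : x ∈ U) : ∃ (V : X.Opens) (hV : V ≤ U), x ∈ V ∧ P.res (homOfLE hV).op p = 0 := by
  obtain ⟨V, hV, hxV, e⟩ := toShf_locally_injective P.presheaf U p (0 : P.obj (op U))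
    (h.trans (map_zero (P.toSec U)).symm) x hx
  exact ⟨V, hV, hxV, e.trans (map_zero (P.res (homOfLE hV).op))⟩

lemma secMap_shf_map (g : P.presheaf ⟶ Q.presheaf) (U : X.Opens) (m : P.obj (op U)) :
    secMap (show P.sheaf ⟶ Q.sheaf from (shf X).map g) U (P.toSec U m) =
      Q.toSec U (g.app (op U) m) := by
  have h := (PresheafOfModules.sheafificationAdjunction (𝟙 X.ringCatSheaf.obj)).unit.naturality g
  have h1 := congrArg (fun g => PresheafOfModules.Hom.app g (op U)) h
  exact (ConcreteCategory.congr_hom h1 m).symm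

lemma secMap_homEquiv_symm {M : X.Modules} (g : P.presheaf ⟶ M.val) (U : X.Opens)
    (m : P.obj (op U)) :
    secMap (show P.sheaf ⟶ M from ((PresheafOfModules.sheafificationAdjunction
      (𝟙 X.ringCatSheaf.obj)).homEquiv P.presheaf M).symm g) U (P.toSec U m) =
      g.app (op U) m := by
  have h := (PresheafOfModules.sheafificationAdjunction (𝟙 X.ringCatSheaf.obj)).homEquiv_unit
    P.presheaf M (f := ((PresheafOfModules.sheafificationAdjunction
      (𝟙 X.ringCatSheaf.obj)).homEquiv P.presheaf M).symm g)
  have h1 := congrArg (fun g => PresheafOfModules.Hom.app g (op U))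
    ((Equiv.apply_symm_apply _ _).symm.trans h)
  exact (ConcreteCategory.congr_hom h1 m).symm

/-- Two morphisms out of an associated sheaf agree if they do so on the presheaf. -/
lemma hom_ext_toSec {M : X.Modules} {f g : P.sheaf ⟶ M}
    (h : ∀ U p, secMap f U (P.toSec U p) = secMap g U (P.toSec U p)) : f = g := by
  refine hom_ext_sec fun U m => section_ext _ fun x hx => ?_
  obtain ⟨V, hV, hxV, p, hp⟩ := toSec_locally_surjective m hx
  exact ⟨V, hV, hxV, by rw [← secMap_secRes, ← secMap_secRes, ← hp, h]⟩

end ModFamily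

/-- The presheaf cokernel of a morphism of sheaves of modules. -/
def quotFamily {M N : X.Modules} (f : M ⟶ N) : ModFamily X where
  obj U := Γ(N, U.unop) ⧸ LinearMap.range (secMap f U.unop)
  res {U V} g := Submodule.mapQ _ _ (secRes N g.unop.le) (by
    rintro _ ⟨m, rfl⟩
    exact ⟨secRes M g.unop.le m, secMap_secRes f g.unop.le m⟩)
  res_id U m := by
    obtain ⟨m, rfl⟩ := Submodule.Quotient.mk_surjective _ m
    exact congrArg Submodule.Quotient.mk (secRes_self N _ m)
  res_comp g g' m := by
    obtain ⟨m, rfl⟩ := Submodule.Quotient.mk_surjective _ m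
    exact congrArg Submodule.Quotient.mk (secRes_trans N g.unop.le g'.unop.le m).symm

/-- Epimorphisms of sheaves of modules are locally surjective on sections. -/
lemma locally_surjective_of_epi {M N : X.Modules} (f : M ⟶ N) [Epi f] (U : X.Opens) (n : Γ(N, U))
    (x : X) (hx : x ∈ U) :
    ∃ (V : X.Opens) (hV : V ≤ U), x ∈ V ∧ ∃ m, secMap f V m = secRes N hV n := by
  let Q := quotFamily f
  -- The projection to the sheafified presheaf cokernel kills `f`, so it is zero since `f` is an
  -- epimorphism. The class of `n` therefore vanishes locally in the presheaf cokernel, which says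
  -- that `n` is locally in the image.
  let q : N ⟶ Q.sheaf :=
    ⟨{ app := fun U => ModuleCat.ofHom (X := N.val.obj U) (Y := Q.presheaf.obj U)
        { toFun := fun n => (Submodule.Quotient.mk n : Q.obj U)
          map_add' := fun _ _ => rfl
          map_smul' := fun _ _ => rfl }
       naturality := fun f => by ext m; rfl } ≫ toShf X Q.presheaf⟩
  have hq : ∀ (V : X.Opens) (n : Γ(N, V)), secMap q V n = Q.toSec V (Submodule.Quotient.mk n) :=
    fun V n => rfl
  have h0 : q = 0 := by
    rw [← cancel_epi f]
    refine hom_ext_sec fun V m => ?_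
    rw [secMap_comp, hq]
    refine Eq.trans (congrArg _ ?_) (map_zero (Q.toSec V))
    exact (Submodule.Quotient.mk_eq_zero _).2 ⟨m, rfl⟩
  have h1 : Q.toSec U (Submodule.Quotient.mk n) = 0 := by
    rw [← hq, h0]
    rfl
  obtain ⟨V, hV, hxV, e⟩ := ModFamily.toSec_locally_injective _ h1 hx
  obtain ⟨m, hm⟩ := (Submodule.Quotient.mk_eq_zero _).1 e
  exact ⟨V, hV, hxV, m, hm⟩

end Sheafification

/-! ### Families of elements which are regular modulo each other -/

section RegularFamily

variable {A ι : Type} [CommRing A]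

/-- Each member of the family is a nonzerodivisor modulo any nonempty finite set of other
members. -/
def RegularFamily (y : ι → A) : Prop :=
  ∀ (T : Finset ι), T.Nonempty → ∀ j ∉ T, ∀ a : A,
    a * y j ∈ Ideal.span (y '' T) → a ∈ Ideal.span (y '' T)

namespace RegularFamily

variable {y : ι → A} (hy : RegularFamily y)

include hy

/-- The factors are cancelled one at a time. The set `T` has to be nonempty: on a chart the product
of all equations is zero, so they are regular on the divisors but not in the ring itself. -/
lemma mem_of_mul_prod_mem {J T : Finset ι} (hT : T.Nonempty) (hJT : Disjoint J T) {a : A}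
    (h : a * ∏ j ∈ J, y j ∈ Ideal.span (y '' T)) : a ∈ Ideal.span (y '' T) := by
  classical
  induction J using Finset.induction_on with
  | empty => simpa using h
  | insert s J hs ih =>
    rw [Finset.disjoint_insert_left] at hJT
    refine ih hJT.2 (hy T hT s hJT.1 _ ?_)
    rw [Finset.prod_insert hs] at h
    convert h using 1
    ring

variable [DecidableEq ι]

/-- Modulo `T`, divisibility by each `y j` is divisibility by their product. If `a = b ∏_J y` modulo
`T` and `a ∈ (y s, T)`, cancelling the product modulo `(y s, T)` gives `b ∈ (y s, T)`. Regularity is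
used only modulo sets containing `s`, so `T` itself may be empty. -/
lemma mem_of_forall_mem {J T : Finset ι} (hJT : Disjoint J T) {a : A}
    (h : ∀ j ∈ J, a ∈ Ideal.span (y '' ↑(insert j T))) :
    a ∈ Ideal.span {∏ j ∈ J, y j} ⊔ Ideal.span (y '' T) := by
  induction J using Finset.induction_on with
  | empty => simp
  | insert s J hs ih =>
    rw [Finset.disjoint_insert_left] at hJT
    obtain ⟨b', hb', t, ht, rfl⟩ := Submodule.mem_sup.1
      (ih hJT.2 (fun j hj => h j (Finset.mem_insert_of_mem hj)))
    obtain ⟨b, rfl⟩ := Ideal.mem_span_singleton'.1 hb'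
    have h1 := h s (Finset.mem_insert_self s J)
    have h2 : Ideal.span (y '' T) ≤ Ideal.span (y '' ↑(insert s T)) :=
      Ideal.span_mono (Set.image_mono (by simp))
    have h3 : b ∈ Ideal.span (y '' ↑(insert s T)) :=
      hy.mem_of_mul_prod_mem (J := J) (Finset.insert_nonempty s T)
        (Finset.disjoint_insert_right.2 ⟨hs, hJT.2⟩)
        ((Ideal.add_mem_iff_left _ (h2 ht)).1 h1)
    rw [Finset.coe_insert, Set.image_insert_eq, Ideal.mem_span_insert] at h3
    obtain ⟨c, t', ht', rfl⟩ := h3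
    refine Submodule.mem_sup.2 ⟨c * ∏ j ∈ insert s J, y j,
      Ideal.mem_span_singleton'.2 ⟨c, rfl⟩, t' * (∏ j ∈ J, y j) + t,
      Ideal.add_mem _ (Ideal.mul_mem_right _ _ ht') ht, ?_⟩
    rw [Finset.prod_insert hs]
    ring

omit [DecidableEq ι] in
-- The intersection of all `(y i)` is generated by the product of the `y i`. For a chart this is the
-- injectivity of `𝒪_X → a_* 𝒪_{X^{[1]}}`.
lemma eq_zero_of_forall_mem [Fintype ι] (h0 : ∏ i, y i = 0) {a : A}
    (h : ∀ i, a ∈ Ideal.span {y i}) : a = 0 := by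
  classical
  have := hy.mem_of_forall_mem (J := Finset.univ) (T := ∅) (by simp) (a := a)
    (fun j _ => by simpa using h j)
  simpa [h0] using this

/-- Sums and intersections of these ideals distribute: the multiple of `∏_J y` found in
`mem_of_forall_mem` lies in all the `(y j)` at once. Distributivity is what makes gluing along the
components possible. -/
lemma mem_inf_sup {J T : Finset ι} (hJT : Disjoint J T) {a : A}
    (h : ∀ j ∈ J, a ∈ Ideal.span {y j} ⊔ Ideal.span (y '' T)) :
    ∃ b, (∀ j ∈ J, b ∈ Ideal.span {y j}) ∧ a - b ∈ Ideal.span (y '' T) := by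
  obtain ⟨b, hb, t, ht, rfl⟩ := Submodule.mem_sup.1 (hy.mem_of_forall_mem hJT (a := a)
    (fun j hj => by
      rw [Finset.coe_insert, Set.image_insert_eq, Set.insert_eq, Ideal.span_union]
      exact h j hj))
  refine ⟨b, fun j hj => ?_, by simpa using ht⟩
  refine (Ideal.span_singleton_le_span_singleton.2 (Finset.dvd_prod_of_mem y hj)) hb

/-- A compatible family of functions on the divisors `y j = 0`, modulo some other `y i`. -/
lemma exists_glue_mod {J T : Finset ι} (hJT : Disjoint J T) (u : ι → A)
    (h : ∀ i ∈ J, ∀ j ∈ J, u j - u i ∈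
      Ideal.span {y i} ⊔ Ideal.span {y j} ⊔ Ideal.span (y '' T)) :
    ∃ a, ∀ j ∈ J, a - u j ∈ Ideal.span {y j} ⊔ Ideal.span (y '' T) := by
  induction J using Finset.induction_on with
  | empty => exact ⟨0, by simp⟩
  | insert s J hs ih =>
    rw [Finset.disjoint_insert_left] at hJT
    obtain ⟨a, ha⟩ := ih hJT.2 (fun i hi j hj => h i (Finset.mem_insert_of_mem hi) j
      (Finset.mem_insert_of_mem hj))
    have hins : Ideal.span (y '' ↑(insert s T)) = Ideal.span {y s} ⊔ Ideal.span (y '' T) := by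
      rw [Finset.coe_insert, Set.image_insert_eq, Set.insert_eq, Ideal.span_union]
    -- The function `a` already has the right values on the divisors in `J`. For each of them `a - u
    -- s` lies in `(y j, y s, T)`, so modulo `(y s, T)` it equals some `b` vanishing on all these
    -- divisors. Then `a - b` keeps the values on `J` and takes the value `u s` on the new divisor.
    obtain ⟨b, hb, hab⟩ := hy.mem_inf_sup (J := J) (T := insert s T) (a := a - u s)
      (Finset.disjoint_insert_right.2 ⟨hs, hJT.2⟩) (fun j hj => by
        rw [hins, ← sub_add_sub_cancel a (u j) (u s), ← sup_assoc]
        refine Ideal.add_mem _ ?_ (h s (Finset.mem_insert_self s J) j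
          (Finset.mem_insert_of_mem hj) |> fun t => by rwa [sup_comm (Ideal.span {y j})])
        exact (show Ideal.span {y j} ⊔ Ideal.span (y '' T) ≤
          Ideal.span {y j} ⊔ Ideal.span {y s} ⊔ Ideal.span (y '' T) from
          sup_le_sup_right le_sup_left _) (ha j hj))
    refine ⟨a - b, fun j hj => ?_⟩
    rcases Finset.mem_insert.1 hj with rfl | hj
    · rw [hins] at hab
      convert hab using 1
      ring
    · convert Ideal.sub_mem _ (ha j hj) (Ideal.mem_sup_left (hb j hj)) using 1
      ring

lemma exists_glue [Fintype ι] (u : ι → A)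
    (h : ∀ i j, u j - u i ∈ Ideal.span {y i} ⊔ Ideal.span {y j}) :
    ∃ a, ∀ j, a - u j ∈ Ideal.span {y j} := by
  obtain ⟨a, ha⟩ := hy.exists_glue_mod (J := Finset.univ) (T := ∅) (by simp) u
    (fun i _ j _ => by simpa using h i j)
  exact ⟨a, fun j => by simpa using ha j (Finset.mem_univ j)⟩

omit hy [DecidableEq ι] in
/-- A cocycle on the double loci is a coboundary. -/
lemma exists_coboundary [Fintype ι] [LinearOrder ι] (hy : RegularFamily y) (v : ι → ι → A)
    (h : ∀ i j k, i < j → j < k → v j k - v i k + v i j ∈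
      Ideal.span {y i} ⊔ Ideal.span {y j} ⊔ Ideal.span {y k}) :
    ∃ u : ι → A, ∀ i j, i < j → v i j - (u j - u i) ∈ Ideal.span {y i} ⊔ Ideal.span {y j} := by
  suffices H : ∀ J : Finset ι, ∃ u : ι → A, ∀ i ∈ J, ∀ j ∈ J, i < j →
      v i j - (u j - u i) ∈ Ideal.span {y i} ⊔ Ideal.span {y j} by
    obtain ⟨u, hu⟩ := H Finset.univ
    exact ⟨u, fun i j => hu i (Finset.mem_univ i) j (Finset.mem_univ j)⟩
  intro J
  -- Indices are added in increasing order, so the new index `r` occurs only in second position and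
  -- only the entries `v i r` are involved.
  induction J using Finset.induction_on_max with
  | empty => exact ⟨0, by simp⟩
  | insert r J hr ih =>
    obtain ⟨u, hu⟩ := ih
    -- The wanted `u r` must restrict to `v i r + u i` on `y i = y r = 0` for every `i ∈ J`. By the
    -- cocycle condition these functions agree on the triple loci, so they glue on the divisor `y r
    -- = 0`.
    have key : ∀ i ∈ J, ∀ j ∈ J, i < j → (v j r + u j) - (v i r + u i) ∈
        Ideal.span {y i} ⊔ Ideal.span {y j} ⊔ Ideal.span (y '' ↑({r} : Finset ι)) := by
      intro i hi j hj hij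
      rw [Finset.coe_singleton, Set.image_singleton]
      have h1 := h i j r hij (hr j hj)
      have h2 := Ideal.mem_sup_left (T := Ideal.span {y r}) (hu i hi j hj hij)
      convert Ideal.sub_mem _ h1 h2 using 1
      ring
    obtain ⟨a, ha⟩ := hy.exists_glue_mod (J := J) (T := {r})
      (Finset.disjoint_singleton_right.2 fun hrJ => lt_irrefl _ (hr r hrJ))
      (fun i => v i r + u i) (fun i hi j hj => by
        rcases lt_trichotomy i j with hij | rfl | hij
        · exact key i hi j hj hij
        · simp
        · have := key j hj i hi hij
          rw [sup_comm (Ideal.span {y i}), ← neg_sub, Ideal.neg_mem_iff]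
          exact this)
    refine ⟨Function.update u r a, fun i hi j hj hij => ?_⟩
    have hne : ∀ l ∈ J, l ≠ r := fun l hl e => lt_irrefl _ (e ▸ hr l hl)
    rcases Finset.mem_insert.1 hi with rfl | hi'
    · rcases Finset.mem_insert.1 hj with rfl | hj'
      · exact absurd hij (lt_irrefl _)
      · exact absurd (hr j hj') (not_lt_of_gt hij)
    · rcases Finset.mem_insert.1 hj with rfl | hj'
      · rw [Function.update_self, Function.update_of_ne (hne i hi')]
        have := ha i hi'
        rw [Finset.coe_singleton, Set.image_singleton] at this
        rw [← Ideal.neg_mem_iff]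
        convert this using 1
        ring
      · rw [Function.update_of_ne (hne i hi'), Function.update_of_ne (hne j hj')]
        exact hu i hi' j hj' hij

/-- The partial derivatives of `∏ i, y i = 0` have no common annihilator. -/
lemma eq_zero_of_forall_mul_prod_eq_zero [Fintype ι] (h0 : ∏ i, y i = 0) {a : A}
    (h : ∀ i, a * ∏ j ∈ Finset.univ.erase i, y j = 0) : a = 0 := by
  refine hy.eq_zero_of_forall_mem h0 fun i => ?_
  have := hy.mem_of_mul_prod_mem (J := Finset.univ.erase i) (T := {i}) (a := a) (by simp)
    (by simp) (by rw [h i]; exact Ideal.zero_mem _)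
  simpa using this

end RegularFamily

/-- Extension of a regular family by units. -/
lemma RegularFamily.extend_one {κ : Type} {x : κ → A} (hx : RegularFamily x) (c : κ ↪ ι)
    (y : ι → A) (hc : ∀ j, y (c j) = x j) (h1 : ∀ i, i ∉ Set.range c → y i = 1) :
    RegularFamily y := by
  classical
  intro T hT j hj a ha
  by_cases hjc : j ∈ Set.range c
  swap
  · rwa [h1 j hjc, mul_one] at ha
  by_cases hTc : ∀ t ∈ T, t ∈ Set.range c
  swap
  · push Not at hTc
    obtain ⟨t, htT, ht⟩ := hTc
    have : Ideal.span (y '' T) = ⊤ :=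
      Ideal.eq_top_of_isUnit_mem _ (Ideal.subset_span ⟨t, htT, rfl⟩) (h1 t ht ▸ isUnit_one)
    rw [this]
    trivial
  obtain ⟨j, rfl⟩ := hjc
  have hcT : y '' T = x '' ↑(T.preimage c c.injective.injOn) := by
    ext z
    constructor
    · rintro ⟨t, ht, rfl⟩
      obtain ⟨l, rfl⟩ := hTc t ht
      exact ⟨l, by simpa using ht, (hc l).symm⟩
    · rintro ⟨l, hl, rfl⟩
      exact ⟨c l, by simpa using hl, hc l⟩
  rw [hcT, hc] at ha
  rw [hcT]
  refine hx _ ?_ j (by simpa using hj) a ha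
  obtain ⟨t, ht⟩ := hT
  obtain ⟨l, rfl⟩ := hTc t ht
  exact ⟨l, by simpa using ht⟩

end RegularFamily

/-! ### Regularity of the coordinates of the local model and flat base change -/

section Model

/-- The ideal is monomial: membership means that every monomial of the support involves a variable
of `T`. Multiplication by `X j` shifts the support and adds only the variable `j`, which is not in
`T`. -/
lemma MvPolynomial.mem_span_X_of_mul_X_mem {σ : Type} {T : Set σ} {j : σ} (hj : j ∉ T)
    {q : MvPolynomial σ ℂ}
    (h : q * MvPolynomial.X j ∈ Ideal.span (MvPolynomial.X '' T : Set (MvPolynomial σ ℂ))) :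
    q ∈ Ideal.span (MvPolynomial.X '' T : Set (MvPolynomial σ ℂ)) := by
  rw [MvPolynomial.mem_ideal_span_X_image] at h ⊢
  intro m hm
  obtain ⟨i, hi, hne⟩ := h (m + Finsupp.single j 1) (by
    rw [MvPolynomial.mem_support_iff, MvPolynomial.coeff_mul_X]
    exact MvPolynomial.mem_support_iff.1 hm)
  refine ⟨i, hi, ?_⟩
  rwa [Finsupp.add_apply, Finsupp.single_eq_of_ne (by rintro rfl; exact hj hi), add_zero] at hne

variable {n k : ℕ} (hk : k ≤ n + 1)

/-- The coordinates of the local model. -/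
def modelX (j : Fin (n + 1)) : ModelRing n k hk := Ideal.Quotient.mk _ (MvPolynomial.X j)

lemma prod_modelX : ∏ j : Fin k, modelX hk (Fin.castLE hk j) = 0 := by
  change ∏ j : Fin k, Ideal.Quotient.mk _ (MvPolynomial.X (Fin.castLE hk j)) = 0
  rw [← map_prod, Ideal.Quotient.eq_zero_iff_mem]
  exact Ideal.mem_span_singleton_self _

/-- For nonempty `T` the defining product already lies in `(X_t : t ∈ T)`, so the membership
question lifts to the polynomial ring. -/
lemma regularFamily_modelX : RegularFamily (fun j : Fin k => modelX hk (Fin.castLE hk j)) := by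
  intro T hT j hj a ha
  obtain ⟨q, rfl⟩ := Ideal.Quotient.mk_surjective a
  let I : Ideal (MvPolynomial (Fin (n + 1)) ℂ) :=
    Ideal.span {∏ j : Fin k, (MvPolynomial.X (Fin.castLE hk j))}
  let K : Ideal (MvPolynomial (Fin (n + 1)) ℂ) :=
    Ideal.span (MvPolynomial.X '' (Fin.castLE hk '' (T : Set (Fin k))))
  have hK : Ideal.span ((fun j : Fin k => modelX hk (Fin.castLE hk j)) '' T) =
      K.map (Ideal.Quotient.mk I) := by
    rw [Ideal.map_span, Set.image_image, Set.image_image]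
    rfl
  have hIK : I ≤ K := by
    obtain ⟨t, ht⟩ := hT
    refine (Ideal.span_singleton_le_iff_mem _).2 ?_
    exact Ideal.mem_of_dvd _ (Finset.dvd_prod_of_mem _ (Finset.mem_univ t))
      (Ideal.subset_span ⟨_, ⟨t, ht, rfl⟩, rfl⟩)
  have hmem : ∀ p, Ideal.Quotient.mk I p ∈ K.map (Ideal.Quotient.mk I) ↔ p ∈ K := by
    intro p
    rw [← Ideal.mem_comap, Ideal.comap_map_of_surjective _ Ideal.Quotient.mk_surjective]
    change p ∈ K ⊔ RingHom.ker (Ideal.Quotient.mk I) ↔ _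
    rw [Ideal.mk_ker, sup_eq_left.2 hIK]
  rw [hK] at ha ⊢
  have ha' : Ideal.Quotient.mk I (q * MvPolynomial.X (Fin.castLE hk j)) ∈
      K.map (Ideal.Quotient.mk I) := by
    rw [map_mul]
    exact ha
  refine (hmem q).2 (MvPolynomial.mem_span_X_of_mul_X_mem ?_ ((hmem _).1 ha'))
  rintro ⟨l, hl, e⟩
  exact hj (Fin.castLE_injective hk e ▸ hl)

/-- Flat base change of regular families. -/
lemma RegularFamily.algebraMap_of_flat {A B κ : Type} [CommRing A] [CommRing B] [Algebra B A]
    [Module.Flat B A] {x : κ → B} (hx : RegularFamily x) :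
    RegularFamily (fun j => algebraMap B A (x j)) := by
  intro T hT j hj a ha
  obtain ⟨f, hf⟩ := (Submodule.mem_span_image_finset_iff_exists_fun A).1 ha
  -- The membership of `a * x j` in the ideal is a linear relation over `B` with coefficients `x j`
  -- and `-x t` between `a` and the `f t`. By the equational criterion of flatness `a = ∑ r_p z_p`,
  -- where each `r_p * x j` lies in the ideal of `T` in `B`; regularity in `B` puts `r_p` in that
  -- ideal.
  have hrel : ∑ o : Option T, Option.elim o (x j) (fun t => - x t) • Option.elim o a f = 0 := by
    rw [Fintype.sum_option]
    simp only [Option.elim, Algebra.smul_def]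
    have hs : ∑ t : T, algebraMap B A (-x t) * f t = -(a * algebraMap B A (x j)) := by
      rw [← hf, ← Finset.sum_neg_distrib]
      exact Finset.sum_congr rfl fun t _ => by rw [smul_eq_mul, map_neg]; ring
    rw [hs]
    ring
  have h0 : Module.IsTrivialRelation (R := B) (M := A) (ι := Option T)
      (fun o => Option.elim o (x j) (fun t => - x t)) (fun o => Option.elim o a f) :=
    Module.Flat.isTrivialRelation_of_sum_smul_eq_zero hrel
  obtain ⟨l, r, z, h1, h2⟩ := h0
  have ha' : a = ∑ p, r none p • z p := h1 none
  rw [ha']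
  refine Ideal.sum_mem _ fun p _ => ?_
  rw [Algebra.smul_def]
  refine Ideal.mul_mem_right _ _ ?_
  have h3 := h2 p
  rw [Fintype.sum_option] at h3
  simp only [Option.elim] at h3
  have h4 : r none p ∈ Ideal.span (x '' T) := by
    refine hx T hT j hj _ ?_
    rw [mul_comm, eq_neg_of_add_eq_zero_left h3]
    refine (Ideal.neg_mem_iff _).2 (Ideal.sum_mem _ fun t _ => ?_)
    exact Ideal.mul_mem_right _ _ ((Ideal.neg_mem_iff _).2 (Ideal.subset_span ⟨t, t.2, rfl⟩))
  have h5 := Ideal.mem_map_of_mem (algebraMap B A) h4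
  rw [Ideal.map_span, Set.image_image] at h5
  exact h5

lemma RegularFamily.map_of_flat {A B κ : Type} [CommRing A] [CommRing B] {x : κ → B}
    (hx : RegularFamily x) (φ : B →+* A) (hφ : φ.Flat) : RegularFamily (fun j => φ (x j)) := by
  let _ := φ.toAlgebra
  have : Module.Flat B A := hφ
  exact hx.algebraMap_of_flat (A := A)

end Model

/-! ### Sections of the deformation -/

section SqZeroUnits

variable {A Ω F : Type} [CommRing A] [AddCommGroup Ω] [Module A Ω]
    [AddCommGroup F] [Module A F] {D : Derivation ℤ A Ω} {p : F →ₗ[A] Ω}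

/-- The inverse of `(a, m)` is `(a⁻¹, -a⁻² m)`, which belongs to the fibre product because `D a⁻¹ =
-a⁻² D a`. -/
lemma SqZero.isUnit_of_isUnit_fst {z : SqZero D p} (h : IsUnit z.fst) : IsUnit z := by
  obtain ⟨u, hu⟩ := h
  have hD := D.leibniz_of_mul_eq_one (a := (↑u⁻¹ : A)) (b := z.fst) (by simp [← hu])
  refine IsUnit.of_mul_eq_one ⟨↑u⁻¹, -((↑u⁻¹ : A) ^ 2 • z.snd), ?_⟩ ?_
  · rw [map_neg, map_smul, z.cond, hD, neg_smul]
  · refine SqZero.ext ?_ ?_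
    · simp [← hu]
    · simp only [SqZero.mul_snd, SqZero.one_snd, ← hu, smul_neg, smul_smul]
      rw [pow_two, ← mul_assoc, Units.mul_inv, one_mul, neg_add_cancel]

lemma SqZero.prod_fst {κ : Type} (J : Finset κ) (z : κ → SqZero D p) :
    (∏ j ∈ J, z j).fst = ∏ j ∈ J, (z j).fst :=
  map_prod (SqZero.fstHom (D := D) (p := p)) z J

/-- The second component obeys the Leibniz rule. Applied to lifts of the coordinates, it produces
the partial derivatives of the equation of the model. -/
lemma SqZero.prod_snd {κ : Type} [DecidableEq κ] (J : Finset κ) (z : κ → SqZero D p) :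
    (∏ j ∈ J, z j).snd = ∑ j ∈ J, (∏ l ∈ J.erase j, (z l).fst) • (z j).snd := by
  induction J using Finset.induction_on with
  | empty => simp
  | insert r J hr ih =>
    rw [Finset.prod_insert hr, SqZero.mul_snd, ih, SqZero.prod_fst, Finset.sum_insert hr,
      Finset.erase_insert hr, add_comm, Finset.smul_sum]
    congr 1
    refine Finset.sum_congr rfl fun j hj => ?_
    have hjr : j ≠ r := fun e => hr (e ▸ hj)
    rw [smul_smul, Finset.erase_insert_of_ne hjr.symm, Finset.prod_insert]
    exact fun h => hr (Finset.mem_of_mem_erase h)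

end SqZeroUnits

section Functions

variable {X : Scheme.{0}}

/-- Restriction of functions to a smaller open subset. -/
abbrev fRes (X : Scheme.{0}) {U V : X.Opens} (h : V ≤ U) : Γ(X, U) →+* Γ(X, V) :=
  oRes X (homOfLE h).op

lemma fRes_fRes {U V W : X.Opens} (h : V ≤ U) (h' : W ≤ V) (a : Γ(X, U)) :
    fRes X h' (fRes X h a) = fRes X (h'.trans h) a :=
  (oRes_comp X (homOfLE h).op (homOfLE h').op a).symm

lemma fRes_self {U : X.Opens} (h : U ≤ U) (a : Γ(X, U)) : fRes X h a = a :=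
  oRes_id X (op U) a

lemma exists_isUnit_fRes {U : X.Opens} {x : X} (hx : x ∈ U) {a : Γ(X, U)}
    (h : IsUnit (X.presheaf.germ U x hx a)) :
    ∃ (V : X.Opens) (hV : V ≤ U), x ∈ V ∧ IsUnit (fRes X hV a) :=
  ⟨X.basicOpen a, X.basicOpen_le a, (X.mem_basicOpen a x hx).2 h,
    RingedSpace.isUnit_res_basicOpen _ a⟩

end Functions

namespace CotangentExtension

variable {X : Scheme.{0}} {s : X ⟶ SpecC} (E : CotangentExtension X s)

instance : Mono E.i := E.shortExact.mono_f
instance : Epi E.p := E.shortExact.epi_g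

/-- The map `𝒪_X → F` on sections. -/
def incl (U : X.Opens) : Γ(X, U) →ₗ[Γ(X, U)] Γ(E.F, U) := secMap E.i U

lemma incl_injective (U : X.Opens) : Function.Injective (E.incl U) :=
  secMap_injective_of_mono E.i U

lemma p_incl (U : X.Opens) (a : Γ(X, U)) : secMap E.p U (E.incl U a) = 0 := by
  refine (secMap_comp E.i E.p U a).symm.trans ?_
  rw [E.w]
  rfl

lemma exists_incl_eq {U : X.Opens} {m : Γ(E.F, U)} (h : secMap E.p U m = 0) :
    ∃ a, E.incl U a = m :=
  exists_of_exact_of_mono E.shortExact.exact U m h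

lemma secRes_incl {U V : X.Opens} (h : V ≤ U) (a : Γ(X, U)) :
    secRes E.F h (E.incl U a) = E.incl V (fRes X h a) :=
  (secMap_secRes E.i h a).symm

lemma incl_eq_smul (U : X.Opens) (a : Γ(X, U)) : E.incl U a = a • (E.eps U).snd :=
  (congrArg (E.incl U) (mul_one a).symm).trans ((E.incl U).map_smul a 1)

/-- Restriction of sections of the deformation to a smaller open subset. -/
abbrev sRes {U V : X.Opens} (h : V ≤ U) : E.Sec U →+* E.Sec V := E.res (homOfLE h).op

lemma sRes_sRes {U V W : X.Opens} (h : V ≤ U) (h' : W ≤ V) (z : E.Sec U) :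
    E.sRes h' (E.sRes h z) = E.sRes (h'.trans h) z :=
  (E.res_comp (homOfLE h).op (homOfLE h').op z).symm

lemma proj_sRes {U V : X.Opens} (h : V ≤ U) (z : E.Sec U) :
    E.proj V (E.sRes h z) = fRes X h (E.proj U z) := rfl

lemma sRes_eps {U V : X.Opens} (h : V ≤ U) : E.sRes h (E.eps U) = E.eps V :=
  E.res_eps (homOfLE h).op

lemma exists_lift_omega {U : X.Opens} (ω : Γ(Omega X s, U)) {x : X} (hx : x ∈ U) :
    ∃ (V : X.Opens) (hV : V ≤ U), x ∈ V ∧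
      ∃ m, secMap E.p V m = secRes (Omega X s) hV ω :=
  locally_surjective_of_epi E.p U ω x hx

lemma secRes_dOmega {U V : X.Opens} (h : V ≤ U) (a : Γ(X, U)) :
    secRes (Omega X s) h (dOmega X s U a) = dOmega X s V (fRes X h a) :=
  dOmega_map X s (homOfLE h).op a

/-- Functions on `X` lift locally to the deformation. -/
lemma exists_lift {U : X.Opens} (a : Γ(X, U)) {x : X} (hx : x ∈ U) :
    ∃ (V : X.Opens) (hV : V ≤ U), x ∈ V ∧ ∃ z : E.Sec V, E.proj V z = fRes X hV a := by
  obtain ⟨V, hV, hxV, m, hm⟩ := E.exists_lift_omega (dOmega X s U a) hx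
  exact ⟨V, hV, hxV, ⟨fRes X hV a, m, by rw [hm, secRes_dOmega]⟩, rfl⟩

lemma mul_eps (U : X.Opens) (z : E.Sec U) :
    z * E.eps U = ⟨0, E.incl U (E.proj U z), by rw [map_zero, p_incl]⟩ := by
  refine SqZero.ext (mul_zero _) ?_
  refine Eq.trans ?_ (E.incl_eq_smul U (E.proj U z)).symm
  change z.fst • (E.eps U).snd + (0 : Γ(X, U)) • z.snd = z.fst • (E.eps U).snd
  rw [zero_smul, add_zero]

/-- Sections of the deformation which vanish on `X` are locally multiples of `ε`. -/
lemma exists_eq_mul_eps {U : X.Opens} {z : E.Sec U} (h : E.proj U z = 0) {x : X} (hx : x ∈ U) :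
    ∃ (V : X.Opens) (hV : V ≤ U), x ∈ V ∧ ∃ w : E.Sec V, E.sRes hV z = w * E.eps V := by
  obtain ⟨a, ha⟩ := E.exists_incl_eq (m := z.snd) (by
    rw [z.cond]
    exact (congrArg _ h).trans (map_zero _))
  obtain ⟨V, hV, hxV, w, hw⟩ := E.exists_lift a hx
  refine ⟨V, hV, hxV, w, ?_⟩
  rw [mul_eps]
  refine SqZero.ext ?_ ?_
  · change fRes X hV (E.proj U z) = 0
    rw [h, map_zero]
  · change secRes E.F hV z.snd = E.incl V (E.proj V w)
    rw [hw, ← ha, secRes_incl]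

lemma isUnit_of_isUnit_proj {U : X.Opens} {z : E.Sec U} (h : IsUnit (E.proj U z)) : IsUnit z :=
  SqZero.isUnit_of_isUnit_fst h

/-- A function annihilating `ε` vanishes on `X`. -/
lemma proj_eq_zero_of_mul_eps_eq_zero {U : X.Opens} {z : E.Sec U} (h : z * E.eps U = 0) :
    E.proj U z = 0 := by
  rw [mul_eps] at h
  exact E.incl_injective U ((congrArg SqZero.snd h).trans (map_zero _).symm)

/-! ### Generators of the ideals of the components -/

variable {ι : Type} {C : ι → X.IdealSheafData}

lemma Vanishes.sRes {J : X.IdealSheafData} {U V : X.Opens} (h : V ≤ U) {z : E.Sec U}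
    (hz : E.Vanishes J z) : E.Vanishes J (E.sRes h z) :=
  Vanishes.res E (homOfLE h).op hz

lemma vanishes_eps (J : X.IdealSheafData) (U : X.Opens) : E.Vanishes J (E.eps U) :=
  map_zero _

/-- Two generators of the ideal of a component differ locally by a unit. -/
lemma IsGen.exists_unit {i : ι} {U : X.Opens} {m m' : E.Sec U} (hm : E.IsGen C i U m)
    (hm' : E.IsGen C i U m') {x : X} (hx : x ∈ U) :
    ∃ (V : X.Opens) (hV : V ≤ U), x ∈ V ∧ ∃ u : E.Sec V, IsUnit u ∧
      E.sRes hV m' = u * E.sRes hV m := by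
  obtain ⟨V₁, h₁, h₁', hx₁, t, ht⟩ := hm.2 U le_rfl m' hm'.1 x hx
  obtain ⟨V₂, h₂, h₂', hx₂, t', ht'⟩ := hm'.2 V₁ h₁ (E.sRes h₁ m) (hm.1.sRes E h₁) x hx₁
  -- From `m' = t m` and `m = t' m'` one cannot cancel `m`, which may be a zero divisor. But `ε`
  -- vanishes on the component, so it is a multiple of `m`, and `(1 - t' t) ε = 0`. The annihilator
  -- of `ε` consists of sections vanishing on `X`; hence `t' t = 1` on `X`, and `t` is a unit
  -- because units lift.
  obtain ⟨V₃, h₃, h₃', hx₃, w, hw⟩ := hm.2 V₂ (h₂.trans h₁) (E.eps V₂) (E.vanishes_eps _ _) x hx₂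
  have e1 : E.sRes (h₃.trans h₂') m' = E.sRes (h₃.trans h₂) t * E.sRes (h₃.trans h₂') m := by
    have := congrArg (E.sRes (h₃.trans h₂)) ht
    rwa [map_mul, sRes_sRes, sRes_sRes] at this
  have e2 : E.sRes (h₃.trans h₂') m = E.sRes h₃ t' * E.sRes (h₃.trans h₂') m' := by
    have := congrArg (E.sRes h₃) ht'
    rwa [map_mul, sRes_sRes, sRes_sRes, sRes_sRes] at this
  have e3 : E.eps V₃ = w * E.sRes (h₃.trans h₂') m := by
    rw [← hw]
    exact (E.sRes_eps h₃).symm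
  have e4 : (1 - E.sRes h₃ t' * E.sRes (h₃.trans h₂) t) * E.eps V₃ = 0 := by
    have : E.sRes (h₃.trans h₂') m =
        E.sRes h₃ t' * E.sRes (h₃.trans h₂) t * E.sRes (h₃.trans h₂') m := by
      rw [mul_assoc, ← e1, ← e2]
    rw [e3]
    linear_combination w * this
  have e5 := E.proj_eq_zero_of_mul_eps_eq_zero e4
  rw [map_sub, map_one, map_mul, sub_eq_zero] at e5
  refine ⟨V₃, h₃.trans h₂', hx₃, E.sRes (h₃.trans h₂) t, ?_, e1⟩
  exact E.isUnit_of_isUnit_proj (IsUnit.of_mul_eq_one_right _ e5.symm)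

end CotangentExtension

/-! ### Charts of normal crossing varieties -/

section Charts

variable {X : Scheme.{0}} (s : X ⟶ SpecC) (n : ℕ) {ι : Type} (C : ι → X.IdealSheafData)

/-- An affine open subset with an étale map to the local model. -/
structure Chart (W : X.affineOpens) where
  k : ℕ
  hk : k ≤ n + 1
  c : Fin k ↪ ι
  φ : ModelRing n k hk →+* Γ(X, W.1)
  etale : φ.Etale
  scalar_eq : ∀ z : ℂ, φ (algebraMap ℂ _ z) = scalar X s W.1 z
  ideal_c : ∀ j : Fin k, (C (c j)).ideal W = Ideal.span {φ (modelX hk (Fin.castLE hk j))}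
  ideal_of_notMem : ∀ i, i ∉ Set.range c → (C i).ideal W = ⊤

variable {s n C}

/-- Charts restrict to basic open subsets. -/
def Chart.basicOpen {W : X.affineOpens} (ch : Chart s n C W) (f : Γ(X, W.1)) :
    Chart s n C (X.affineBasicOpen f) where
  k := ch.k
  hk := ch.hk
  c := ch.c
  φ := (fRes X (X.affineBasicOpen_le f)).comp ch.φ
  etale := by
    refine RingHom.Etale.stableUnderComposition _ _ ch.etale ?_
    let _ : Algebra Γ(X, W.1) Γ(X, X.basicOpen f) := (fRes X (X.affineBasicOpen_le f)).toAlgebra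
    have : IsLocalization.Away f Γ(X, X.basicOpen f) := W.2.isLocalization_basicOpen f
    exact RingHom.etale_algebraMap.2
      (Algebra.Etale.of_isLocalizationAway (A := Γ(X, X.basicOpen f)) f)
  scalar_eq z := by
    rw [RingHom.comp_apply, ch.scalar_eq]
    have h : X.basicOpen f ≤ W.1 := X.affineBasicOpen_le f
    exact congr($(scalar_map X s (homOfLE h).op) z)
  ideal_c j := by
    rw [← (C (ch.c j)).map_ideal (X.affineBasicOpen_le f), ch.ideal_c, Ideal.map_span,
      Set.image_singleton]
    rfl
  ideal_of_notMem i hi := by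
    rw [← (C i).map_ideal (X.affineBasicOpen_le f), ch.ideal_of_notMem i hi, Ideal.map_top]

/-- A chart restricts to basic open subsets, which form a basis of its topology. Any local
construction may thus be completed by passing to a smaller chart. -/
lemma IsNormalCrossing.exists_chart (hX : IsNormalCrossing s n C) {U : X.Opens} {x : X}
    (hx : x ∈ U) : ∃ (W : X.affineOpens) (_ : Chart s n C W), W.1 ≤ U ∧ x ∈ W.1 := by
  obtain ⟨W, hxW, k, hk, c, φ, h1, h2, h3, h4⟩ := hX x
  obtain ⟨f, hf, hxf⟩ := W.2.exists_basicOpen_le (V := U) ⟨x, hx⟩ hxW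
  exact ⟨X.affineBasicOpen f, Chart.basicOpen ⟨k, hk, c, φ, h1, h2, h3, h4⟩ f, hf, hxf⟩

namespace Chart

variable {W : X.affineOpens} (ch : Chart s n C W)

/-- The coordinates. -/
def x (j : Fin (n + 1)) : Γ(X, W.1) := ch.φ (modelX ch.hk j)

/-- Local equations of all components. -/
def y : ι → Γ(X, W.1) := Function.extend ch.c (fun j => ch.x (Fin.castLE ch.hk j)) 1

lemma y_c (j : Fin ch.k) : ch.y (ch.c j) = ch.x (Fin.castLE ch.hk j) :=
  ch.c.injective.extend_apply _ _ _

/-- Components that miss `W` receive the equation `1`. Products and ideals can then be indexed by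
all of `ι` instead of the branches through a given point. -/
lemma y_of_notMem {i : ι} (hi : i ∉ Set.range ch.c) : ch.y i = 1 :=
  Function.extend_apply' _ _ _ hi

lemma ideal_eq (i : ι) : (C i).ideal W = Ideal.span {ch.y i} := by
  by_cases hi : i ∈ Set.range ch.c
  · obtain ⟨j, rfl⟩ := hi
    rw [ch.ideal_c, ch.y_c]
    rfl
  · rw [ch.ideal_of_notMem i hi, ch.y_of_notMem hi, Ideal.span_singleton_one]

lemma prod_extend {A : Type} [CommRing A] [Fintype ι] (f : Fin ch.k → A) (g : ι → A)
    (h : ∀ j, g (ch.c j) = f j) (h1 : ∀ i, i ∉ Set.range ch.c → g i = 1) :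
    ∏ i, g i = ∏ j, f j := by
  classical
  rw [← Finset.prod_subset (Finset.subset_univ (Finset.univ.map ch.c)), Finset.prod_map]
  · exact Finset.prod_congr rfl fun j _ => h j
  · intro i _ hi
    exact h1 i (fun ⟨j, hj⟩ => hi (Finset.mem_map.2 ⟨j, Finset.mem_univ j, hj⟩))

lemma prod_y [Fintype ι] : ∏ i, ch.y i = 0 := by
  rw [ch.prod_extend _ _ ch.y_c fun i => ch.y_of_notMem]
  change ∏ j, ch.φ _ = 0
  rw [← map_prod, prod_modelX, map_zero]

lemma flat : ch.φ.Flat := (RingHom.Etale.iff_flat_and_formallyUnramified.1 ch.etale).1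

lemma regularFamily_y : RegularFamily ch.y :=
  ((regularFamily_modelX ch.hk).map_of_flat ch.φ ch.flat).extend_one ch.c ch.y ch.y_c
    fun _ => ch.y_of_notMem

end Chart

/-! ### Functions on closed subschemes of an affine open subset -/

lemma restr_algebraMap_surjective (J : X.IdealSheafData) (W : X.affineOpens) :
    Function.Surjective (algebraMap Γ(X, W.1) (Restr J W.1)) :=
  J.subschemeι_app_surjective W

lemma restr_algebraMap_eq_zero_iff (J : X.IdealSheafData) (W : X.affineOpens) (a : Γ(X, W.1)) :
    algebraMap Γ(X, W.1) (Restr J W.1) a = 0 ↔ a ∈ J.ideal W := by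
  rw [← J.ker_subschemeι_app W]
  rfl

end Charts

/-! ### The resolution of `𝒪_X` by the functions on the components -/

section Rep

variable {X : Scheme.{0}} {P Q : ModFamily X}

/-- Sections of an associated sheaf annihilated by a morphism come locally from elements of the
presheaf annihilated by it. -/
lemma ModFamily.exists_rep_of_secMap_eq_zero
    {g : P.presheaf ⟶ Q.presheaf} {U : X.Opens} {m : Γ(P.sheaf, U)}
    (hm : secMap (show P.sheaf ⟶ Q.sheaf from (shf X).map g) U m = 0) {x : X} (hx : x ∈ U) :
    ∃ (V : X.Opens) (hV : V ≤ U), x ∈ V ∧ ∀ (W : X.Opens) (hW : W ≤ V),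
      ∃ p : P.obj (op W), P.toSec W p = secRes P.sheaf (hW.trans hV) m ∧ (g.app (op W) p : Q.obj (op W)) = 0 := by
  obtain ⟨V, hV, hxV, p, hp⟩ := ModFamily.toSec_locally_surjective m hx
  have h1 : Q.toSec V (g.app (op V) p) = 0 := by
    rw [← ModFamily.secMap_shf_map g, hp, secMap_secRes, hm, map_zero]
  obtain ⟨V', hV', hxV', e⟩ := ModFamily.toSec_locally_injective _ h1 hxV
  refine ⟨V', hV'.trans hV, hxV', fun W hW => ⟨P.res (homOfLE (hW.trans hV')).op p, ?_, ?_⟩⟩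
  · rw [← ModFamily.secRes_toSec, hp, secRes_trans]
  · refine (PresheafOfModules.naturality_apply g (homOfLE (hW.trans hV')).op p).trans ?_
    refine (Q.res_comp (homOfLE hV').op (homOfLE hW).op _).trans ?_
    refine (congrArg (Q.res (homOfLE hW).op) e).trans ?_
    exact map_zero (Q.res (homOfLE hW).op)

lemma ModFamily.exists_rep {U : X.Opens} (m : Γ(P.sheaf, U)) {x : X} (hx : x ∈ U) :
    ∃ (V : X.Opens) (hV : V ≤ U), x ∈ V ∧ ∀ (W : X.Opens) (hW : W ≤ V),
      ∃ p : P.obj (op W), P.toSec W p = secRes P.sheaf (hW.trans hV) m := by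
  obtain ⟨V, hV, hxV, p, hp⟩ := ModFamily.toSec_locally_surjective m hx
  refine ⟨V, hV, hxV, fun W hW => ⟨P.res (homOfLE hW).op p, ?_⟩⟩
  rw [← ModFamily.secRes_toSec, hp, secRes_trans]

end Rep

section Resolution

variable {X : Scheme.{0}} {s : X ⟶ SpecC} {n : ℕ} {ι : Type} [Fintype ι] {C : ι → X.IdealSheafData}

omit [Fintype ι] in
lemma secMap_toNormalization (U : X.Opens) (a : Γ(sheafO X, U)) :
    secMap (toNormalization C) U (a : Γ(sheafO X, U)) =
      (closedFamily C).toSec U (fun i => algebraMap Γ(X, U) (Restr (C i) U) a) := by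
  change (closedFamily C).toSec U ((show Γ(X, U) from a) • fun i => 1) = _
  refine congrArg _ ?_
  funext i
  exact (Algebra.smul_def (show Γ(X, U) from a) (1 : Restr (C i) U)).trans (mul_one _)

/-- On a chart, a function vanishing on all components lies in every `(y i)`, hence in the ideal of
their product, which is zero. -/
lemma mono_toNormalization (hX : IsNormalCrossing s n C) : Mono (toNormalization C) := by
  refine mono_of_secMap_injective _ fun U => (injective_iff_map_eq_zero _).2 fun a ha => ?_
  refine section_ext (sheafO X) fun x hx => ?_
  obtain ⟨V, hV, hxV, e⟩ := ModFamily.toSec_locally_injective _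
    ((secMap_toNormalization U a).symm.trans ha) hx
  obtain ⟨W, ch, hWV, hxW⟩ := hX.exists_chart hxV
  refine ⟨W.1, hWV.trans hV, hxW, ?_⟩
  generalize (show Γ(X, U) from a) = a at e
  change fRes X (hWV.trans hV) a = fRes X (hWV.trans hV) 0
  rw [map_zero]
  refine ch.regularFamily_y.eq_zero_of_forall_mem ch.prod_y fun i => ?_
  rw [← ch.ideal_eq, ← restr_algebraMap_eq_zero_iff, ← fRes_fRes hV hWV]
  refine (restrRes_algebraMap (C i) (homOfLE hWV).op _).symm.trans ?_
  have := (restrRes_algebraMap (C i) (homOfLE hV).op _).symm.trans (congrFun e i)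
  exact (congrArg (restrRes (C i) (homOfLE hWV).op) this).trans (map_zero _)

variable [LinearOrder ι]

omit [Fintype ι] in
lemma toNormalization_comp_cech1 : toNormalization C ≫ cech1 C = 0 := by
  refine hom_ext_sec fun U a => ?_
  rw [secMap_comp, secMap_toNormalization]
  refine (ModFamily.secMap_shf_map _ U _).trans ?_
  refine Eq.trans (congrArg _ ?_) (map_zero ((closedFamily (double C)).toSec U))
  funext q
  exact (congrArg₂ (fun b c => b - c) (restrIncl_algebraMap _ U _)
    (restrIncl_algebraMap _ U _)).trans (sub_self _)

omit [Fintype ι] [LinearOrder ι] in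
lemma Chart.ideal_sup {W : X.affineOpens} (ch : Chart s n C W) (i j : ι) :
    (C i ⊔ C j).ideal W = Ideal.span {ch.y i} ⊔ Ideal.span {ch.y j} := by
  rw [Scheme.IdealSheafData.ideal_sup, ← ch.ideal_eq, ← ch.ideal_eq]
  rfl

omit [Fintype ι] [LinearOrder ι] in
lemma Chart.ideal_sup₃ {W : X.affineOpens} (ch : Chart s n C W) (i j k : ι) :
    (C i ⊔ C j ⊔ C k).ideal W =
      Ideal.span {ch.y i} ⊔ Ideal.span {ch.y j} ⊔ Ideal.span {ch.y k} := by
  rw [← ch.ideal_sup, ← ch.ideal_eq]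
  rfl

/-- Local exactness of the sequence at the functions on the components. -/
lemma locally_exact_cech1 (hX : IsNormalCrossing s n C) {U : X.Opens}
    {u : Γ((closedFamily C).sheaf, U)} (hu : secMap (cech1 C) U u = 0) {x : X} (hx : x ∈ U) :
    ∃ (V : X.Opens) (hV : V ≤ U), x ∈ V ∧ ∃ a, secMap (toNormalization C) V a =
      secRes (closedFamily C).sheaf hV u := by
  obtain ⟨V, hV, hxV, hrep⟩ := ModFamily.exists_rep_of_secMap_eq_zero hu hx
  obtain ⟨W, ch, hWV, hxW⟩ := hX.exists_chart hxV
  obtain ⟨p, hp, hp0⟩ := hrep W.1 hWV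
  choose b hb using fun i => restr_algebraMap_surjective (C i) W (p i)
  -- On an affine chart the functions on components lift to `b`, and vanishing of the differences on
  -- the double loci becomes membership in `(y i) + (y j)`.
  have key : ∀ i j, i < j → b j - b i ∈ Ideal.span {ch.y i} ⊔ Ideal.span {ch.y j} := by
    intro i j hij
    rw [← ch.ideal_sup, ← restr_algebraMap_eq_zero_iff, map_sub,
      ← restrIncl_algebraMap (le_sup_right : C j ≤ C i ⊔ C j),
      ← restrIncl_algebraMap (le_sup_left : C i ≤ C i ⊔ C j), hb, hb]
    exact congrFun hp0 ⟨(i, j), hij⟩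
  obtain ⟨a, ha⟩ := ch.regularFamily_y.exists_glue b (fun i j => by
    rcases lt_trichotomy i j with h | rfl | h
    · exact key i j h
    · simp
    · rw [sup_comm, ← Ideal.neg_mem_iff, neg_sub]
      exact key j i h)
  refine ⟨W.1, hWV.trans hV, hxW, a, ?_⟩
  rw [← hp]
  refine (secMap_toNormalization W.1 a).trans (congrArg _ ?_)
  funext i
  rw [← hb, ← sub_eq_zero, ← map_sub, restr_algebraMap_eq_zero_iff, ch.ideal_eq]
  exact ha i

/-- Local exactness of the sequence at the functions on the double loci. -/
lemma locally_exact_cech2 (hX : IsNormalCrossing s n C) {U : X.Opens}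
    {v : Γ((closedFamily (double C)).sheaf, U)} (hv : secMap (cech2 C) U v = 0) {x : X}
    (hx : x ∈ U) :
    ∃ (V : X.Opens) (hV : V ≤ U), x ∈ V ∧ ∃ u, secMap (cech1 C) V u =
      secRes (closedFamily (double C)).sheaf hV v := by
  obtain ⟨V, hV, hxV, hrep⟩ := ModFamily.exists_rep_of_secMap_eq_zero hv hx
  obtain ⟨W, ch, hWV, hxW⟩ := hX.exists_chart hxV
  obtain ⟨p, hp, hp0⟩ := hrep W.1 hWV
  choose b hb using fun q => restr_algebraMap_surjective (double C q) W (p q)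
  -- The cocycle is extended to all pairs by the default value `0`; only pairs with `i < j` are ever
  -- used.
  let v' : ι → ι → Γ(X, W.1) := fun i j => if h : i < j then b ⟨(i, j), h⟩ else 0
  have hv' : ∀ i j (h : i < j), v' i j = b ⟨(i, j), h⟩ := fun i j h => dif_pos h
  obtain ⟨u, hu⟩ := ch.regularFamily_y.exists_coboundary v' (fun i j k hij hjk => by
    rw [hv' i j hij, hv' j k hjk, hv' i k (hij.trans hjk), ← ch.ideal_sup₃,
      ← restr_algebraMap_eq_zero_iff, map_add, map_sub]
    have h0 := congrFun hp0 ⟨(i, j, k), hij, hjk⟩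
    change restrIncl _ W.1 (p _) - restrIncl _ W.1 (p _) + restrIncl _ W.1 (p _) = 0 at h0
    rw [← hb, ← hb, ← hb, restrIncl_algebraMap, restrIncl_algebraMap, restrIncl_algebraMap] at h0
    exact h0)
  refine ⟨W.1, hWV.trans hV, hxW,
    (closedFamily C).toSec W.1 (fun i => algebraMap _ (Restr (C i) W.1) (u i)), ?_⟩
  rw [← hp]
  refine (ModFamily.secMap_shf_map _ W.1 _).trans (congrArg _ ?_)
  funext q
  obtain ⟨⟨i, j⟩, hij⟩ := q
  change restrIncl _ W.1 (algebraMap _ _ (u j)) - restrIncl _ W.1 (algebraMap _ _ (u i)) = _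
  rw [restrIncl_algebraMap, restrIncl_algebraMap, ← hb, ← map_sub]
  refine (sub_eq_zero.1 ?_).symm
  change algebraMap _ (Restr (C i ⊔ C j) W.1) (b ⟨(i, j), hij⟩) - algebraMap _ _ (u j - u i) = 0
  rw [← map_sub, restr_algebraMap_eq_zero_iff, ← hv' i j hij, ch.ideal_sup]
  exact hu i j hij

omit [Fintype ι] in
lemma toNormalization_comp_lift : toNormalization C ≫
    Limits.kernel.lift (cech2 C) (cech1 C) (cech1_comp_cech2 C) = 0 := by
  rw [← cancel_mono (Limits.kernel.ι (cech2 C)), Category.assoc, Limits.kernel.lift_ι,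
    toNormalization_comp_cech1, Limits.zero_comp]

/-- The sequence `0 → 𝒪_X → a_* 𝒪_{X^{[1]}} → ker(a_{2*} 𝒪_{X^{[2]}} → a_{3*} 𝒪_{X^{[3]}}) → 0`
is exact. -/
lemma shortExact_toNormalization (hX : IsNormalCrossing s n C) :
    (ShortComplex.mk (toNormalization C)
      (Limits.kernel.lift (cech2 C) (cech1 C) (cech1_comp_cech2 C))
      toNormalization_comp_lift).ShortExact where
  exact := by
    refine exact_of_locally_exact _ _ _ fun U u hu x hx => locally_exact_cech1 hX ?_ hx
    have h : Limits.kernel.lift (cech2 C) (cech1 C) (cech1_comp_cech2 C) ≫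
      Limits.kernel.ι (cech2 C) = cech1 C := Limits.kernel.lift_ι _ _ _
    rw [← h, secMap_comp, hu, map_zero]
  mono_f := mono_toNormalization hX
  epi_g := by
    refine epi_of_locally_surjective _ fun U v x hx => ?_
    obtain ⟨V, hV, hxV, u, hu⟩ := locally_exact_cech2 hX
      (v := secMap (Limits.kernel.ι (cech2 C)) U v)
      (by rw [← secMap_comp, Limits.kernel.condition, secMap_zero]) hx
    refine ⟨V, hV, hxV, u, secMap_injective_of_mono (Limits.kernel.ι (cech2 C)) V ?_⟩
    have h : Limits.kernel.lift (cech2 C) (cech1 C) (cech1_comp_cech2 C) ≫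
      Limits.kernel.ι (cech2 C) = cech1 C := Limits.kernel.lift_ι _ _ _
    rw [← secMap_comp, h, hu, secMap_secRes]

end Resolution

/-! ### Universal properties of the sheaves of differentials -/

section KaehlerLift

variable {A B : CommRingCat.{0}} (f : A ⟶ B) {R M : Type} [CommRing R] [AddCommGroup M] [Module R M]
  (g : B →+* R) (D : B →+ M) (hmul : ∀ b c, D (b * c) = g b • D c + g c • D b)
  (hf : ∀ a, D (f a) = 0)

/-- The derivation with values in the restriction of scalars of `M`. -/
def scalarsDerivation : let _ := Module.compHom M g; (ModuleCat.of B M).Derivation f :=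
  let _ := Module.compHom M g
  ModuleCat.Derivation.mk D (map_add D) hmul hf

/-- The semilinear map on Kähler differentials given by a derivation. -/
def kaehlerLift : CommRingCat.KaehlerDifferential f →+ M :=
  let _ := Module.compHom M g
  (scalarsDerivation f g D hmul hf).desc.hom.toAddMonoidHom

lemma kaehlerLift_d (b : B) :
    kaehlerLift f g D hmul hf (CommRingCat.KaehlerDifferential.d b) = D b :=
  let _ := Module.compHom M g
  ModuleCat.Derivation.desc_d (scalarsDerivation f g D hmul hf) b

lemma kaehlerLift_smul (b : B) (ω : CommRingCat.KaehlerDifferential f) :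
    kaehlerLift f g D hmul hf (b • ω) = g b • kaehlerLift f g D hmul hf ω :=
  let _ := Module.compHom M g
  (scalarsDerivation f g D hmul hf).desc.hom.map_smul b ω

end KaehlerLift

section OmegaDesc

variable {X : Scheme.{0}} {s : X ⟶ SpecC} {M : X.Modules}

/-- Two morphisms out of `Ω¹_X` agree if they do so on the sections `da`. -/
lemma omega_hom_ext {f g : Omega X s ⟶ M}
    (h : ∀ (U : X.Opens) (a : Γ(X, U)),
      secMap f U (dOmega X s U a) = secMap g U (dOmega X s U a)) : f = g := by
  have key : ∀ (U : X.Opens) (p : CommRingCat.KaehlerDifferential ((constToO X s).app (op U))),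
      secMap f U ((toShf X (preOmega X s)).app (op U) p) =
        secMap g U ((toShf X (preOmega X s)).app (op U) p) := by
    intro U p
    induction p using CotangentExtension.kaehler_induction with
    | h0 =>
      refine (congrArg (secMap f U) (map_zero _)).trans (((map_zero _).trans (map_zero _).symm).trans
        (congrArg (secMap g U) (map_zero _)).symm)
    | hadd x y hx hy =>
      refine (congrArg (secMap f U) (map_add _ x y)).trans ?_
      refine Eq.trans ?_ (congrArg (secMap g U) (map_add _ x y)).symm
      refine (map_add _ _ _).trans ?_
      refine Eq.trans ?_ (map_add _ _ _).symm
      exact congrArg₂ _ hx hy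
    | hd b c =>
      have e := LinearMap.map_smul ((toShf X (preOmega X s)).app (op U)).hom b
        (CommRingCat.KaehlerDifferential.d (f := (constToO X s).app (op U)) c)
      refine (congrArg (secMap f U) e).trans ?_
      refine Eq.trans ?_ (congrArg (secMap g U) e).symm
      refine ((secMap f U).map_smul b _).trans ?_
      refine Eq.trans ?_ ((secMap g U).map_smul b _).symm
      exact congrArg (b • ·) (h U c)
  refine hom_ext_sec fun U m => section_ext _ fun x hx => ?_
  obtain ⟨V, hV, hxV, p, hp⟩ := toShf_locally_surjective (preOmega X s) U m x hx
  refine ⟨V, hV, hxV, ?_⟩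
  refine (secMap_secRes f hV m).symm.trans ?_
  refine Eq.trans ?_ (secMap_secRes g hV m)
  refine (congrArg (secMap f V) hp.symm).trans ?_
  exact (key V p).trans (congrArg (secMap g V) hp)

variable (D : ∀ U : X.Opens, Γ(X, U) →+ Γ(M, U))
  (hmul : ∀ U a b, D U (a * b) = a • D U b + b • D U a)
  (hc : ∀ U c, D U (scalar X s U c) = 0)
  (hres : ∀ {U V : X.Opens} (h : V ≤ U) a, secRes M h (D U a) = D V (fRes X h a))

/-- The morphism of presheaves given by a derivation. -/
def preOmegaDesc : preOmega X s ⟶ M.val where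
  app U := ModuleCat.ofHom (R := X.ringCatSheaf.obj.obj U) (X := (preOmega X s).obj U) (Y := M.val.obj U)
    { toFun := kaehlerLift (scalar X s U.unop) (RingHom.id _) (D U.unop) (hmul U.unop) (hc U.unop)
      map_add' := map_add (kaehlerLift (scalar X s U.unop) (RingHom.id _) (D U.unop) (hmul U.unop) (hc U.unop))
      map_smul' := kaehlerLift_smul (scalar X s U.unop) (RingHom.id _) (D U.unop) (hmul U.unop) (hc U.unop) }
  naturality {U V} f := by
    ext ω
    change kaehlerLift (scalar X s V.unop) (RingHom.id _) (D V.unop) (hmul V.unop) (hc V.unop)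
      ((preOmega X s).map f ω) = secRes M f.unop.le
        (kaehlerLift (scalar X s U.unop) (RingHom.id _) (D U.unop) (hmul U.unop) (hc U.unop) ω)
    change CommRingCat.KaehlerDifferential (scalar X s U.unop) at ω
    induction ω using CotangentExtension.kaehler_induction with
    | h0 =>
      refine (congrArg _ (map_zero _)).trans ((map_zero _).trans ?_)
      refine Eq.trans ?_ (congrArg (secRes M f.unop.le) (map_zero _)).symm
      exact (map_zero _).symm
    | hadd x y hx hy =>
      refine (congrArg _ (map_add _ x y)).trans ((map_add _ _ _).trans ?_)
      refine Eq.trans ?_ (congrArg (secRes M f.unop.le) (map_add _ x y)).symm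
      refine Eq.trans ?_ (map_add _ _ _).symm
      exact congrArg₂ _ hx hy
    | hd b c =>
      have e1 : (show CommRingCat.KaehlerDifferential (scalar X s V.unop) from (preOmega X s).map f
          (b • CommRingCat.KaehlerDifferential.d (f := scalar X s U.unop) c)) = (oRes X f b • CommRingCat.KaehlerDifferential.d (f := scalar X s V.unop) (oRes X f c) :
            CommRingCat.KaehlerDifferential (scalar X s V.unop)) := by
        refine ((preOmega X s).map_smul f b _).trans ?_
        exact congrArg (fun t : CommRingCat.KaehlerDifferential (scalar X s V.unop) => oRes X f b • t)
          (PresheafOfModules.DifferentialsConstruction.relativeDifferentials'_map_d (constToO X s) f c)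
      refine (congrArg _ e1).trans ?_
      refine (kaehlerLift_smul _ _ _ _ _ _ _).trans ?_
      refine (congrArg (_ • ·) (kaehlerLift_d _ _ _ _ _ _)).trans ?_
      refine Eq.trans ?_ (congrArg (secRes M f.unop.le) (kaehlerLift_smul _ _ _ _ _ _ _)).symm
      refine Eq.trans ?_ ((secRes M f.unop.le).map_smulₛₗ _ _).symm
      refine congrArg (oRes X f b • ·) ?_
      refine (hres f.unop.le c).symm.trans ?_
      exact congrArg (secRes M f.unop.le) (kaehlerLift_d _ _ _ _ _ _).symm

/-- The morphism out of `Ω¹_X` given by a derivation. -/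
def omegaDesc : Omega X s ⟶ M :=
  ((PresheafOfModules.sheafificationAdjunction (𝟙 X.ringCatSheaf.obj)).homEquiv (preOmega X s)
    M).symm (preOmegaDesc D hmul hc hres)

lemma secMap_omegaDesc (U : X.Opens) (a : Γ(X, U)) :
    secMap (omegaDesc D hmul hc hres) U (dOmega X s U a) = D U a := by
  have h := (PresheafOfModules.sheafificationAdjunction (𝟙 X.ringCatSheaf.obj)).homEquiv_unit
    (preOmega X s) M (f := omegaDesc D hmul hc hres)
  have h1 := congrArg (fun g => PresheafOfModules.Hom.app g (op U))
    ((Equiv.apply_symm_apply _ _).symm.trans h)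
  exact (ConcreteCategory.congr_hom h1
    (CommRingCat.KaehlerDifferential.d (f := (constToO X s).app (op U)) a)).symm.trans
    (kaehlerLift_d (scalar X s U) (RingHom.id _) (D U) (hmul U) (hc U) a)

end OmegaDesc

namespace CotangentExtension

variable {X : Scheme.{0}} {s : X ⟶ SpecC} (E : CotangentExtension X s) {M : X.Modules}

/-! ### Sections of `Ω¹_𝒳 ⊗ 𝒪_X` -/

lemma d_add (U : X.Opens) (z w : E.Sec U) : E.d U (z + w) = E.d U z + E.d U w :=
  ModuleCat.Derivation.d_add (CommRingCat.KaehlerDifferential.D (E.const U)) z w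

lemma d_mul (U : X.Opens) (z w : E.Sec U) : E.d U (z * w) = z • E.d U w + w • E.d U z :=
  ModuleCat.Derivation.d_mul (CommRingCat.KaehlerDifferential.D (E.const U)) z w

lemma d_const (U : X.Opens) (c : ℂ) : E.d U (E.const U c) = 0 :=
  ModuleCat.Derivation.d_map (CommRingCat.KaehlerDifferential.D (E.const U)) c

/-- The section `dz` of `Ω¹_𝒳 ⊗ 𝒪_X`. -/
def dX (U : X.Opens) (z : E.Sec U) : Γ(E.omegaX, U) :=
  E.diffFamily.restrict.toSec U ((1 : Γ(X, U)) ⊗ₜ[E.Sec U] E.d U z : E.DiffX U)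

lemma dX_add (U : X.Opens) (z w : E.Sec U) : E.dX U (z + w) = E.dX U z + E.dX U w := by
  refine Eq.trans (congrArg (E.diffFamily.restrict.toSec U) ?_) (map_add _ _ _)
  rw [d_add, TensorProduct.tmul_add]
  rfl

lemma dX_mul (U : X.Opens) (z w : E.Sec U) :
    E.dX U (z * w) = E.proj U z • E.dX U w + E.proj U w • E.dX U z := by
  refine Eq.trans (congrArg (E.diffFamily.restrict.toSec U) ?_)
    ((map_add _ _ _).trans (congrArg₂ _ (map_smul _ _ _) (map_smul _ _ _)))
  rw [d_mul, TensorProduct.tmul_add, smul_tmul_sec, smul_tmul_sec]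
  rfl

lemma dX_const (U : X.Opens) (c : ℂ) : E.dX U (E.const U c) = 0 := by
  refine Eq.trans (congrArg (E.diffFamily.restrict.toSec U) ?_) (map_zero _)
  rw [d_const, TensorProduct.tmul_zero]
  rfl

lemma secRes_dX {U V : X.Opens} (h : V ≤ U) (z : E.Sec U) :
    secRes E.omegaX h (E.dX U z) = E.dX V (E.sRes h z) := by
  refine (ModFamily.secRes_toSec (P := E.diffFamily.restrict) h _).trans ?_
  refine congrArg (E.diffFamily.restrict.toSec V) ?_
  refine (E.diffXRes_tmul (homOfLE h).op 1 (E.d U z)).trans ?_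
  rw [map_one, diffRes_d]

lemma tmul_induction {U : X.Opens} {p : E.DiffX U → Prop} (t : E.DiffX U) (h0 : p 0)
    (hadd : ∀ x y, p x → p y → p (x + y))
    (hd : ∀ (a : Γ(X, U)) (z : E.Sec U), p (a • ((1 : Γ(X, U)) ⊗ₜ E.d U z : E.DiffX U))) : p t := by
  induction t using TensorProduct.induction_on with
  | zero => exact h0
  | add x y hx hy => exact hadd x y hx hy
  | tmul a ω =>
    induction ω using kaehler_induction with
    | h0 => rw [TensorProduct.tmul_zero]; exact h0
    | hadd x y hx hy => rw [TensorProduct.tmul_add]; exact hadd _ _ hx hy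
    | hd b c =>
      have e : (a ⊗ₜ[E.Sec U] (b • CommRingCat.KaehlerDifferential.d (f := E.const U) c) : E.DiffX U)
          = (E.proj U b * a) • ((1 : Γ(X, U)) ⊗ₜ E.d U c : E.DiffX U) := by
        refine (smul_tmul_sec E b a _).trans ?_
        rw [TensorProduct.smul_tmul', TensorProduct.smul_tmul', smul_eq_mul, smul_eq_mul, mul_one]
        rfl
      exact Eq.mpr (congrArg p e) (hd _ c)

/-- Two morphisms out of `Ω¹_𝒳 ⊗ 𝒪_X` agree if they do so on the sections `dz`. -/
lemma omegaX_hom_ext {f g : E.omegaX ⟶ M}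
    (h : ∀ (U : X.Opens) (z : E.Sec U), secMap f U (E.dX U z) = secMap g U (E.dX U z)) : f = g := by
  refine ModFamily.hom_ext_toSec (P := E.diffFamily.restrict) fun U p => ?_
  induction p using E.tmul_induction with
  | h0 =>
    refine (congrArg (secMap f U) (map_zero _)).trans (((map_zero _).trans (map_zero _).symm).trans
      (congrArg (secMap g U) (map_zero _)).symm)
  | hadd x y hx hy =>
    refine (congrArg (secMap f U) (map_add _ x y)).trans ?_
    refine Eq.trans ?_ (congrArg (secMap g U) (map_add _ x y)).symm
    refine (map_add _ _ _).trans ?_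
    refine Eq.trans ?_ (map_add _ _ _).symm
    exact congrArg₂ _ hx hy
  | hd b c =>
    refine (congrArg (secMap f U) (map_smul _ b _)).trans ?_
    refine Eq.trans ?_ (congrArg (secMap g U) (map_smul _ b _)).symm
    refine ((secMap f U).map_smul b _).trans ?_
    refine Eq.trans ?_ ((secMap g U).map_smul b _).symm
    exact congrArg (b • ·) (h U c)

section Desc

variable (D : ∀ U : X.Opens, E.Sec U →+ Γ(M, U))
  (hmul : ∀ U a b, D U (a * b) = E.proj U a • D U b + E.proj U b • D U a)
  (hc : ∀ U c, D U (E.const U c) = 0)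
  (hres : ∀ {U V : X.Opens} (h : V ≤ U) a, secRes M h (D U a) = D V (E.sRes h a))

/-- The semilinear map on differentials given by a derivation. -/
def diffLift (U : X.Opens) : E.Diff U →+ Γ(M, U) :=
  kaehlerLift (E.const U) (E.proj U) (D U) (hmul U) (hc U)

lemma diffLift_d (U : X.Opens) (z : E.Sec U) : E.diffLift D hmul hc U (E.d U z) = D U z :=
  kaehlerLift_d (E.const U) (E.proj U) (D U) (hmul U) (hc U) z

lemma diffLift_smul (U : X.Opens) (z : E.Sec U) (ω : E.Diff U) :
    E.diffLift D hmul hc U (z • ω) = E.proj U z • E.diffLift D hmul hc U ω :=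
  kaehlerLift_smul (E.const U) (E.proj U) (D U) (hmul U) (hc U) z ω

include hres in
lemma diffLift_res {U V : X.Opens} (h : V ≤ U) (ω : E.Diff U) :
    E.diffLift D hmul hc V (E.diffRes (homOfLE h).op ω) =
      secRes M h (E.diffLift D hmul hc U ω) := by
  induction ω using kaehler_induction with
  | h0 => simp only [map_zero]
  | hadd x y hx hy => simp only [map_add, hx, hy]
  | hd b c =>
    refine (congrArg (E.diffLift D hmul hc V)
      ((E.diffRes (homOfLE h).op).map_smulₛₗ b (E.d U c))).trans ?_
    rw [diffRes_d, diffLift_smul, diffLift_d]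
    refine Eq.trans ?_ (congrArg (secRes M h) ((E.diffLift_smul D hmul hc U b (E.d U c)).trans
      (congrArg (fun t => E.proj U b • t) (E.diffLift_d D hmul hc U c)))).symm
    rw [(secRes M h).map_smulₛₗ, hres, proj_res]

/-- The morphism out of `Ω¹_𝒳 ⊗ 𝒪_X` given by a derivation. -/
def omegaXDesc : E.omegaX ⟶ M :=
  E.diffFamily.liftModules (fun U => E.diffLift D hmul hc U.unop)
    (fun U => E.diffLift_smul D hmul hc U.unop)
    (fun f => E.diffLift_res D hmul hc hres f.unop.le)

lemma secMap_omegaXDesc (U : X.Opens) (z : E.Sec U) :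
    secMap (E.omegaXDesc D hmul hc hres) U (E.dX U z) = D U z := by
  refine (ModFamily.secMap_homEquiv_symm (P := E.diffFamily.restrict) _ U _).trans ?_
  change (1 : Γ(X, U)) • E.diffLift D hmul hc U (E.d U z) = _
  rw [one_smul, diffLift_d]

end Desc

lemma secMap_toOmega (U : X.Opens) (z : E.Sec U) :
    secMap E.toOmega U (E.dX U z) = dOmega X s U (E.proj U z) := by
  refine (ModFamily.secMap_homEquiv_symm (P := E.diffFamily.restrict) _ U _).trans ?_
  change (1 : Γ(X, U)) • E.diffToOmega (op U) (E.d U z) = _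
  exact (one_smul _ _).trans (E.diffToOmega_d (op U) z)

/-- `Ω¹_X` is generated by sections `da`, and every function `a` lifts locally to the deformation
because `F → Ω¹_X` is locally surjective. -/
instance : Epi E.toOmega := by
  refine ⟨fun {Z} f g e => omega_hom_ext fun U a => section_ext _ fun x hx => ?_⟩
  obtain ⟨V, hV, hxV, z, hz⟩ := E.exists_lift a hx
  refine ⟨V, hV, hxV, ?_⟩
  refine (secMap_secRes f hV _).symm.trans ?_
  refine Eq.trans ?_ (secMap_secRes g hV _)
  rw [secRes_dOmega, ← hz, ← secMap_toOmega, ← secMap_comp, ← secMap_comp, e]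

/-- The map `Ω¹_𝒳 ⊗ 𝒪_X → F`, `d(a, m) ↦ m`. -/
def toF : E.omegaX ⟶ E.F :=
  E.omegaXDesc (fun _ => AddMonoidHom.mk' (fun z => z.snd) (fun _ _ => rfl))
    (fun _ _ _ => rfl) (fun _ _ => rfl) (fun _ _ => rfl)

lemma secMap_toF (U : X.Opens) (z : E.Sec U) : secMap E.toF U (E.dX U z) = z.snd :=
  E.secMap_omegaXDesc _ _ _ (fun _ _ => rfl) U z

/-! ### Sections of `π^*Ω¹_Δ ⊗ 𝒪_X` and `π^*Ω¹_Δ(log 0) ⊗ 𝒪_X` -/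

section Generated

variable {N : Type} [AddCommGroup N] [Module (DualNumber ℂ) N]

/-- The section of `π^* N ⊗ 𝒪_X` given by an element of `N`. -/
def baseSec (U : X.Opens) (n : N) : Γ(E.pullX N, U) :=
  (E.pull N).restrict.toSec U ((1 : Γ(X, U)) ⊗ₜ[E.Sec U] ((1 : E.Sec U) ⊗ₜ[DualNumber ℂ] n) :
    Γ(X, U) ⊗[E.Sec U] (E.Sec U ⊗[DualNumber ℂ] N))

/-- Scalars from `ℂ[ε]` and from the deformation all move to the left factor. Since `Ω¹_Δ` and
`Ω¹_Δ(log 0)` are cyclic, morphisms out of their pullbacks to `X` can be compared, and tested for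
injectivity, on the single section `baseSec`. -/
lemma exists_eq_smul_tmul {n : N} (hn : ∀ m : N, ∃ z : DualNumber ℂ, m = z • n) (U : X.Opens)
    (t : Γ(X, U) ⊗[E.Sec U] (E.Sec U ⊗[DualNumber ℂ] N)) :
    ∃ a : Γ(X, U), t = a • ((1 : Γ(X, U)) ⊗ₜ[E.Sec U] ((1 : E.Sec U) ⊗ₜ[DualNumber ℂ] n)) := by
  induction t using TensorProduct.induction_on with
  | zero => exact ⟨0, (zero_smul _ _).symm⟩
  | add x y hx hy =>
    obtain ⟨a, rfl⟩ := hx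
    obtain ⟨b, rfl⟩ := hy
    exact ⟨a + b, (add_smul _ _ _).symm⟩
  | tmul a t =>
    induction t using TensorProduct.induction_on with
    | zero => exact ⟨0, by rw [TensorProduct.tmul_zero, zero_smul]⟩
    | add x y hx hy =>
      obtain ⟨a, ha⟩ := hx
      obtain ⟨b, hb⟩ := hy
      exact ⟨a + b, by rw [TensorProduct.tmul_add, ha, hb, add_smul]⟩
    | tmul z m =>
      obtain ⟨w, rfl⟩ := hn m
      have e : (z ⊗ₜ[DualNumber ℂ] (w • n) : E.Sec U ⊗[DualNumber ℂ] N) =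
          (E.dual U w * z) • ((1 : E.Sec U) ⊗ₜ[DualNumber ℂ] n) := by
        rw [TensorProduct.smul_tmul', smul_eq_mul, mul_one]
        exact (TensorProduct.smul_tmul w z n).symm
      refine ⟨E.proj U (E.dual U w * z) * a, ?_⟩
      rw [e, smul_tmul_sec, TensorProduct.smul_tmul', TensorProduct.smul_tmul', smul_eq_mul,
        smul_eq_mul, mul_one]

lemma exists_eq_smul_baseSec {n : N} (hn : ∀ m : N, ∃ z : DualNumber ℂ, m = z • n) {U : X.Opens}
    (t : Γ(E.pullX N, U)) {x : X} (hx : x ∈ U) :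
    ∃ (V : X.Opens) (hV : V ≤ U), x ∈ V ∧ ∃ a : Γ(X, V),
      secRes (E.pullX N) hV t = a • E.baseSec V n := by
  obtain ⟨V, hV, hxV, p, hp⟩ := ModFamily.toSec_locally_surjective t hx
  obtain ⟨a, rfl⟩ := E.exists_eq_smul_tmul hn V p
  exact ⟨V, hV, hxV, a, hp.symm.trans (map_smul _ _ _)⟩

lemma pullX_hom_ext {n : N} (hn : ∀ m : N, ∃ z : DualNumber ℂ, m = z • n) {f g : E.pullX N ⟶ M}
    (h : ∀ U, secMap f U (E.baseSec U n) = secMap g U (E.baseSec U n)) : f = g := by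
  refine hom_ext_sec fun U m => section_ext _ fun x hx => ?_
  obtain ⟨V, hV, hxV, a, ha⟩ := E.exists_eq_smul_baseSec hn m hx
  exact ⟨V, hV, hxV, by rw [← secMap_secRes, ← secMap_secRes, ha, map_smul, map_smul, h]⟩

lemma mono_of_secMap_baseSec {n : N} (hn : ∀ m : N, ∃ z : DualNumber ℂ, m = z • n)
    (f : E.pullX N ⟶ M) (h : ∀ U (a : Γ(X, U)), a • secMap f U (E.baseSec U n) = 0 → a = 0) :
    Mono f := by
  refine mono_of_secMap_injective _ fun U => (injective_iff_map_eq_zero _).2 fun m hm => ?_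
  refine section_ext _ fun x hx => ?_
  obtain ⟨V, hV, hxV, a, ha⟩ := E.exists_eq_smul_baseSec hn m hx
  refine ⟨V, hV, hxV, ?_⟩
  have e := secMap_secRes f hV m
  rw [hm, ha, map_smul, map_zero] at e
  rw [ha, h V a e, zero_smul, map_zero]

end Generated

/-- The differential `dε` on `Δ`. -/
def dEps : OmegaDelta :=
  CommRingCat.KaehlerDifferential.d (f := CommRingCat.ofHom (algebraMap ℂ (DualNumber ℂ)))
    (DualNumber.eps : DualNumber ℂ)

/-- For `c = c_0 + c_1 ε` with complex `c_0`, `c_1` one has `dc = c_1 dε`. The module is cyclic but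
not free, since `2 ε dε = 0`; this relation becomes empty after restriction to `X`, where `ε` is
zero. -/
lemma exists_eq_smul_dEps (ω : OmegaDelta) : ∃ z : DualNumber ℂ, ω = z • dEps := by
  induction ω using kaehler_induction with
  | h0 => exact ⟨0, (zero_smul _ _).symm⟩
  | hadd x y hx hy =>
    obtain ⟨a, rfl⟩ := hx
    obtain ⟨b, rfl⟩ := hy
    exact ⟨a + b, (add_smul _ _ _).symm⟩
  | hd b c =>
    let f := CommRingCat.ofHom (algebraMap ℂ (DualNumber ℂ))
    let D := CommRingCat.KaehlerDifferential.D f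
    have e : c = f (TrivSqZeroExt.fst (R := ℂ) (M := ℂ) c) +
        f (TrivSqZeroExt.snd (R := ℂ) (M := ℂ) c) * (DualNumber.eps : DualNumber ℂ) := by
      refine TrivSqZeroExt.ext ?_ ?_
      · change _ = TrivSqZeroExt.fst c + TrivSqZeroExt.snd c * 0
        rw [mul_zero, add_zero]
      · change _ = (0 : ℂ) + (TrivSqZeroExt.snd c * 1 + 0 * 0)
        ring
    have h : D.d c = (f (TrivSqZeroExt.snd (R := ℂ) (M := ℂ) c) : DualNumber ℂ) • D.d (DualNumber.eps : DualNumber ℂ) := by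
      refine (congrArg D.d e).trans ?_
      refine (D.d_add _ _).trans ?_
      refine (congrArg₂ (· + ·) (D.d_map _) (D.d_mul _ _)).trans ?_
      refine (zero_add _).trans ?_
      refine (congrArg₂ (· + ·) rfl (congrArg (_ • ·) (D.d_map _))).trans ?_
      refine (congrArg₂ (· + ·) rfl (smul_zero _)).trans (add_zero _)
    exact ⟨b * f (TrivSqZeroExt.snd (R := ℂ) (M := ℂ) c),
      (congrArg (b • ·) h).trans (smul_smul _ _ _)⟩

lemma dual_eps (U : X.Opens) : E.dual U (DualNumber.eps : DualNumber ℂ) = E.eps U := by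
  change E.const U 0 + E.const U 1 * E.eps U = _
  rw [map_zero, map_one, zero_add, one_mul]

lemma secMap_inclBase (U : X.Opens) :
    secMap E.inclBase U (E.baseSec U dEps) = E.dX U (E.eps U) := by
  refine (ModFamily.secMap_shf_map (P := (E.pull OmegaDelta).restrict) _ U _).trans ?_
  refine congrArg (E.diffFamily.restrict.toSec U) ?_
  change (1 : Γ(X, U)) • (((1 : Γ(X, U)) ⊗ₜ[E.Sec U] ((1 : E.Sec U) • E.baseDiff U dEps)) : E.DiffX U) = _
  rw [one_smul, one_smul, dEps, baseDiff_d, dual_eps]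

lemma secMap_inclBaseLog {ι : Type} [Fintype ι] (C : ι → X.IdealSheafData) (U : X.Opens) :
    secMap (E.inclBaseLog C) U (E.baseSec U (1 : OmegaDeltaLog)) =
      (E.preLog C).toSec U (Submodule.Quotient.mk (E.dlogEps C U)) := by
  refine (ModFamily.secMap_shf_map (P := (E.pull OmegaDeltaLog).restrict) _ U _).trans ?_
  refine congrArg ((E.preLog C).toSec U) ?_
  change (1 : Γ(X, U)) • E.proj U ((1 : E.Sec U) • E.dual U 1) •
    (Submodule.Quotient.mk (E.dlogEps C U) : E.LogMod C U) = _
  rw [map_one, one_smul, one_smul, map_one, one_smul]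

lemma secMap_residueBase (U : X.Opens) :
    secMap E.residueBase U (E.baseSec U (1 : OmegaDeltaLog)) = (1 : Γ(X, U)) := by
  refine (ModFamily.secMap_homEquiv_symm (P := (E.pull OmegaDeltaLog).restrict) _ U _).trans ?_
  change (1 : Γ(X, U)) • E.proj U ((1 : E.Sec U) • E.dual U 1) = _
  rw [map_one, one_smul, one_smul, map_one]

lemma exists_eq_smul_one (z : OmegaDeltaLog) : ∃ w : DualNumber ℂ, z = w • (1 : OmegaDeltaLog) :=
  ⟨z, (mul_one z).symm⟩

/-! ### The first row -/

lemma inclBase_toOmega : E.inclBase ≫ E.toOmega = 0 := by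
  refine E.pullX_hom_ext exists_eq_smul_dEps fun U => ?_
  rw [secMap_comp, secMap_inclBase, secMap_toOmega]
  exact map_zero (dOmega X s U)

/-- The product rule of the deformation makes `(a, m) ↦ m` a derivation. The resulting map `toF`
sends `a dε` to `i(a)`, and `𝒪_X → F` is injective. -/
instance : Mono E.inclBase := by
  have : Mono (E.inclBase ≫ E.toF) := by
    refine E.mono_of_secMap_baseSec exists_eq_smul_dEps _ fun U a h => ?_
    rw [secMap_comp, secMap_inclBase, secMap_toF, ← incl_eq_smul] at h
    exact E.incl_injective U (h.trans (map_zero _).symm)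
  exact mono_of_mono E.inclBase E.toF

section Descent

variable {q : E.omegaX ⟶ M} (hq : E.inclBase ≫ q = 0)

include hq

lemma secMap_dX_eps (U : X.Opens) : secMap q U (E.dX U (E.eps U)) = 0 := by
  rw [← secMap_inclBase, ← secMap_comp, hq]
  rfl

/-- Locally `z = w ε`, and `d(w ε) = w dε + ε dw`: the morphism `q` kills the first term, and the
second is zero because `ε` vanishes on `X`. -/
lemma secMap_dX_eq_zero {U : X.Opens} {z : E.Sec U} (h : E.proj U z = 0) :
    secMap q U (E.dX U z) = 0 := by
  refine section_ext _ fun x hx => ?_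
  obtain ⟨V, hV, hxV, w, hw⟩ := E.exists_eq_mul_eps h hx
  refine ⟨V, hV, hxV, ?_⟩
  rw [← secMap_secRes, secRes_dX, hw, dX_mul, map_add, map_smul, map_smul,
    E.secMap_dX_eps hq V, smul_zero, zero_add, map_zero]
  exact zero_smul _ _

lemma secMap_dX_congr {U : X.Opens} {z w : E.Sec U} (h : E.proj U z = E.proj U w) :
    secMap q U (E.dX U z) = secMap q U (E.dX U w) := by
  have e := E.secMap_dX_eq_zero hq (z := z - w) (by rw [map_sub, h, sub_self])
  have e1 := E.dX_add U (z - w) w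
  rw [sub_add_cancel] at e1
  rw [e1, map_add, e, zero_add]

/-- The value `q(dz)` depends only on `z|_X`. The values at local lifts of `a` therefore agree on
overlaps and glue to a section, which plays the role of the image of `da`. -/
lemma exists_descent (U : X.Opens) (a : Γ(X, U)) : ∃ t : Γ(M, U), ∀ (V : X.Opens) (hV : V ≤ U)
    (z : E.Sec V), E.proj V z = fRes X hV a → secRes M hV t = secMap q V (E.dX V z) := by
  have key : ∀ (V W T : X.Opens) (hV : V ≤ U) (hW : W ≤ U) (z : E.Sec V) (w : E.Sec W),
      E.proj V z = fRes X hV a → E.proj W w = fRes X hW a → ∀ (h₁ : T ≤ V) (h₂ : T ≤ W),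
      secRes M h₁ (secMap q V (E.dX V z)) = secRes M h₂ (secMap q W (E.dX W w)) := by
    intro V W T hV hW z w hz hw h₁ h₂
    rw [← secMap_secRes, ← secMap_secRes, secRes_dX, secRes_dX]
    refine E.secMap_dX_congr hq ?_
    rw [proj_sRes, proj_sRes, hz, hw, fRes_fRes, fRes_fRes]
  choose V hV hxV z hz using fun x : U => E.exists_lift a x.2
  obtain ⟨t, ht⟩ := exists_glue M V hV (fun x hx => ⟨⟨x, hx⟩, hxV ⟨x, hx⟩⟩)
    (fun x => secMap q (V x) (E.dX (V x) (z x)))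
    (fun x y => key _ _ _ (hV x) (hV y) _ _ (hz x) (hz y) _ _)
  refine ⟨t, fun W hW w hw => section_ext _ fun x hx => ?_⟩
  refine ⟨W ⊓ V ⟨x, hW hx⟩, inf_le_left, ⟨hx, hxV ⟨x, hW hx⟩⟩, ?_⟩
  rw [secRes_trans]
  refine (secRes_trans M (hV ⟨x, hW hx⟩) inf_le_right t).symm.trans ?_
  rw [ht]
  exact key _ _ _ (hV _) hW _ _ (hz _) hw _ _

omit hq in
/-- Two sections agree if they do so after restriction to the open subsets over which given
functions lift to the deformation. -/
lemma section_ext_of_lift {U : X.Opens} (a b : Γ(X, U)) {t u : Γ(M, U)}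
    (h : ∀ (V : X.Opens) (hV : V ≤ U) (z w : E.Sec V), E.proj V z = fRes X hV a →
      E.proj V w = fRes X hV b → secRes M hV t = secRes M hV u) : t = u := by
  refine section_ext _ fun x hx => ?_
  obtain ⟨V, hV, hxV, z, hz⟩ := E.exists_lift a hx
  obtain ⟨W, hW, hxW, w, hw⟩ := E.exists_lift (fRes X hV b) hxV
  refine ⟨W, hW.trans hV, hxW, h W _ (E.sRes hW z) w ?_ ?_⟩
  · rw [proj_sRes, hz, fRes_fRes]
  · rw [hw, fRes_fRes]

/-- The glued sections form a `ℂ`-derivation of `𝒪_X`, each identity being checked where the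
functions involved lift to the deformation; the universal property of `Ω¹_X` then gives `σ`. Since
`toOmega` is an epimorphism, this makes it the cokernel of `inclBase`, and the same factorization
provides `r`. -/
lemma exists_toOmega_comp_eq : ∃ σ : Omega X s ⟶ M, E.toOmega ≫ σ = q := by
  choose t ht using E.exists_descent hq
  have hadd : ∀ U a b, t U (a + b) = t U a + t U b := fun U a b => by
    refine E.section_ext_of_lift a b fun V hV z w hz hw => ?_
    rw [map_add, ht U a V hV z hz, ht U b V hV w hw,
      ht U (a + b) V hV (z + w) (by rw [map_add, map_add, hz, hw]), dX_add, map_add]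
  have hmul : ∀ U a b, t U (a * b) = a • t U b + b • t U a := fun U a b => by
    refine E.section_ext_of_lift a b fun V hV z w hz hw => ?_
    rw [map_add, (secRes M hV).map_smulₛₗ, (secRes M hV).map_smulₛₗ, ht U a V hV z hz,
      ht U b V hV w hw, ht U (a * b) V hV (z * w) (by rw [map_mul, map_mul, hz, hw]), dX_mul,
      map_add, map_smul, map_smul, hz, hw]
  have hc : ∀ U c, t U (scalar X s U c) = 0 := fun U c => by
    have h := ht U (scalar X s U c) U le_rfl (E.const U c) (fRes_self _ _).symm
    rw [secRes_self] at h
    rw [h, dX_const, map_zero]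
  have hres : ∀ {U V : X.Opens} (h : V ≤ U) a, secRes M h (t U a) = t V (fRes X h a) :=
    fun {U V} h a => by
      refine E.section_ext_of_lift (fRes X h a) 0 fun W hW z w hz hw => ?_
      rw [secRes_trans, ht U a W (hW.trans h) z (by rw [hz, fRes_fRes]), ht V _ W hW z hz]
  refine ⟨omegaDesc (fun U => AddMonoidHom.mk' (t U) (hadd U)) hmul hc hres,
    E.omegaX_hom_ext fun U z => ?_⟩
  rw [secMap_comp, secMap_toOmega]
  refine (secMap_omegaDesc _ _ _ _ U (E.proj U z)).trans ?_
  have h := ht U (E.proj U z) U le_rfl z (fRes_self _ _).symm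
  rwa [secRes_self] at h

end Descent

/-- The first row. -/
lemma shortExact_inclBase :
    (ShortComplex.mk E.inclBase E.toOmega E.inclBase_toOmega).ShortExact := by
  refine { exact := ?_, mono_f := inferInstance, epi_g := inferInstance }
  refine ShortComplex.exact_of_g_is_cokernel _ (Limits.CokernelCofork.IsColimit.ofπ _ _
    (fun q hq => (E.exists_toOmega_comp_eq hq).choose)
    (fun q hq => (E.exists_toOmega_comp_eq hq).choose_spec)
    (fun q hq m hm => ?_))
  rw [← cancel_epi E.toOmega, hm, (E.exists_toOmega_comp_eq hq).choose_spec]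

/-! ### The left residue -/

/-- The source is locally generated by `dε/ε`, which goes to `1`; so `a dε/ε ↦ a` has trivial kernel
and hits every function. -/
instance isIso_residueBase : IsIso E.residueBase := by
  have : Mono E.residueBase := by
    refine E.mono_of_secMap_baseSec exists_eq_smul_one _ fun U a h => ?_
    rw [secMap_residueBase] at h
    exact (mul_one a).symm.trans h
  have : Epi E.residueBase := by
    refine epi_of_locally_surjective _ fun U a x hx => ⟨U, le_rfl, hx, ?_⟩
    refine ⟨(show Γ(X, U) from a) • E.baseSec U (1 : OmegaDeltaLog), ?_⟩
    rw [map_smul, secMap_residueBase, secRes_self]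
    exact mul_one (show Γ(X, U) from a)
  exact isIso_of_mono_of_epi _

end CotangentExtension

/-! ### Local images -/

/-- Near `x`, the section `n` is in the image of `f`. -/
def LocallyImage {X : Scheme.{0}} {M N : X.Modules} (f : M ⟶ N) {U : X.Opens} (n : Γ(N, U))
    (x : X) : Prop :=
  ∃ (V : X.Opens) (hV : V ≤ U), x ∈ V ∧ ∃ m, secMap f V m = secRes N hV n

namespace LocallyImage

variable {X : Scheme.{0}} {M N : X.Modules} {f : M ⟶ N} {U : X.Opens} {n n' : Γ(N, U)} {x : X}

lemma of_eq (hx : x ∈ U) {m : Γ(M, U)} (h : secMap f U m = n) : LocallyImage f n x :=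
  ⟨U, le_rfl, hx, m, by rw [secRes_self, h]⟩

lemma of_secRes {V : X.Opens} (hV : V ≤ U) (h : LocallyImage f (secRes N hV n) x) :
    LocallyImage f n x := by
  obtain ⟨W, hW, hxW, m, hm⟩ := h
  exact ⟨W, hW.trans hV, hxW, m, by rw [hm, secRes_trans]⟩

lemma add (h : LocallyImage f n x) (h' : LocallyImage f n' x) : LocallyImage f (n + n') x := by
  obtain ⟨V, hV, hxV, m, hm⟩ := h
  obtain ⟨W, hW, hxW, m', hm'⟩ := h'
  refine ⟨V ⊓ W, inf_le_left.trans hV, ⟨hxV, hxW⟩,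
    secRes M (inf_le_left : V ⊓ W ≤ V) m + secRes M (inf_le_right : V ⊓ W ≤ W) m', ?_⟩
  rw [map_add, map_add, secMap_secRes, secMap_secRes, hm, hm', secRes_trans, secRes_trans]

lemma sum (hx : x ∈ U) {κ : Type} (J : Finset κ) (t : κ → Γ(N, U))
    (h : ∀ j ∈ J, LocallyImage f (t j) x) : LocallyImage f (∑ j ∈ J, t j) x := by
  classical
  induction J using Finset.induction_on with
  | empty => exact of_eq hx ((map_zero (secMap f U)).trans Finset.sum_empty.symm)
  | insert j J hj ih =>
    rw [Finset.sum_insert hj]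
    exact (h j (Finset.mem_insert_self _ _)).add
      (ih fun i hi => h i (Finset.mem_insert_of_mem hi))

end LocallyImage

/-! ### Local normal form of logarithmic differentials -/

namespace CotangentExtension

variable {X : Scheme.{0}} {s : X ⟶ SpecC} (E : CotangentExtension X s) {ι : Type} [Fintype ι]
  (C : ι → X.IdealSheafData)

/-- Local equations of the components with product `ε`. -/
@[ext]
structure LocalEqs (U : X.Opens) where
  eqn : ι → E.Sec U
  isGen : ∀ i, E.IsGen C i U (eqn i)
  prod_eq : ∏ i, eqn i = E.eps U

variable {E C}

/-- Restriction of local equations to a smaller open subset. -/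
def LocalEqs.restrict {U V : X.Opens} (h : V ≤ U) (m : E.LocalEqs C U) : E.LocalEqs C V where
  eqn i := E.sRes h (m.eqn i)
  isGen i := (m.isGen i).res E C (homOfLE h).op
  prod_eq := by rw [← map_prod, m.prod_eq, sRes_eps]

variable (E C)

/-- The section `dm/m`. -/
def dlogSec {U : X.Opens} (i : ι) (m : E.Sec U) (hm : E.IsGen C i U m) : Γ(E.omegaLog C, U) :=
  (E.preLog C).toSec U (Submodule.Quotient.mk (E.dlog C ⟨i, m, hm⟩))

/-- The section `dε/ε`. -/
def dlogEpsSec (U : X.Opens) : Γ(E.omegaLog C, U) :=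
  (E.preLog C).toSec U (Submodule.Quotient.mk (E.dlogEps C U))

variable {E C}

lemma secRes_dlogSec {U V : X.Opens} (h : V ≤ U) (i : ι) (m : E.Sec U) (hm : E.IsGen C i U m) :
    secRes (E.omegaLog C) h (E.dlogSec C i m hm) =
      E.dlogSec C i (E.sRes h m) (hm.res E C (homOfLE h).op) := by
  refine (ModFamily.secRes_toSec (P := E.preLog C) h _).trans ?_
  exact congrArg (fun t => (E.preLog C).toSec V (Submodule.Quotient.mk t))
    (E.logFreeRes_dlog C (homOfLE h).op _)

lemma secMap_toLog_toSec (U : X.Opens) (t : E.DiffX U) :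
    secMap (E.toLog C) U (E.diffFamily.restrict.toSec U t) =
      (E.preLog C).toSec U (Submodule.Quotient.mk ((t, 0, 0) : E.LogFree C U)) :=
  ModFamily.secMap_shf_map _ U _

lemma secMap_toLog_dX (U : X.Opens) (z : E.Sec U) :
    secMap (E.toLog C) U (E.dX U z) =
      (E.preLog C).toSec U (Submodule.Quotient.mk (E.oneD C z)) :=
  secMap_toLog_toSec U _

lemma secMap_toLog_dX_eqn {U : X.Opens} (i : ι) (m : E.Sec U) (hm : E.IsGen C i U m) :
    secMap (E.toLog C) U (E.dX U m) = E.proj U m • E.dlogSec C i m hm := by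
  rw [secMap_toLog_dX]
  refine Eq.trans (congrArg ((E.preLog C).toSec U) ?_) (map_smul _ _ _)
  refine ((Submodule.Quotient.eq _).2 ?_).trans
    (Submodule.Quotient.mk_smul (E.logRels C U) (E.proj U m) (E.dlog C ⟨i, m, hm⟩))
  exact Submodule.subset_span (LogRel.d_eq i m hm)

lemma dlogSec_unit_mul {U : X.Opens} (i : ι) {m m' u : E.Sec U} (hm : E.IsGen C i U m)
    (hm' : E.IsGen C i U m') (hu : IsUnit u) (h : m' = u * m) :
    E.proj U u • E.dlogSec C i m' hm' =
      E.proj U u • E.dlogSec C i m hm + secMap (E.toLog C) U (E.dX U u) := by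
  let T : E.LogFree C U →ₗ[Γ(X, U)] Γ(E.omegaLog C, U) :=
    ((E.preLog C).toSec U).comp (E.logRels C U).mkQ
  have e : T (E.proj U u • E.dlog C ⟨i, m', hm'⟩ - E.proj U u • E.dlog C ⟨i, m, hm⟩ -
      E.oneD C u) = 0 := by
    refine (congrArg ((E.preLog C).toSec U) ?_).trans (map_zero _)
    exact (Submodule.Quotient.mk_eq_zero _).2
      (Submodule.subset_span (LogRel.unit_mul i m m' hm hm' u hu h))
  rw [map_sub, map_sub, map_smul, map_smul, sub_sub, sub_eq_zero] at e
  rw [secMap_toLog_dX]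
  exact e

lemma LocalEqs.dlogEpsSec_eq {U : X.Opens} (m : E.LocalEqs C U) :
    E.dlogEpsSec C U = ∑ i, E.dlogSec C i (m.eqn i) (m.isGen i) := by
  refine Eq.trans (congrArg ((E.preLog C).toSec U) ?_) (map_sum _ _ _)
  refine ((Submodule.Quotient.eq _).2
    (Submodule.subset_span (LogRel.eps m.eqn m.isGen m.prod_eq))).trans ?_
  exact map_sum (E.logRels C U).mkQ _ _

/-- This is the logarithmic derivative of a product. Its use is the case where the product is `ε`:
the factor in front of the sum is then zero on `X`. -/
lemma secMap_toLog_dX_prod {U : X.Opens} (m : ι → E.Sec U) (hm : ∀ i, E.IsGen C i U (m i))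
    (J : Finset ι) :
    secMap (E.toLog C) U (E.dX U (∏ i ∈ J, m i)) =
      E.proj U (∏ i ∈ J, m i) • ∑ i ∈ J, E.dlogSec C i (m i) (hm i) := by
  classical
  induction J using Finset.induction_on with
  | empty =>
    have h := E.dX_const U 1
    rw [map_one] at h
    rw [Finset.prod_empty, h, map_zero, Finset.sum_empty, smul_zero]
  | insert j J hj ih =>
    rw [Finset.prod_insert hj, dX_mul, map_add, map_smul, map_smul, ih,
      secMap_toLog_dX_eqn j (m j) (hm j), Finset.sum_insert hj, map_mul]
    module

variable (hE : ∀ (U : X.Opens) (x : X), x ∈ U →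
  ∃ (V : X.Opens) (_ : V ≤ U) (_ : x ∈ V), Nonempty (E.LocalEqs C V))

include hE

/-- Locally `ε = ∏ m_i`, so `dε = ε ∑ dm_i/m_i`, and `ε` restricts to zero on `X`. Without local
equations of product `ε` nothing would relate `dε` to logarithmic symbols. -/
lemma inclBase_toLog : E.inclBase ≫ E.toLog C = 0 := by
  refine E.pullX_hom_ext exists_eq_smul_dEps fun U => section_ext _ fun x hx => ?_
  obtain ⟨V, hV, hxV, ⟨m⟩⟩ := hE U x hx
  refine ⟨V, hV, hxV, ?_⟩
  rw [secMap_comp, secMap_inclBase, ← secMap_secRes, secRes_dX, sRes_eps, ← m.prod_eq,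
    secMap_toLog_dX_prod m.eqn m.isGen, m.prod_eq]
  refine (zero_smul _ _).trans ?_
  exact (map_zero (secRes (E.omegaLog C) hV)).symm

omit hE

/-- The combinations of the sections `dm_i/m_i`. -/
def LocalEqs.logSum {U : X.Opens} (m : E.LocalEqs C U) :
    (ι → Γ(X, U)) →ₗ[Γ(X, U)] Γ(E.omegaLog C, U) :=
  Fintype.linearCombination Γ(X, U) (fun i => E.dlogSec C i (m.eqn i) (m.isGen i))

lemma LocalEqs.logSum_apply {U : X.Opens} (m : E.LocalEqs C U) (a : ι → Γ(X, U)) :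
    m.logSum a = ∑ i, a i • E.dlogSec C i (m.eqn i) (m.isGen i) := rfl

lemma LocalEqs.secRes_logSum {U V : X.Opens} (h : V ≤ U) (m : E.LocalEqs C U) (a : ι → Γ(X, U)) :
    secRes (E.omegaLog C) h (m.logSum a) = (m.restrict h).logSum (fun i => fRes X h (a i)) := by
  rw [logSum_apply, logSum_apply, map_sum]
  refine Finset.sum_congr rfl fun i _ => ?_
  rw [LinearMap.map_smulₛₗ, secRes_dlogSec]
  rfl

lemma LocalEqs.restrict_restrict {U V W : X.Opens} (h : V ≤ U) (h' : W ≤ V)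
    (m : E.LocalEqs C U) : (m.restrict h).restrict h' = m.restrict (h'.trans h) :=
  LocalEqs.ext (funext fun i => E.sRes_sRes h h' (m.eqn i))

/-- Near `x`, the section `t` is a combination of the sections `dm_i/m_i` and of a differential
without poles. -/
def LogForm {U : X.Opens} (m : E.LocalEqs C U) (t : Γ(E.omegaLog C, U)) (x : X) : Prop :=
  ∃ (V : X.Opens) (hV : V ≤ U) (_ : x ∈ V) (a : ι → Γ(X, V)) (ω : Γ(E.omegaX, V)),
    secRes (E.omegaLog C) hV t = secMap (E.toLog C) V ω + (m.restrict hV).logSum a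

namespace LogForm

variable {U : X.Opens} {m : E.LocalEqs C U} {x : X}

lemma add {t t' : Γ(E.omegaLog C, U)} (h : LogForm m t x) (h' : LogForm m t' x) :
    LogForm m (t + t') x := by
  obtain ⟨V, hV, hxV, a, ω, e⟩ := h
  obtain ⟨W, hW, hxW, b, η, e'⟩ := h'
  have h₁ : V ⊓ W ≤ V := inf_le_left
  have h₂ : V ⊓ W ≤ W := inf_le_right
  refine ⟨V ⊓ W, h₁.trans hV, ⟨hxV, hxW⟩,
    (fun i => fRes X h₁ (a i)) + (fun i => fRes X h₂ (b i)), secRes _ h₁ ω + secRes _ h₂ η, ?_⟩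
  have e1 := congrArg (secRes (E.omegaLog C) h₁) e
  have e2 := congrArg (secRes (E.omegaLog C) h₂) e'
  rw [secRes_trans, map_add, LocalEqs.secRes_logSum, LocalEqs.restrict_restrict, ← secMap_secRes]
    at e1 e2
  rw [map_add, e1, e2, map_add, map_add]
  abel

lemma smul {t : Γ(E.omegaLog C, U)} (b : Γ(X, U)) (h : LogForm m t x) : LogForm m (b • t) x := by
  obtain ⟨V, hV, hxV, a, ω, e⟩ := h
  refine ⟨V, hV, hxV, fRes X hV b • a, fRes X hV b • ω, ?_⟩
  rw [LinearMap.map_smulₛₗ, e, smul_add, map_smul, map_smul]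

lemma of_toLog (hx : x ∈ U) (ω : Γ(E.omegaX, U)) : LogForm m (secMap (E.toLog C) U ω) x :=
  ⟨U, le_rfl, hx, 0, ω, by rw [secRes_self, map_zero, add_zero]⟩

lemma zero (hx : x ∈ U) : LogForm m (0 : Γ(E.omegaLog C, U)) x := by
  have h := of_toLog (m := m) hx 0
  rwa [map_zero] at h

lemma of_secRes {t : Γ(E.omegaLog C, U)} {V : X.Opens} (hV : V ≤ U)
    (h : LogForm (m.restrict hV) (secRes _ hV t) x) : LogForm m t x := by
  obtain ⟨W, hW, hxW, a, ω, e⟩ := h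
  refine ⟨W, hW.trans hV, hxW, a, ω, ?_⟩
  rw [← secRes_trans _ hV hW, e, LocalEqs.restrict_restrict]

lemma of_logSum (hx : x ∈ U) (a : ι → Γ(X, U)) : LogForm m (m.logSum a) x := by
  refine ⟨U, le_rfl, hx, fun i => fRes X le_rfl (a i), 0, ?_⟩
  rw [map_zero, zero_add, LocalEqs.secRes_logSum]

lemma of_dlog_eqn (hx : x ∈ U) (i : ι) : LogForm m (E.dlogSec C i (m.eqn i) (m.isGen i)) x := by
  classical
  have h := of_logSum (m := m) hx (Pi.single i 1)
  rwa [LocalEqs.logSum, Fintype.linearCombination_apply_single, one_smul] at h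

/-- Near `x` one has `z = u m_i` with a unit `u`, whence `dz/z = dm_i/m_i + u⁻¹ du`, and the last
term has no pole. -/
lemma of_dlog (hx : x ∈ U) (i : ι) (z : E.Sec U) (hz : E.IsGen C i U z) :
    LogForm m (E.dlogSec C i z hz) x := by
  obtain ⟨V, hV, hxV, u, hu, e⟩ := (m.isGen i).exists_unit E hz hx
  refine of_secRes hV ?_
  rw [secRes_dlogSec]
  have h := dlogSec_unit_mul (C := C) i ((m.restrict hV).isGen i) (hz.res E C (homOfLE hV).op) hu e
  obtain ⟨v, hv⟩ := (hu.map (E.proj V)).exists_left_inv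
  have h' := congrArg (v • ·) h
  simp only [smul_add, smul_smul, hv, one_smul] at h'
  rw [h']
  exact (of_dlog_eqn hxV i).add ((of_toLog hxV _).smul v)

/-- The three kinds of generators are reduced separately: differentials have no poles, a symbol
`dz/z` is `of_dlog`, and `dε/ε = ∑ dm_i/m_i` because the `m_i` have product `ε`. One choice of local
equations thus suffices for all forms near `x`. -/
lemma of_section (hx : x ∈ U) (t : Γ(E.omegaLog C, U)) : LogForm m t x := by
  obtain ⟨V, hV, hxV, p, hp⟩ := ModFamily.toSec_locally_surjective t hx
  refine of_secRes hV ?_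
  obtain ⟨⟨ω, f, c⟩, rfl⟩ := Submodule.Quotient.mk_surjective (E.logRels C V) p
  let T : E.LogFree C V →ₗ[Γ(X, V)] Γ(E.omegaLog C, V) :=
    ((E.preLog C).toSec V).comp (E.logRels C V).mkQ
  have key : ∀ f : E.Gens C V →₀ Γ(X, V), LogForm (m.restrict hV) (T (0, f, 0)) x := by
    intro f
    induction f using Finsupp.induction_linear with
    | zero => exact (map_zero T).symm ▸ zero hxV
    | add f g hf hg =>
      have e : ((0, f + g, 0) : E.LogFree C V) = (0, f, 0) + (0, g, 0) := by simp
      rw [e, map_add]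
      exact hf.add hg
    | single g b =>
      have e : ((0, Finsupp.single g b, 0) : E.LogFree C V) = b • E.dlog C g := by
        simp [dlog]
      rw [e, map_smul]
      exact (of_dlog hxV g.idx g.eqn g.isGen).smul b
  have e : ((ω, f, c) : E.LogFree C V) = (ω, 0, 0) + (0, f, 0) + c • E.dlogEps C V := by
    simp [dlogEps]
  have hp' : T (ω, f, c) = secRes (E.omegaLog C) hV t := hp
  rw [← hp', e, map_add, map_add, map_smul]
  refine (LogForm.add ?_ (key f)).add (LogForm.smul c ?_)
  · have h := of_toLog (m := m.restrict hV) hxV (E.diffFamily.restrict.toSec V ω)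
    rw [secMap_toLog_toSec] at h
    exact h
  · change LogForm _ (E.dlogEpsSec C V) x
    have h := of_logSum (m := m.restrict hV) hxV 1
    rw [LocalEqs.logSum_apply] at h
    simp only [Pi.one_apply, one_smul] at h
    rwa [(m.restrict hV).dlogEpsSec_eq]

end LogForm

/-! ### The residue -/

section Residue

variable [DecidableEq ι]

lemma toLog_residue : E.toLog C ≫ E.residue C = 0 := by
  refine E.omegaX_hom_ext fun U z => ?_
  rw [secMap_comp, secMap_toLog_dX]
  refine (ModFamily.secMap_shf_map _ U _).trans ?_
  exact (congrArg ((closedFamily C).toSec U) (E.residueFree_oneD C U z)).trans (map_zero _)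

lemma secMap_residue_toLog (U : X.Opens) (ω : Γ(E.omegaX, U)) :
    secMap (E.residue C) U (secMap (E.toLog C) U ω) = 0 := by
  rw [← secMap_comp, toLog_residue, secMap_zero]

lemma secMap_residue_dlogSec {U : X.Opens} (i : ι) (m : E.Sec U) (hm : E.IsGen C i U m) :
    secMap (E.residue C) U (E.dlogSec C i m hm) =
      (closedFamily C).toSec U (Pi.single i 1 : ∀ i, Restr (C i) U) := by
  refine (ModFamily.secMap_shf_map _ U _).trans ?_
  exact congrArg ((closedFamily C).toSec U) (E.residueFree_dlog C U ⟨i, m, hm⟩)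

lemma secMap_residue_logSum {U : X.Opens} (m : E.LocalEqs C U) (a : ι → Γ(X, U)) :
    secMap (E.residue C) U (m.logSum a) =
      (closedFamily C).toSec U (fun i => algebraMap Γ(X, U) (Restr (C i) U) (a i)) := by
  rw [LocalEqs.logSum_apply]
  simp only [map_sum, map_smul, secMap_residue_dlogSec]
  have e : (fun i => algebraMap Γ(X, U) (Restr (C i) U) (a i)) =
      ∑ i, a i • (Pi.single i 1 : ∀ i, Restr (C i) U) := by
    refine (Finset.univ_sum_single _).symm.trans (Finset.sum_congr rfl fun i _ => ?_)
    rw [← Pi.single_smul, Algebra.smul_def, mul_one]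
  rw [e]
  refine Eq.trans ?_ (map_sum ((closedFamily C).toSec U) _ _).symm
  exact Finset.sum_congr rfl fun i _ => (map_smul ((closedFamily C).toSec U) _ _).symm

lemma inclBaseLog_residue :
    E.inclBaseLog C ≫ E.residue C = E.residueBase ≫ toNormalization C := by
  refine E.pullX_hom_ext exists_eq_smul_one fun U => ?_
  rw [secMap_comp, secMap_comp, secMap_inclBaseLog]
  refine (ModFamily.secMap_shf_map _ U _).trans ?_
  refine Eq.trans ?_ (congrArg (secMap (toNormalization C) U) (E.secMap_residueBase U)).symm
  refine Eq.trans ?_ (secMap_toNormalization U (1 : Γ(X, U))).symm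
  refine congrArg ((closedFamily C).toSec U) ((E.residueFree_dlogEps C U).trans ?_)
  funext i
  exact (map_one _).symm

include hE

/-- The middle column. -/
lemma exact_toLog_residue :
    (ShortComplex.mk (E.toLog C) (E.residue C) E.toLog_residue).Exact := by
  refine exact_of_locally_exact _ _ _ fun U t ht x hx => ?_
  change LocallyImage (E.toLog C) t x
  obtain ⟨V, hV, hxV, ⟨m⟩⟩ := hE U x hx
  refine LocallyImage.of_secRes hV ?_
  -- In the normal form `ω + ∑ a_i dm_i/m_i` the residue is the family `(a_i|X_i)`; its vanishing as
  -- a section of the associated sheaf gives actual vanishing on a smaller neighbourhood `T`.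
  obtain ⟨W, hW, hxW, a, ω, e⟩ := LogForm.of_section (m := m) hxV (secRes _ hV t)
  refine LocallyImage.of_secRes hW ?_
  have h0 := congrArg (secMap (E.residue C) W) e
  rw [secMap_secRes, secMap_secRes, ht, map_zero, map_zero, map_add, secMap_residue_toLog, zero_add]
    at h0
  have h1 := h0.trans (secMap_residue_logSum (m.restrict hW) a)
  obtain ⟨T, hT, hxT, hz⟩ := ModFamily.toSec_locally_injective _ h1.symm hxW
  rw [e, LocalEqs.logSum_apply]
  refine (LocallyImage.of_eq hxW rfl).add (LocallyImage.sum hxW _ _ fun i _ => ?_)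
  refine LocallyImage.of_secRes hT ?_
  -- A lift `z` of `a_i` to the deformation vanishes on `X_i`, so it is locally `w m_i`. Then `a_i
  -- dm_i/m_i = w m_i dm_i/m_i = w dm_i` on `X`, a differential without poles.
  obtain ⟨S, hS, hxS, z, hz'⟩ := E.exists_lift (fRes X hT (a i)) hxT
  have hv : E.Vanishes (C i) z := by
    change algebraMap _ _ (E.proj S z) = 0
    rw [hz']
    refine (restrRes_algebraMap (C i) (homOfLE hS).op _).symm.trans ?_
    refine (congrArg _ ((restrRes_algebraMap (C i) (homOfLE hT).op _).symm.trans
      (congrFun hz i))).trans (map_zero _)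
  obtain ⟨R, hR, hR', hxR, w, hw⟩ := (((m.restrict hW).restrict hT).isGen i).2 S hS z hv x hxS
  refine ⟨R, hR', hxR, E.proj R w • E.dX R ((((m.restrict hW).restrict hT).restrict hR').eqn i), ?_⟩
  rw [map_smul, secMap_toLog_dX_eqn i _ ((((m.restrict hW).restrict hT).restrict hR').isGen i),
    LinearMap.map_smulₛₗ, LinearMap.map_smulₛₗ, secRes_dlogSec, secRes_dlogSec, smul_smul]
  have e2 := congrArg (E.proj R) hw
  rw [map_mul] at e2
  have e3 : E.proj R (E.sRes hR z) = fRes X hR' (fRes X hT (a i)) := by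
    rw [proj_sRes, hz', fRes_fRes]
  exact congrArg (· • _) (e2.symm.trans e3)

/-- Over an affine open subset, functions on the components extend to functions `a_i`, and `∑ a_i
dm_i/m_i` has the prescribed residue. -/
lemma epi_residue {n : ℕ} (hX : IsNormalCrossing s n C) : Epi (E.residue C) := by
  refine epi_of_locally_surjective _ fun U u x hx => ?_
  obtain ⟨V, hV, hxV, hrep⟩ := ModFamily.exists_rep u hx
  obtain ⟨V', hV', hxV', ⟨m⟩⟩ := hE V x hxV
  obtain ⟨W, -, hW, hxW⟩ := hX.exists_chart hxV'
  obtain ⟨p, hp⟩ := hrep W.1 (hW.trans hV')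
  choose a ha using fun i => restr_algebraMap_surjective (C i) W (p i)
  refine ⟨W.1, (hW.trans hV').trans hV, hxW, _,
    (secMap_residue_logSum (m.restrict hW) a).trans ?_⟩
  rw [← hp]
  exact congrArg _ (funext ha)

end Residue

omit hE

/-! ### The second row and the right column -/

/-- Taking residues turns this map into `𝒪_X → a_* 𝒪_{X^{[1]}}`, preceded by an isomorphism. Thus no
form `a dε/ε` with `a ≠ 0` is killed by the relations among logarithmic symbols. -/
lemma mono_inclBaseLog {n : ℕ} (hX : IsNormalCrossing s n C) : Mono (E.inclBaseLog C) := by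
  classical
  have := mono_toNormalization hX
  have : Mono (E.inclBaseLog C ≫ E.residue C) := by
    rw [inclBaseLog_residue]
    infer_instance
  exact mono_of_mono _ (E.residue C)

lemma inclBaseLog_toRelLog : E.inclBaseLog C ≫ E.toRelLog C = 0 :=
  Limits.cokernel.condition (E.inclBaseLog C)

lemma shortExact_inclBaseLog {n : ℕ} (hX : IsNormalCrossing s n C) :
    (ShortComplex.mk (E.inclBaseLog C) (E.toRelLog C)
      E.inclBaseLog_toRelLog).ShortExact where
  exact := ShortComplex.exact_cokernel (E.inclBaseLog C)
  mono_f := E.mono_inclBaseLog hX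
  epi_g := inferInstanceAs (Epi (Limits.cokernel.π (E.inclBaseLog C)))

section Order

variable [LinearOrder ι]

variable (E C) in
/-- The residue of relative logarithmic differentials. -/
def residueRel : E.omegaRelLog C ⟶ Limits.kernel (cech2 C) :=
  Limits.cokernel.desc (E.inclBaseLog C)
    (E.residue C ≫ Limits.kernel.lift (cech2 C) (cech1 C) (cech1_comp_cech2 C)) (by
      rw [← Category.assoc, inclBaseLog_residue, Category.assoc, toNormalization_comp_lift,
        Limits.comp_zero])

lemma toRelLog_residueRel : E.toRelLog C ≫ E.residueRel C =
    E.residue C ≫ Limits.kernel.lift (cech2 C) (cech1 C) (cech1_comp_cech2 C) :=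
  Limits.cokernel.π_desc _ _ _

include hE

omit [LinearOrder ι] in
-- Since `dε` becomes zero among logarithmic differentials, the composite kills the image of the
-- base and factors through the cokernel `Ω¹_X` of the first row.
lemma exists_omega_to_relLog :
    ∃ r : Omega X s ⟶ E.omegaRelLog C, E.toOmega ≫ r = E.toLog C ≫ E.toRelLog C :=
  E.exists_toOmega_comp_eq (by
    rw [← Category.assoc, inclBase_toLog hE, Limits.zero_comp])

lemma epi_residueRel {n : ℕ} (hX : IsNormalCrossing s n C) : Epi (E.residueRel C) := by
  have := epi_residue hE hX
  have := (shortExact_toNormalization hX).epi_g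
  have : Epi (E.toRelLog C ≫ E.residueRel C) := by
    rw [toRelLog_residueRel]
    exact epi_comp _ _
  exact epi_of_epi (E.toRelLog C) _

/-- It is shown that `residueRel` is the cokernel of `r`. A map `g` killing `r`, composed with
`toRelLog`, kills all differentials without poles and so factors through the residue by the middle
column. The factor kills `𝒪_X`, so the third row lets it descend to the kernel of `cech2`. -/
lemma exact_residueRel {n : ℕ} (hX : IsNormalCrossing s n C) {r : Omega X s ⟶ E.omegaRelLog C}
    (hr : E.toOmega ≫ r = E.toLog C ≫ E.toRelLog C) :
    ∃ w, (ShortComplex.mk r (E.residueRel C) w).Exact := by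
  have w : r ≫ E.residueRel C = 0 := by
    rw [← cancel_epi E.toOmega, ← Category.assoc, hr, Category.assoc, toRelLog_residueRel,
      ← Category.assoc, toLog_residue, Limits.zero_comp, Limits.comp_zero]
  have := epi_residue hE hX
  have := epi_residueRel hE hX
  have hN := shortExact_toNormalization hX
  have := hN.epi_g
  have : Epi (E.toRelLog C) := (E.shortExact_inclBaseLog hX).epi_g
  have key : ∀ {Z : X.Modules} (g : E.omegaRelLog C ⟶ Z), r ≫ g = 0 →
      ∃ h, E.residueRel C ≫ h = g := by
    intro Z g hg
    have h1 : E.toLog C ≫ E.toRelLog C ≫ g = 0 := by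
      rw [← Category.assoc, ← hr, Category.assoc, hg, Limits.comp_zero]
    have : Epi (ShortComplex.mk (E.toLog C) (E.residue C) E.toLog_residue).g :=
      epi_residue hE hX
    let a := (exact_toLog_residue hE).desc (E.toRelLog C ≫ g) h1
    have ha : E.residue C ≫ a = E.toRelLog C ≫ g :=
      (exact_toLog_residue hE).g_desc (E.toRelLog C ≫ g) h1
    -- As `residueBase` is an epimorphism, this can be tested on `dε/ε`, which dies in the relative
    -- logarithmic differentials.
    have h2 : toNormalization C ≫ a = 0 := by
      rw [← cancel_epi E.residueBase, ← Category.assoc, ← inclBaseLog_residue, Category.assoc, ha,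
        ← Category.assoc, inclBaseLog_toRelLog, Limits.zero_comp, Limits.comp_zero]
    have := hN.epi_g
    refine ⟨hN.exact.desc a h2, ?_⟩
    have hb : Limits.kernel.lift (cech2 C) (cech1 C) (cech1_comp_cech2 C) ≫
      hN.exact.desc a h2 = a := hN.exact.g_desc a h2
    rw [← cancel_epi (E.toRelLog C), ← Category.assoc, toRelLog_residueRel, Category.assoc, hb, ha]
  refine ⟨w, ShortComplex.exact_of_g_is_cokernel _ (Limits.CokernelCofork.IsColimit.ofπ _ _
    (fun q hq => (key q hq).choose) (fun q hq => (key q hq).choose_spec) (fun q hq m hm => ?_))⟩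
  rw [← cancel_epi (E.residueRel C), hm, (key q hq).choose_spec]

end Order

end CotangentExtension

/-! ### Derivations of étale algebras over the local model -/

section Derivations

/-- The trivial square-zero extension of `A` by `M`. -/
abbrev DualExt (A M : Type) [CommRing A] [AddCommGroup M] [Module A M] : Type :=
  SqZero (0 : Derivation ℤ A PUnit) (0 : M →ₗ[A] PUnit)

namespace DualExt

variable {A M : Type} [CommRing A] [AddCommGroup M] [Module A M]

/-- The ring homomorphism given by a derivation. -/
def ofDerivation {B : Type} [CommRing B] (g : B →+* A) (D : B →+ M) (h1 : D 1 = 0)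
    (hmul : ∀ b c, D (b * c) = g b • D c + g c • D b) : B →+* DualExt A M where
  toFun b := ⟨g b, D b, rfl⟩
  map_zero' := SqZero.ext (map_zero g) (map_zero D)
  map_one' := SqZero.ext (map_one g) h1
  map_add' b c := SqZero.ext (map_add g b c) (map_add D b c)
  map_mul' b c := SqZero.ext (map_mul g b c) (hmul b c)

lemma isNilpotent_ker : IsNilpotent (RingHom.ker (SqZero.fstHom : DualExt A M →+* A)) := by
  refine ⟨2, ?_⟩
  rw [pow_two, Ideal.zero_eq_bot, eq_bot_iff, Ideal.mul_le]
  intro a ha b hb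
  change a.fst = 0 at ha
  change b.fst = 0 at hb
  refine SqZero.ext ?_ ?_
  · rw [SqZero.mul_fst, ha, zero_mul]
    rfl
  · rw [SqZero.mul_snd, ha, hb, zero_smul, zero_smul, zero_add]
    rfl

end DualExt

variable {n k : ℕ} {hk : k ≤ n + 1} {A : Type} [CommRing A] {M : Type} [AddCommGroup M]
  [Module A M]

/-- Derivations of an algebra which is formally smooth over the local model can be prescribed on
the coordinates, subject to the relation coming from the equation of the model. -/
lemma exists_derivation [Algebra (ModelRing n k hk) A] [Algebra.FormallySmooth (ModelRing n k hk) A]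
    (e : Fin (n + 1) → M)
    (he : ∑ j : Fin k, (∏ l ∈ Finset.univ.erase j,
      algebraMap (ModelRing n k hk) A (modelX hk (Fin.castLE hk l))) • e (Fin.castLE hk j) = 0) :
    ∃ D : A →+ M, (∀ a b, D (a * b) = a • D b + b • D a) ∧
      (∀ c : ℂ, D (algebraMap (ModelRing n k hk) A (algebraMap ℂ _ c)) = 0) ∧
      ∀ j, D (algebraMap (ModelRing n k hk) A (modelX hk j)) = e j := by
  let inl : A →+* DualExt A M := DualExt.ofDerivation (RingHom.id A) 0 rfl (by simp)
  let x : Fin (n + 1) → A := fun j => algebraMap (ModelRing n k hk) A (modelX hk j)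
  -- A derivation of `A` into `M` is a ring section of `A ⊕ M → A`. On the polynomial ring the
  -- section is prescribed by `X_j ↦ (x_j, e_j)`. By the Leibniz rule for products, `he` says
  -- exactly that the second component of the image of the equation is zero, so `g₀` descends to the
  -- model.
  let g₀ : MvPolynomial (Fin (n + 1)) ℂ →+* DualExt A M := MvPolynomial.eval₂Hom
    (inl.comp ((algebraMap (ModelRing n k hk) A).comp (algebraMap ℂ _))) (fun j => ⟨x j, e j, rfl⟩)
  have hg₀ : g₀ (∏ j : Fin k, MvPolynomial.X (Fin.castLE hk j)) = 0 := by
    rw [map_prod]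
    simp only [g₀, MvPolynomial.eval₂Hom_X']
    refine SqZero.ext ?_ ?_
    · rw [SqZero.prod_fst]
      change ∏ j : Fin k, algebraMap (ModelRing n k hk) A (modelX hk (Fin.castLE hk j)) = 0
      rw [← map_prod, prod_modelX, map_zero]
    · rw [SqZero.prod_snd]
      exact he
  let g : ModelRing n k hk →+* DualExt A M := Ideal.Quotient.lift _ g₀ (fun a ha => by
    obtain ⟨b, rfl⟩ := Ideal.mem_span_singleton'.1 ha
    rw [map_mul, hg₀, mul_zero])
  have hg : SqZero.fstHom.comp g = algebraMap (ModelRing n k hk) A := by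
    refine Ideal.Quotient.ringHom_ext (MvPolynomial.ringHom_ext ?_ ?_)
    · intro c
      change (g₀ (MvPolynomial.C c)).fst = _
      rw [MvPolynomial.eval₂Hom_C]
      rfl
    · intro j
      change (g₀ (MvPolynomial.X j)).fst = _
      rw [MvPolynomial.eval₂Hom_X']
      rfl
  let _ := g.toAlgebra
  let f : DualExt A M →ₐ[ModelRing n k hk] A :=
    { SqZero.fstHom with commutes' := fun b => congr($hg b) }
  have hf : Function.Surjective f := fun a => ⟨inl a, rfl⟩
  -- The extension is an algebra over the model through `g`, so an algebra section takes the
  -- prescribed values on coordinates. Formal smoothness provides one, the kernel of the projection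
  -- having square zero.
  let σ := Algebra.FormallySmooth.liftOfSurjective (AlgHom.id (ModelRing n k hk) A) f hf
    DualExt.isNilpotent_ker
  have hσ : ∀ a, (σ a).fst = a := Algebra.FormallySmooth.liftOfSurjective_apply _ f hf _
  refine ⟨AddMonoidHom.mk' (fun a => (σ a).snd) (fun a b => by rw [map_add, SqZero.add_snd]),
    fun a b => ?_, fun c => ?_, fun j => ?_⟩
  · change (σ (a * b)).snd = a • (σ b).snd + b • (σ a).snd
    rw [map_mul, SqZero.mul_snd, hσ, hσ]
  · change (σ (algebraMap _ A _)).snd = 0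
    rw [σ.commutes]
    change (g₀ (MvPolynomial.C c)).snd = 0
    rw [MvPolynomial.eval₂Hom_C]
    rfl
  · change (σ (algebraMap _ A _)).snd = _
    rw [σ.commutes]
    change (g₀ (MvPolynomial.X j)).snd = _
    rw [MvPolynomial.eval₂Hom_X']

/-- A derivation of an algebra formally unramified over the local model which annihilates the
coordinates vanishes. -/
lemma derivation_eq_zero [Algebra (ModelRing n k hk) A]
    [Algebra.FormallyUnramified (ModelRing n k hk) A] (D : A →+ M)
    (hmul : ∀ a b, D (a * b) = a • D b + b • D a)
    (hc : ∀ c : ℂ, D (algebraMap (ModelRing n k hk) A (algebraMap ℂ _ c)) = 0)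
    (hx : ∀ j, D (algebraMap (ModelRing n k hk) A (modelX hk j)) = 0) (a : A) : D a = 0 := by
  have h1 : D 1 = 0 := by
    have := hc 1
    rwa [map_one, map_one] at this
  -- The ring maps `a ↦ (a, D a)` and `a ↦ (a, 0)` both lift the identity of `A` through a
  -- square-zero ideal and agree on the model, hence coincide when `A` is unramified over it.
  let g₁ : A →+* DualExt A M := DualExt.ofDerivation (RingHom.id A) D h1 hmul
  let g₂ : A →+* DualExt A M := DualExt.ofDerivation (RingHom.id A) 0 rfl (by simp)
  have h : g₁.comp (algebraMap (ModelRing n k hk) A) = g₂.comp (algebraMap (ModelRing n k hk) A) := by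
    refine Ideal.Quotient.ringHom_ext (MvPolynomial.ringHom_ext ?_ ?_)
    · exact fun c => SqZero.ext rfl (hc c)
    · exact fun j => SqZero.ext rfl (hx j)
  let _ := (g₂.comp (algebraMap (ModelRing n k hk) A)).toAlgebra
  let f₁ : A →ₐ[ModelRing n k hk] DualExt A M := { g₁ with commutes' := fun b => congr($h b) }
  let f₂ : A →ₐ[ModelRing n k hk] DualExt A M := { g₂ with commutes' := fun b => rfl }
  have e := Algebra.FormallyUnramified.ext' SqZero.fstHom DualExt.isNilpotent_ker f₁ f₂
    (fun _ => rfl)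
  exact congrArg SqZero.snd (DFunLike.congr_fun e a)

end Derivations

/-! ### Differentials in a chart -/

namespace Chart

variable {X : Scheme.{0}} {s : X ⟶ SpecC} {n : ℕ} {ι : Type} {C : ι → X.IdealSheafData}
  {W : X.affineOpens} (ch : Chart s n C W)

/-- The partial derivatives of the equation of the model. -/
def hat (j : Fin (n + 1)) : Γ(X, W.1) :=
  if h : j.1 < ch.k then
    ∏ l ∈ Finset.univ.erase (⟨j.1, h⟩ : Fin ch.k), ch.x (Fin.castLE ch.hk l)
  else 0

lemma hat_castLE (j : Fin ch.k) :
    ch.hat (Fin.castLE ch.hk j) = ∏ l ∈ Finset.univ.erase j, ch.x (Fin.castLE ch.hk l) :=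
  dif_pos j.2

lemma sum_hat_smul {M : Type} [AddCommGroup M] [Module Γ(X, W.1) M] (e : Fin (n + 1) → M) :
    ∑ j, ch.hat j • e j = ∑ j : Fin ch.k,
      (∏ l ∈ Finset.univ.erase j, ch.x (Fin.castLE ch.hk l)) • e (Fin.castLE ch.hk j) := by
  have h : ∀ j ∈ Finset.univ, j ∉ Finset.univ.map (Fin.castLEEmb ch.hk) → ch.hat j • e j = 0 := by
    intro j _ hj
    rw [hat, dif_neg, zero_smul]
    exact fun h => hj (Finset.mem_map.2 ⟨⟨j.1, h⟩, Finset.mem_univ _, rfl⟩)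
  rw [← Finset.sum_subset (Finset.subset_univ _) h, Finset.sum_map]
  exact Finset.sum_congr rfl fun j _ => congrArg (· • _) (ch.hat_castLE j)

/-- The differential of a function on `W`. -/
abbrev kd (a : Γ(X, W.1)) : CommRingCat.KaehlerDifferential (scalar X s W.1) :=
  CommRingCat.KaehlerDifferential.d (f := scalar X s W.1) a

/-- Modulo the span of the `dx_j`, the universal derivation kills the coordinates; it is therefore
zero, since the chart is unramified over the model. -/
lemma exists_kd_eq_sum (a : Γ(X, W.1)) :
    ∃ g : Fin (n + 1) → Γ(X, W.1), (kd a : CommRingCat.KaehlerDifferential (scalar X s W.1)) =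
      ∑ j, g j • kd (ch.x j) := by
  let N : Submodule Γ(X, W.1) (CommRingCat.KaehlerDifferential (scalar X s W.1)) :=
    Submodule.span _ (Set.range fun j => kd (ch.x j))
  let D : Γ(X, W.1) →+ (CommRingCat.KaehlerDifferential (scalar X s W.1) ⧸ N) :=
    AddMonoidHom.mk' (fun a => N.mkQ (kd a)) (fun a b =>
      (congrArg N.mkQ (ModuleCat.Derivation.d_add (CommRingCat.KaehlerDifferential.D (scalar X s W.1)) a b)).trans (map_add _ _ _))
  let _ := ch.φ.toAlgebra
  have : Algebra.Etale (ModelRing n ch.k ch.hk) Γ(X, W.1) := ch.etale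
  have h : D a = 0 := by
    refine derivation_eq_zero (n := n) (k := ch.k) (hk := ch.hk) D (fun a b => ?_) (fun c => ?_) (fun j => ?_) a
    · refine (congrArg N.mkQ (ModuleCat.Derivation.d_mul (CommRingCat.KaehlerDifferential.D (scalar X s W.1)) a b)).trans ?_
      exact (map_add N.mkQ _ _).trans (congrArg₂ _ (map_smul N.mkQ _ _) (map_smul N.mkQ _ _))
    · refine (congrArg D (ch.scalar_eq c)).trans ?_
      exact (congrArg N.mkQ (ModuleCat.Derivation.d_map (CommRingCat.KaehlerDifferential.D (scalar X s W.1)) c)).trans (map_zero _)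
    · exact (Submodule.Quotient.mk_eq_zero _).2 (Submodule.subset_span ⟨j, rfl⟩)
  obtain ⟨g, hg⟩ := (Submodule.mem_span_range_iff_exists_fun _).1 ((Submodule.Quotient.mk_eq_zero N).1 h)
  exact ⟨g, hg.symm⟩

/-- The only relation among the `dx_j` is the differential of the equation. Smoothness over the
model gives a derivation into the free module modulo `hat` that sends `x_j` to the `j`-th basis
vector; applied to the relation `g`, it shows that `g` is a multiple of `hat`. -/
lemma exists_eq_mul_hat (g : Fin (n + 1) → Γ(X, W.1))
    (hg : (∑ j, g j • kd (ch.x j) : CommRingCat.KaehlerDifferential (scalar X s W.1)) = 0) :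
    ∃ b, ∀ j, g j = b * ch.hat j := by
  let N : Submodule Γ(X, W.1) (Fin (n + 1) → Γ(X, W.1)) := Submodule.span _ {ch.hat}
  let _ := ch.φ.toAlgebra
  have : Algebra.Etale (ModelRing n ch.k ch.hk) Γ(X, W.1) := ch.etale
  obtain ⟨D, hmul, hc, hx⟩ := exists_derivation (n := n) (k := ch.k) (hk := ch.hk) (A := Γ(X, W.1))
    (fun j => N.mkQ (Pi.single j 1)) (by
      refine (ch.sum_hat_smul (fun j => N.mkQ (Pi.single j 1))).symm.trans ?_
      simp only [← map_smul, ← map_sum]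
      refine (Submodule.Quotient.mk_eq_zero _).2 (Submodule.mem_span_singleton.2 ⟨1, ?_⟩)
      rw [one_smul]
      refine (Finset.univ_sum_single ch.hat).symm.trans (Finset.sum_congr rfl fun j _ => ?_)
      rw [← Pi.single_smul, smul_eq_mul, mul_one])
  have h := congrArg (kaehlerLift (scalar X s W.1) (RingHom.id Γ(X, W.1)) D hmul
    (fun c => (congrArg D (ch.scalar_eq c)).symm.trans (hc c))) hg
  rw [map_zero, map_sum] at h
  have h' : ∑ j, g j • N.mkQ (Pi.single j 1) = 0 := by
    refine Eq.trans (Finset.sum_congr rfl fun j _ => ?_) h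
    refine Eq.trans ?_ (kaehlerLift_smul _ _ _ _ _ _ _).symm
    exact congrArg (g j • ·) ((kaehlerLift_d _ _ _ _ _ _).trans (hx j)).symm
  simp only [← map_smul, ← map_sum] at h'
  obtain ⟨b, hb⟩ := Submodule.mem_span_singleton.1 ((Submodule.Quotient.mk_eq_zero N).1 h')
  refine ⟨b, fun j => ?_⟩
  have := congrFun hb j
  rw [Pi.smul_apply, smul_eq_mul, Finset.sum_apply, Finset.sum_eq_single j] at this
  · rw [this, Pi.smul_apply, Pi.single_eq_same, smul_eq_mul, mul_one]
  · intro i _ hi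
    rw [Pi.smul_apply, Pi.single_eq_of_ne hi.symm, smul_zero]
  · exact fun h => (h (Finset.mem_univ j)).elim

/-- This is injectivity at the left end of the presentation of `Ω¹_X` by the coordinates, and it
comes from the regularity of the coordinates appearing in the equation. -/
lemma eq_zero_of_forall_mul_hat_eq_zero {b : Γ(X, W.1)} (h : ∀ j, b * ch.hat j = 0) : b = 0 := by
  refine ((regularFamily_modelX ch.hk).map_of_flat ch.φ ch.flat).eq_zero_of_forall_mul_prod_eq_zero
    ?_ fun i => ?_
  · rw [← map_prod, prod_modelX, map_zero]
  · have := h (Fin.castLE ch.hk i)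
    rwa [hat_castLE] at this

lemma basicOpen_hat (f : Γ(X, W.1)) (j : Fin (n + 1)) :
    (ch.basicOpen f).hat j = fRes X (X.basicOpen_le f) (ch.hat j) := by
  unfold hat
  change (if h : j.1 < ch.k then _ else _) = _
  split_ifs with h
  · rw [map_prod]
    rfl
  · rw [map_zero]
    rfl

/-- Restriction of charts to smaller open neighbourhoods. -/
lemma exists_restrict {V : X.Opens} {x : X} (hx : x ∈ W.1) (hxV : x ∈ V) :
    ∃ (W' : X.affineOpens) (h : W'.1 ≤ W.1) (ch' : Chart s n C W'), W'.1 ≤ V ∧ x ∈ W'.1 ∧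
      (∀ j, ch'.x j = fRes X h (ch.x j)) ∧ (∀ j, ch'.hat j = fRes X h (ch.hat j)) ∧
      ∀ i, ch'.y i = fRes X h (ch.y i) := by
  obtain ⟨f, hf, hxf⟩ := W.2.exists_basicOpen_le (V := V) ⟨x, hxV⟩ hx
  refine ⟨X.affineBasicOpen f, X.basicOpen_le f, ch.basicOpen f, hf, hxf, fun j => rfl,
    ch.basicOpen_hat f, fun i => ?_⟩
  by_cases hi : i ∈ Set.range ch.c
  · obtain ⟨j, rfl⟩ := hi
    rw [y_c]
    exact (ch.basicOpen f).y_c j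
  · rw [y_of_notMem _ hi, map_one]
    exact (ch.basicOpen f).y_of_notMem hi

end Chart

/-! ### Extensions over a local ring -/

/-- Suppose that the first extension maps to the second one, by the identity of the quotients and
multiplication by `u` on the submodules. If the class of the second one generates `Ext¹`, then `u`
is a unit or the first extension splits. -/
lemma isUnit_or_exists_retraction {R : Type} [CommRing R] [IsLocalRing R]
    {K P F Ω : ModuleCat.{0} R} {α : K ⟶ P} {β : P ⟶ Ω} {w : α ≫ β = 0}
    (h₀ : (ShortComplex.mk α β w).ShortExact) {i : K ⟶ F} {p : F ⟶ Ω} {w' : i ≫ p = 0}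
    (h : (ShortComplex.mk i p w').ShortExact) (ψ : P ⟶ F) (u : R) (h₁ : α ≫ ψ = u • i)
    (h₂ : ψ ≫ p = β) (hgen : ∀ η : Abelian.Ext Ω K 1, ∃ a : R, η = a • h.extClass) :
    IsUnit u ∨ ∃ ρ : P ⟶ K, α ≫ ρ = 𝟙 K := by
  let f : ShortComplex.mk α β w ⟶ ShortComplex.mk i p w' :=
    { τ₁ := u • 𝟙 K
      τ₂ := ψ
      τ₃ := 𝟙 Ω
      comm₁₂ := by
        change (u • 𝟙 K) ≫ i = α ≫ ψ
        rw [h₁, Linear.smul_comp, Category.id_comp]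
      comm₂₃ := by
        change ψ ≫ p = β ≫ 𝟙 Ω
        rw [h₂, Category.comp_id] }
  -- By naturality of the class, the second extension is the pushout of the first along `u`. As its
  -- class generates `Ext¹`, the first class satisfies `η = a u η`. If `u` is not a unit, neither is
  -- `a u`; then `1 - a u` is a unit of the local ring and `η = 0`.
  have e : u • h₀.extClass = h.extClass := by
    have := ShortComplex.ShortExact.extClass_naturality h₀ h f
    rw [Abelian.Ext.smul_eq_comp_mk₀]
    exact this.trans (Abelian.Ext.mk₀_id_comp _)
  obtain ⟨a, ha⟩ := hgen h₀.extClass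
  rw [← e, smul_smul] at ha
  rcases IsLocalRing.isUnit_or_isUnit_one_sub_self u with hu | hu
  · exact Or.inl hu
  refine or_iff_not_imp_left.2 fun hnu => ?_
  have hau : IsUnit (1 - a * u) := by
    rcases IsLocalRing.isUnit_or_isUnit_one_sub_self (a * u) with h | h
    · exact (hnu (isUnit_of_mul_isUnit_right h)).elim
    · exact h
  have h0 : h₀.extClass = 0 := by
    obtain ⟨b, hb⟩ := hau.exists_left_inv
    rw [← one_smul R h₀.extClass, ← hb, mul_smul, sub_smul, one_smul, ← ha, sub_self, smul_zero]
  -- The connecting map sends the identity of `K` to this class, which is zero; so the identity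
  -- extends along `α` to the middle term.
  obtain ⟨x, hx⟩ := Abelian.Ext.contravariant_sequence_exact₁ h₀ K (Abelian.Ext.mk₀ (𝟙 K))
    (add_zero 1) (by rw [h0, Abelian.Ext.zero_comp])
  obtain ⟨ρ, rfl⟩ := (Abelian.Ext.mk₀_bijective _ _).2 x
  refine ⟨ρ, (Abelian.Ext.mk₀_bijective _ _).1 ?_⟩
  rw [← hx, Abelian.Ext.mk₀_comp_mk₀]

/-! ### Germs -/

section Germs

variable {X : Scheme.{0}} {x : X}

lemma exists_common_neighborhood {κ : Type} [Finite κ] (V : κ → X.Opens) (hV : ∀ k, x ∈ V k) :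
    ∃ U : X.Opens, x ∈ U ∧ ∀ k, U ≤ V k := by
  have := Fintype.ofFinite κ
  refine ⟨Finset.univ.inf V, ?_, fun k => Finset.inf_le (Finset.mem_univ k)⟩
  refine Finset.inf_induction (p := fun U : X.Opens => x ∈ U) trivial (fun _ h _ h' => ⟨h, h'⟩)
    fun k _ => hV k

/-- The germ of a function. -/
abbrev fGerm {U : X.Opens} (hx : x ∈ U) : Γ(X, U) →+* X.presheaf.stalk x :=
  (X.presheaf.germ U x hx).hom

lemma fGerm_fRes {U V : X.Opens} (h : V ≤ U) (hx : x ∈ V) (a : Γ(X, U)) :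
    fGerm hx (fRes X h a) = fGerm (h hx) a :=
  TopCat.Presheaf.germ_res_apply X.presheaf (homOfLE h) x hx a

/-- The germ of a section. -/
def mGerm (M : X.Modules) {U : X.Opens} (hx : x ∈ U) :
    Γ(M, U) →ₛₗ[fGerm hx] stalkMod X M x where
  toFun m := M.presheaf.germ U x hx m
  map_add' := map_add (M.presheaf.germ U x hx).hom
  map_smul' r m := germ_smul X M x U hx r m

variable (M : X.Modules) {N : X.Modules}

lemma mGerm_secRes {U V : X.Opens} (h : V ≤ U) (hx : x ∈ V) (m : Γ(M, U)) :
    mGerm M hx (secRes M h m) = mGerm M (h hx) m :=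
  TopCat.Presheaf.germ_res_apply M.presheaf (homOfLE h) x hx m

lemma exists_mGerm_eq (t : stalkMod X M x) :
    ∃ (U : X.Opens) (hx : x ∈ U) (m : Γ(M, U)), mGerm M hx m = t :=
  M.presheaf.exists_germ_eq t

lemma exists_secRes_eq_zero {U : X.Opens} (hx : x ∈ U) {m : Γ(M, U)} (h : mGerm M hx m = 0) :
    ∃ (V : X.Opens) (hV : V ≤ U), x ∈ V ∧ secRes M hV m = 0 := by
  obtain ⟨W, hxW, i, j, e⟩ := M.presheaf.germ_eq x hx hx m 0 (h.trans (map_zero _).symm)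
  exact ⟨W, i.le, hxW, e.trans (map_zero _)⟩

lemma exists_fGerm_eq (t : X.presheaf.stalk x) :
    ∃ (U : X.Opens) (hx : x ∈ U) (a : Γ(X, U)), fGerm hx a = t :=
  X.presheaf.exists_germ_eq t

lemma exists_fRes_eq_zero {U : X.Opens} (hx : x ∈ U) {a : Γ(X, U)} (h : fGerm hx a = 0) :
    ∃ (V : X.Opens) (hV : V ≤ U), x ∈ V ∧ fRes X hV a = 0 := by
  obtain ⟨W, hxW, i, j, e⟩ := X.presheaf.germ_eq x hx hx a 0 (h.trans (map_zero (fGerm hx)).symm)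
  exact ⟨W, i.le, hxW, e.trans (map_zero (oRes X j.op))⟩

lemma exists_fGerm_eq_of_finite {κ : Type} [Finite κ] {U : X.Opens} (hx : x ∈ U)
    (t : κ → X.presheaf.stalk x) :
    ∃ (V : X.Opens) (_ : V ≤ U) (hxV : x ∈ V) (a : κ → Γ(X, V)), ∀ k, fGerm hxV (a k) = t k := by
  choose W hW a ha using fun k => exists_fGerm_eq (t k)
  obtain ⟨V, hxV, hV⟩ := exists_common_neighborhood W hW
  have hxI : x ∈ V ⊓ U := ⟨hxV, hx⟩
  refine ⟨V ⊓ U, inf_le_right, hxI, fun k => fRes X (inf_le_left.trans (hV k)) (a k), fun k => ?_⟩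
  exact (fGerm_fRes _ hxI (a k)).trans (ha k)

variable {M}

lemma stalkMap_mGerm (f : M ⟶ N) {U : X.Opens} (hx : x ∈ U) (m : Γ(M, U)) :
    (stalkMap f x).hom (mGerm M hx m) = mGerm N hx (secMap f U m) :=
  TopCat.Presheaf.stalkFunctor_map_germ_apply U x hx f.mapPresheaf m

variable (X x) in
/-- The stalk of the structure sheaf as a sheaf of modules. -/
def stalkUnit : X.presheaf.stalk x →ₗ[X.presheaf.stalk x] stalkMod X (sheafO X) x :=
  LinearMap.toSpanSingleton _ _ (mGerm (sheafO X) (U := ⊤) (Opens.mem_top x) (1 : Γ(X, ⊤)))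

lemma stalkUnit_fGerm {U : X.Opens} (hx : x ∈ U) (a : Γ(X, U)) :
    stalkUnit X x (fGerm hx a) = mGerm (sheafO X) hx a := by
  refine (LinearMap.toSpanSingleton_apply _ _ _ _).trans ?_
  refine (congrArg (fGerm hx a • ·) (mGerm_secRes (sheafO X) le_top hx _).symm).trans ?_
  refine ((mGerm (sheafO X) hx).map_smulₛₗ a _).symm.trans (congrArg _ ?_)
  exact (congrArg (a * ·) (map_one (fRes X le_top))).trans (mul_one a)

lemma stalkUnit_bijective : Function.Bijective (stalkUnit X x) := by
  constructor
  · refine (injective_iff_map_eq_zero _).2 fun t ht => ?_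
    obtain ⟨U, hx, a, rfl⟩ := exists_fGerm_eq t
    rw [stalkUnit_fGerm] at ht
    obtain ⟨V, hV, hxV, e⟩ := exists_secRes_eq_zero _ hx ht
    rw [← fGerm_fRes hV hxV]
    exact (congrArg (fGerm hxV) e).trans (map_zero _)
  · intro t
    obtain ⟨U, hx, m, rfl⟩ := exists_mGerm_eq _ t
    exact ⟨fGerm hx m, stalkUnit_fGerm hx m⟩

end Germs

/-! ### The presentation of the stalks of `Ω¹_X` -/

section KaehlerRes

variable {X : Scheme.{0}} (s : X ⟶ SpecC)

/-- Restriction of Kähler differentials. -/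
def kRes {U V : X.Opens} (h : V ≤ U) :
    CommRingCat.KaehlerDifferential (scalar X s U) →ₛₗ[fRes X h]
      CommRingCat.KaehlerDifferential (scalar X s V) where
  toFun ω := (preOmega X s).map (homOfLE h).op ω
  map_add' := map_add _
  map_smul' r ω := (preOmega X s).map_smul (homOfLE h).op r ω

lemma kRes_d {U V : X.Opens} (h : V ≤ U) (a : Γ(X, U)) :
    kRes s h (CommRingCat.KaehlerDifferential.d (f := scalar X s U) a) =
      CommRingCat.KaehlerDifferential.d (f := scalar X s V) (fRes X h a) :=
  PresheafOfModules.DifferentialsConstruction.relativeDifferentials'_map_d (constToO X s) _ a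

/-- The section of `Ω¹_X` given by a Kähler differential. -/
def kSec (U : X.Opens) : CommRingCat.KaehlerDifferential (scalar X s U) →ₗ[Γ(X, U)]
    Γ(Omega X s, U) where
  toFun ω := (toShf X (preOmega X s)).app (op U) ω
  map_add' := map_add ((toShf X (preOmega X s)).app (op U)).hom
  map_smul' := LinearMap.map_smul ((toShf X (preOmega X s)).app (op U)).hom

lemma kSec_d (U : X.Opens) (a : Γ(X, U)) :
    kSec s U (CommRingCat.KaehlerDifferential.d (f := scalar X s U) a) = dOmega X s U a := rfl

lemma secRes_kSec {U V : X.Opens} (h : V ≤ U)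
    (ω : CommRingCat.KaehlerDifferential (scalar X s U)) :
    secRes (Omega X s) h (kSec s U ω) = kSec s V (kRes s h ω) :=
  (PresheafOfModules.naturality_apply (toShf X (preOmega X s)) (homOfLE h).op ω).symm

lemma exists_kSec_eq {U : X.Opens} (m : Γ(Omega X s, U)) {x : X} (hx : x ∈ U) :
    ∃ (V : X.Opens) (hV : V ≤ U), x ∈ V ∧ ∃ ω, kSec s V ω = secRes (Omega X s) hV m :=
  toShf_locally_surjective (preOmega X s) U m x hx

lemma exists_kRes_eq_zero {U : X.Opens} {ω : CommRingCat.KaehlerDifferential (scalar X s U)}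
    (h : kSec s U ω = 0) {x : X} (hx : x ∈ U) :
    ∃ (V : X.Opens) (hV : V ≤ U), x ∈ V ∧ kRes s hV ω = 0 := by
  obtain ⟨V, hV, hxV, e⟩ := toShf_locally_injective (preOmega X s) U ω 0
    (h.trans (map_zero (kSec s U)).symm) x hx
  exact ⟨V, hV, hxV, e.trans (map_zero (kRes s hV))⟩

end KaehlerRes

namespace Chart

variable {X : Scheme.{0}} {s : X ⟶ SpecC} {n : ℕ} {ι : Type} {C : ι → X.IdealSheafData}
  {W : X.affineOpens} (ch : Chart s n C W) {x : X} (hx : x ∈ W.1)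

/-- The map from the free module on the coordinates to the stalk of `Ω¹_X`. -/
def stalkD : (Fin (n + 1) → X.presheaf.stalk x) →ₗ[X.presheaf.stalk x] stalkMod X (Omega X s) x :=
  Fintype.linearCombination _ (fun j => mGerm (Omega X s) hx (dOmega X s W.1 (ch.x j)))

lemma stalkD_apply (a : Fin (n + 1) → X.presheaf.stalk x) : ch.stalkD hx a =
    ∑ j, a j • mGerm (Omega X s) hx (dOmega X s W.1 (ch.x j)) := rfl

lemma stalkD_restrict {W' : X.affineOpens} (h : W'.1 ≤ W.1) (ch' : Chart s n C W')
    (hx' : x ∈ W'.1) (hc : ∀ j, ch'.x j = fRes X h (ch.x j)) :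
    ch'.stalkD hx' = ch.stalkD (h hx') := by
  refine LinearMap.ext fun a => ?_
  rw [stalkD_apply, stalkD_apply]
  refine Finset.sum_congr rfl fun j _ => congrArg (a j • ·) ?_
  rw [← mGerm_secRes _ h hx', CotangentExtension.secRes_dOmega, hc]

lemma mGerm_dOmega_mem_range (a : Γ(X, W.1)) :
    mGerm (Omega X s) hx (dOmega X s W.1 a) ∈ LinearMap.range (ch.stalkD hx) := by
  obtain ⟨g, hg⟩ := ch.exists_kd_eq_sum a
  refine ⟨fun j => fGerm hx (g j), ?_⟩
  have h := congrArg (fun ω => mGerm (Omega X s) hx (kSec s W.1 ω)) hg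
  simp only [map_sum, map_smul, LinearMap.map_smulₛₗ, kSec_d] at h
  exact h.symm

lemma stalkD_surjective : Function.Surjective (ch.stalkD hx) := by
  intro t
  obtain ⟨U, hxU, m, rfl⟩ := exists_mGerm_eq _ t
  obtain ⟨V, hV, hxV, ω, hω⟩ := exists_kSec_eq s m hxU
  rw [← mGerm_secRes _ hV hxV, ← hω]
  have key : mGerm (Omega X s) hxV (kSec s V ω) ∈ LinearMap.range (ch.stalkD hx) := by
    clear hω
    induction ω using CotangentExtension.kaehler_induction with
    | h0 =>
      rw [map_zero, map_zero]
      exact Submodule.zero_mem _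
    | hadd ω η h h' =>
      rw [map_add, map_add]
      exact Submodule.add_mem _ h h'
    | hd b c =>
      refine Eq.mpr (congrArg (· ∈ LinearMap.range (ch.stalkD hx)) ((congrArg _
        (map_smul (kSec s V) b _)).trans ((mGerm (Omega X s) hxV).map_smulₛₗ b _)))
        (Submodule.smul_mem _ _ ?_)
      -- The function `c` lives only on `V`. The chart is shrunk into `V`, where `dc` is a
      -- combination of the differentials of the coordinates; the map on the stalk does not change.
      obtain ⟨W', h, ch', hV', hx', hc, -, -⟩ := ch.exists_restrict hx hxV
      rw [← ch.stalkD_restrict h ch' hx' hc]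
      have := ch'.mGerm_dOmega_mem_range hx' (fRes X hV' c)
      rwa [← CotangentExtension.secRes_dOmega, mGerm_secRes] at this
  exact key

/-- A relation between germs spreads out: after shrinking it holds between sections of `Ω¹_X`, then
between Kähler differentials of functions, and finally on a smaller chart, where the relations are
known. -/
lemma exists_eq_mul_hat_of_stalkD_eq_zero {a : Fin (n + 1) → X.presheaf.stalk x}
    (h : ch.stalkD hx a = 0) : ∃ b, ∀ j, a j = b * fGerm hx (ch.hat j) := by
  obtain ⟨V, hV, hxV, g, hg⟩ := exists_fGerm_eq_of_finite hx a
  let ω : CommRingCat.KaehlerDifferential (scalar X s V) := ∑ j, g j •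
    CommRingCat.KaehlerDifferential.d (f := scalar X s V) (fRes X hV (ch.x j))
  have h1 : mGerm (Omega X s) hxV (kSec s V ω) = 0 := by
    rw [← h, stalkD_apply]
    simp only [ω, map_sum, map_smul, LinearMap.map_smulₛₗ, hg]
    refine Finset.sum_congr rfl fun j _ => congrArg (a j • ·) ?_
    rw [← mGerm_secRes _ hV hxV, CotangentExtension.secRes_dOmega]
    rfl
  obtain ⟨V₁, hV₁, hxV₁, e₁⟩ := exists_secRes_eq_zero _ hxV h1
  rw [secRes_kSec] at e₁
  obtain ⟨V₂, hV₂, hxV₂, e₂⟩ := exists_kRes_eq_zero s e₁ hxV₁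
  obtain ⟨W', h', ch', hW', hx', hc, hh, -⟩ := ch.exists_restrict hx hxV₂
  have e₃ := congrArg (kRes s hW') e₂
  simp only [ω, map_sum, map_zero, LinearMap.map_smulₛₗ, kRes_d, fRes_fRes] at e₃
  simp only [← hc] at e₃
  obtain ⟨b, hb⟩ := ch'.exists_eq_mul_hat (fun j => fRes X (hW'.trans (hV₂.trans hV₁)) (g j)) e₃
  refine ⟨fGerm hx' b, fun j => ?_⟩
  have := congrArg (fGerm hx') (hb j)
  rw [hh, map_mul, fGerm_fRes, fGerm_fRes, hg] at this
  exact this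

lemma eq_zero_of_forall_mul_fGerm_hat_eq_zero {b : X.presheaf.stalk x}
    (h : ∀ j, b * fGerm hx (ch.hat j) = 0) : b = 0 := by
  obtain ⟨U, hxU, c, rfl⟩ := exists_fGerm_eq b
  have h' : ∀ j, ∃ (V : X.Opens) (_ : x ∈ V) (hV : V ≤ U) (hV' : V ≤ W.1),
      fRes X hV c * fRes X hV' (ch.hat j) = 0 := by
    intro j
    have hxI : x ∈ U ⊓ W.1 := ⟨hxU, hx⟩
    have e : fGerm hxI
        (fRes X inf_le_left c * fRes X inf_le_right (ch.hat j)) = 0 := by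
      rw [map_mul, fGerm_fRes, fGerm_fRes, h]
    obtain ⟨V, hV, hxV, e'⟩ := exists_fRes_eq_zero _ e
    refine ⟨V, hxV, hV.trans inf_le_left, hV.trans inf_le_right, ?_⟩
    rwa [map_mul, fRes_fRes, fRes_fRes] at e'
  choose V hxV hV hV' e using h'
  obtain ⟨T, hxT, hT⟩ := exists_common_neighborhood V hxV
  obtain ⟨W', h₁, ch', hW', hx', -, hh, -⟩ := ch.exists_restrict hx hxT
  have hU : W'.1 ≤ U := hW'.trans ((hT 0).trans (hV 0))
  have := ch'.eq_zero_of_forall_mul_hat_eq_zero (b := fRes X hU c) (fun j => by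
    have := congrArg (fRes X (hW'.trans (hT j))) (e j)
    rwa [map_mul, map_zero, fRes_fRes, fRes_fRes, ← hh] at this)
  rw [← fGerm_fRes hU hx', this, map_zero]

end Chart

/-! ### Local equations with product `ε` -/

section LocalEquations

variable {X : Scheme.{0}} {s : X ⟶ SpecC} {n : ℕ} {ι : Type} {C : ι → X.IdealSheafData}

namespace Chart

variable (E : CotangentExtension X s) {W : X.affineOpens} (ch : Chart s n C W) {x : X}

/-- The sections `f j` of `F` lift the differentials of the coordinates, and `u` measures the
failure of the relation between these differentials to lift to `F`. -/
structure IsLift (f : Fin (n + 1) → Γ(E.F, W.1)) (u : Γ(X, W.1)) : Prop where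
  p_eq : ∀ j, secMap E.p W.1 (f j) = dOmega X s W.1 (ch.x j)
  incl_eq : E.incl W.1 u = ∑ j, ch.hat j • f j

variable {E ch} {f : Fin (n + 1) → Γ(E.F, W.1)} {u : Γ(X, W.1)}

lemma IsLift.restrict (H : IsLift E ch f u) {W' : X.affineOpens} (h : W'.1 ≤ W.1)
    {ch' : Chart s n C W'} (hc : ∀ j, ch'.x j = fRes X h (ch.x j))
    (hh : ∀ j, ch'.hat j = fRes X h (ch.hat j)) :
    IsLift E ch' (fun j => secRes E.F h (f j)) (fRes X h u) where
  p_eq j := by rw [secMap_secRes, H.p_eq, CotangentExtension.secRes_dOmega, hc]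
  incl_eq := by
    rw [← CotangentExtension.secRes_incl, H.incl_eq, map_sum]
    refine Finset.sum_congr rfl fun j _ => ?_
    rw [LinearMap.map_smulₛₗ, hh]

/-- The lifts of the coordinates to the deformation. -/
def IsLift.coord (H : IsLift E ch f u) (j : Fin ch.k) : E.Sec W.1 :=
  ⟨ch.x (Fin.castLE ch.hk j), f (Fin.castLE ch.hk j), H.p_eq _⟩

variable (ch) in
lemma prod_x : ∏ j : Fin ch.k, ch.x (Fin.castLE ch.hk j) = 0 := by
  change ∏ j, ch.φ _ = 0
  rw [← map_prod, prod_modelX, map_zero]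

lemma IsLift.prod_coord_fst (H : IsLift E ch f u) : (∏ j, H.coord j).fst = 0 :=
  (SqZero.prod_fst _ _).trans ch.prod_x

/-- Together with `prod_coord_fst` this says that the lifted coordinates have product `u ε`. The
function `u`, which computes the class of the extension, is thus the obstruction to writing `ε` as
their product. -/
lemma IsLift.prod_coord_snd (H : IsLift E ch f u) : (∏ j, H.coord j).snd = E.incl W.1 u :=
  (SqZero.prod_snd _ _).trans ((ch.sum_hat_smul f).symm.trans H.incl_eq.symm)

variable (E) in
-- The sum `∑ hat_j f_j` is the second component of the product of the elements `(x_j, f_j)`. Its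
-- image in `Ω¹_X` is therefore the differential of `∏ x_j = 0`, and exactness of the extension puts
-- it in `𝒪_X`.
lemma exists_isLift_of_p_eq (hf : ∀ j, secMap E.p W.1 (f j) = dOmega X s W.1 (ch.x j)) :
    ∃ u, IsLift E ch f u := by
  let z : Fin ch.k → E.Sec W.1 := fun j =>
    ⟨ch.x (Fin.castLE ch.hk j), f (Fin.castLE ch.hk j), hf _⟩
  have h : secMap E.p W.1 (∑ j, ch.hat j • f j) = 0 := by
    rw [ch.sum_hat_smul f]
    refine (congrArg (secMap E.p W.1) (SqZero.prod_snd Finset.univ z).symm).trans ?_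
    refine (SqZero.cond _).trans ?_
    rw [SqZero.prod_fst]
    exact (congrArg (dOmega X s W.1) ch.prod_x).trans (map_zero _)
  obtain ⟨u, hu⟩ := E.exists_incl_eq h
  exact ⟨u, hf, hu⟩

variable (E) in
lemma exists_isLift (ch : Chart s n C W) (hx : x ∈ W.1) :
    ∃ (W' : X.affineOpens) (_ : W'.1 ≤ W.1) (_ : x ∈ W'.1) (ch' : Chart s n C W')
      (f : Fin (n + 1) → Γ(E.F, W'.1)) (u : Γ(X, W'.1)), IsLift E ch' f u := by
  choose V hV hxV m hm using fun j => E.exists_lift_omega (dOmega X s W.1 (ch.x j)) hx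
  obtain ⟨T, hxT, hT⟩ := exists_common_neighborhood V hxV
  obtain ⟨W', h, ch', hW', hx', hc, -, -⟩ := ch.exists_restrict hx hxT
  obtain ⟨u, hu⟩ := exists_isLift_of_p_eq E (ch := ch')
    (f := fun j => secRes E.F (hW'.trans (hT j)) (m j)) (fun j => by
      rw [secMap_secRes, hm, secRes_trans, CotangentExtension.secRes_dOmega, hc])
  exact ⟨W', h, hx', ch', _, u, hu⟩

lemma IsLift.sum_fGerm_hat_smul (H : IsLift E ch f u) (hx : x ∈ W.1) :
    ∑ j, fGerm hx (ch.hat j) • mGerm E.F hx (f j) =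
      fGerm hx u • (stalkMap E.i x).hom (stalkUnit X x 1) := by
  have h := congrArg (mGerm E.F hx) H.incl_eq
  rw [map_sum] at h
  refine Eq.trans (Finset.sum_congr rfl fun j _ =>
    ((mGerm E.F hx).map_smulₛₗ (ch.hat j) (f j)).symm) (h.symm.trans ?_)
  refine (stalkMap_mGerm E.i hx u).symm.trans ?_
  rw [← stalkUnit_fGerm hx u, ← map_smul, ← map_smul, smul_eq_mul, mul_one]

/-- If the class of `E` generates the stalk of `𝓔xt¹(Ω¹_X, 𝒪_X)` at `x`, the function `u` is
invertible at `x`, unless `x` is a smooth point. -/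
lemma IsLift.isUnit_or (H : IsLift E ch f u) (hx : x ∈ W.1) (hξ : NowhereVanishing E.extClass) :
    IsUnit (fGerm hx u) ∨ ∃ j, IsUnit (fGerm hx (ch.hat j)) := by
  let R := X.presheaf.stalk x
  let ε : R ≃ₗ[R] stalkMod X (sheafO X) x := LinearEquiv.ofBijective _ stalkUnit_bijective
  have hε : ε 1 = stalkUnit X x 1 := rfl
  let v : Fin (n + 1) → R := fun j => fGerm hx (ch.hat j)
  -- The presentation `0 → 𝒪 → 𝒪^(n+1) → Ω¹ → 0` at `x`, with first map `1 ↦ v`, is mapped to the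
  -- stalk of the extension by sending the basis vectors to the `f j`. On `𝒪` this induces
  -- multiplication by the germ of `u`.
  let α : stalkMod X (sheafO X) x →ₗ[R] (Fin (n + 1) → R) :=
    (LinearMap.toSpanSingleton R _ v).comp ε.symm.toLinearMap
  have hα : ∀ r, α (ε r) = r • v := fun r => by simp [α]
  let ψ : (Fin (n + 1) → R) →ₗ[R] stalkMod X E.F x :=
    Fintype.linearCombination R (fun j => mGerm E.F hx (f j))
  have hψ : ∀ a, ψ a = ∑ j, a j • mGerm E.F hx (f j) := fun a => rfl
  have h₁ : ∀ t, ψ (α t) = fGerm hx u • (stalkMap E.i x).hom t := by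
    intro t
    obtain ⟨r, rfl⟩ := ε.surjective t
    have hr : ε r = r • ε 1 := by rw [← map_smul, smul_eq_mul, mul_one]
    rw [hα, map_smul, hψ, H.sum_fGerm_hat_smul hx, ← hε, hr, map_smul, smul_comm]
  have h₂ : ∀ a, (stalkMap E.p x).hom (ψ a) = ch.stalkD hx a := by
    intro a
    rw [hψ, map_sum, stalkD_apply]
    refine Finset.sum_congr rfl fun j _ => ?_
    rw [map_smul, stalkMap_mGerm, H.p_eq]
  obtain ⟨hS, hgen⟩ := hξ E rfl x
  have hip : ∀ t, (stalkMap E.p x).hom ((stalkMap E.i x).hom t) = 0 := fun t =>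
    ConcreteCategory.congr_hom (stalkMap_comp_zero _ _ E.w x) t
  let α' : stalkMod X (sheafO X) x ⟶ ModuleCat.of R (Fin (n + 1) → R) := ModuleCat.ofHom α
  let β' : ModuleCat.of R (Fin (n + 1) → R) ⟶ stalkMod X (Omega X s) x :=
    ModuleCat.ofHom (ch.stalkD hx)
  have w : α' ≫ β' = 0 := by
    ext t
    change ch.stalkD hx (α t) = 0
    rw [← h₂, h₁, map_smul, hip, smul_zero]
  have h₀ : (ShortComplex.mk α' β' w).ShortExact :=
    { exact := by
        rw [ShortComplex.ShortExact.moduleCat_exact_iff_function_exact]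
        intro a
        refine ⟨fun ha => ?_, ?_⟩
        · obtain ⟨b, hb⟩ := ch.exists_eq_mul_hat_of_stalkD_eq_zero hx ha
          exact ⟨ε b, (hα b).trans (funext fun j => (hb j).symm)⟩
        · rintro ⟨t, rfl⟩
          exact ConcreteCategory.congr_hom w t
      mono_f := by
        refine (ModuleCat.mono_iff_injective _).2 ((injective_iff_map_eq_zero α).2 fun t ht => ?_)
        obtain ⟨r, rfl⟩ := ε.surjective t
        rw [hα] at ht
        rw [ch.eq_zero_of_forall_mul_fGerm_hat_eq_zero hx (fun j => congrFun ht j), map_zero]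
      epi_g := (ModuleCat.epi_iff_surjective _).2 (ch.stalkD_surjective hx) }
  refine (isUnit_or_exists_retraction h₀ hS (ModuleCat.ofHom ψ) (fGerm hx u) ?_ ?_ hgen).imp_right ?_
  · ext t
    exact h₁ t
  · ext1
    exact LinearMap.ext h₂
  -- A retraction expresses `1` as a combination of the germs of the `hat j`, so in a local ring
  -- they cannot all lie in the maximal ideal.
  · rintro ⟨ρ, hρ⟩
    have e : ρ.hom (α (ε 1)) = ε 1 := ConcreteCategory.congr_hom hρ (ε 1)
    rw [hα, one_smul, ← ε.symm_apply_eq] at e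
    by_contra! hv
    refine (IsLocalRing.maximalIdeal R).ne_top_iff_one.1 (IsLocalRing.maximalIdeal.isMaximal R).ne_top ?_
    rw [← e, ← Finset.univ_sum_single v, map_sum, map_sum]
    refine Ideal.sum_mem _ fun j _ => ?_
    have : (Pi.single j (v j) : Fin (n + 1) → R) = v j • Pi.single j 1 := by
      rw [← Pi.single_smul, smul_eq_mul, mul_one]
    rw [this, map_smul, map_smul, smul_eq_mul]
    exact Ideal.mul_mem_right _ _ ((IsLocalRing.mem_maximalIdeal _).2 (hv j))

/-- A chart with lifts of the differentials of the coordinates such that `u` is invertible. -/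
lemma IsLift.exists_isUnit (H : IsLift E ch f u) (hx : x ∈ W.1) (hξ : NowhereVanishing E.extClass) :
    ∃ (W' : X.affineOpens) (_ : W'.1 ≤ W.1) (_ : x ∈ W'.1) (ch' : Chart s n C W')
      (f : Fin (n + 1) → Γ(E.F, W'.1)) (u : Γ(X, W'.1)), IsLift E ch' f u ∧ IsUnit u := by
  rcases H.isUnit_or hx hξ with h | ⟨j, h⟩
  · obtain ⟨V, hV, hxV, hu⟩ := exists_isUnit_fRes hx h
    obtain ⟨W', h', ch', hW', hx', hc, hh, -⟩ := ch.exists_restrict hx hxV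
    refine ⟨W', h', hx', ch', _, _, H.restrict h' hc hh, ?_⟩
    rw [← fRes_fRes hV hW']
    exact hu.map _
  · obtain ⟨V, hV, hxV, hu⟩ := exists_isUnit_fRes hx h
    obtain ⟨W', h', ch', hW', hx', hc, hh, -⟩ := ch.exists_restrict hx hxV
    have hj : IsUnit (ch'.hat j) := by
      rw [hh, ← fRes_fRes hV hW']
      exact hu.map _
    obtain ⟨a, ha⟩ := hj.exists_right_inv
    have H' := H.restrict h' hc hh
    -- With `a` the inverse of `hat j`, adding `i(a (1 - u))` to `f j` leaves its image in `Ω¹_X`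
    -- unchanged and adds `hat j * a * (1 - u) = 1 - u` to `u`. The new value is `1`.
    refine ⟨W', h', hx', ch', fun i => secRes E.F h' (f i) +
      E.incl W'.1 (Pi.single (M := fun _ => Γ(X, W'.1)) j (a * (1 - fRes X h' u)) i), 1,
      ⟨fun i => ?_, ?_⟩, isUnit_one⟩
    · rw [map_add, CotangentExtension.p_incl, add_zero, H'.p_eq]
    · simp only [smul_add, Finset.sum_add_distrib]
      rw [← H'.incl_eq]
      simp only [← map_smul, ← map_sum, ← map_add]
      refine congrArg _ ?_
      rw [Finset.sum_eq_single j, Pi.single_eq_same, smul_eq_mul, ← mul_assoc, ha, one_mul,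
        add_sub_cancel]
      · intro i _ hi
        rw [Pi.single_eq_of_ne hi, smul_zero]
      · exact fun h => (h (Finset.mem_univ j)).elim

/-- A section `z` vanishing on `X_i` is locally, on `X`, a multiple of `y i`, so it differs from
some `t * m i` by a section vanishing on `X`. The latter is locally `w ε = w ∏ m_l`, again a
multiple of `m i`. Thus product `ε` is what upgrades equations on `X` to generators of ideals in the
deformation. -/
lemma isGen_of_prod_eq [Fintype ι] (ch : Chart s n C W) {V : X.Opens} (hV : V ≤ W.1)
    {m : ι → E.Sec V}
    (hm : ∀ i, ∃ b, IsUnit b ∧ E.proj V (m i) = b * fRes X hV (ch.y i))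
    (hprod : ∏ i, m i = E.eps V) (i : ι) : E.IsGen C i V (m i) := by
  classical
  obtain ⟨b, hb, e⟩ := hm i
  refine ⟨?_, fun V' hV' z hz x hx => ?_⟩
  · have h0 : algebraMap Γ(X, W.1) (Restr (C i) W.1) (ch.y i) = 0 := by
      rw [restr_algebraMap_eq_zero_iff, ch.ideal_eq]
      exact Ideal.mem_span_singleton_self _
    have h1 := restrRes_algebraMap (C i) (homOfLE hV).op (ch.y i)
    rw [h0, map_zero] at h1
    refine (congrArg (algebraMap Γ(X, V) (Restr (C i) V)) e).trans ?_
    rw [map_mul]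
    exact (congrArg (_ * ·) h1.symm).trans (mul_zero _)
  · obtain ⟨W', h, ch', hW', hx', -, -, hy⟩ := ch.exists_restrict (hV (hV' hx)) hx
    have hz' := hz.sRes E hW'
    have hz'' := (restr_algebraMap_eq_zero_iff (C i) W' _).1 hz'
    rw [ch'.ideal_eq] at hz''
    obtain ⟨a, ha⟩ := Ideal.mem_span_singleton'.1 hz''
    obtain ⟨c, hc⟩ := hb.exists_right_inv
    obtain ⟨V₂, h₂, hx₂, t, ht⟩ := E.exists_lift (a * fRes X (hW'.trans hV') c) hx'
    have hVV : V₂ ≤ V := h₂.trans (hW'.trans hV')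
    have h0 : E.proj V₂ (E.sRes (h₂.trans hW') z - t * E.sRes hVV (m i)) = 0 := by
      rw [map_sub, map_mul, ht, ← E.sRes_sRes hW' h₂, CotangentExtension.proj_sRes _ h₂,
        CotangentExtension.proj_sRes _ hVV, e, ← ha, map_mul, map_mul, map_mul, fRes_fRes, fRes_fRes, hy,
        fRes_fRes, sub_eq_zero]
      have hc' := congrArg (fRes X hVV) hc
      rw [map_mul, map_one] at hc'
      linear_combination (-fRes X h₂ a * fRes X (h₂.trans h) (ch.y i)) * hc'
    obtain ⟨V₃, h₃, hx₃, w, hw⟩ := E.exists_eq_mul_eps h0 hx₂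
    have hV₃ : V₃ ≤ V := h₃.trans hVV
    refine ⟨V₃, h₃.trans (h₂.trans hW'), hV₃, hx₃,
      E.sRes h₃ t + w * E.sRes hV₃ (∏ l ∈ Finset.univ.erase i, m l), ?_⟩
    rw [map_sub, map_mul, E.sRes_sRes, E.sRes_sRes, ← E.sRes_eps hV₃, ← hprod,
      ← Finset.mul_prod_erase _ _ (Finset.mem_univ i), map_mul, sub_eq_iff_eq_add] at hw
    refine hw.trans ?_
    ring

/-- The lifted coordinates have product `u ε`. Multiplying one of them, the one of index `j₀`, by a
lift `w` of `u⁻¹` makes the product `ε` without changing the ideals. -/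
lemma IsLift.exists_localEqs [Fintype ι] (H : IsLift E ch f u) (hu : IsUnit u) (hx : x ∈ W.1) :
    ∃ (V : X.Opens) (_ : V ≤ W.1) (_ : x ∈ V), Nonempty (E.LocalEqs C V) := by
  classical
  -- There has to be at least one factor to absorb `w`: with none, the relation among the `f j`
  -- would be empty and `u = 0`, which is not a unit at `x`.
  have hk : ∃ j₀ : Fin ch.k, True := by
    by_contra! hne
    have h0 : u = 0 := by
      refine E.incl_injective W.1 (H.incl_eq.trans ?_)
      rw [map_zero, ch.sum_hat_smul]
      exact Finset.sum_eq_zero fun j _ => (hne j).elim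
    have := hu.map (fGerm hx)
    rw [h0, map_zero] at this
    exact not_isUnit_zero this
  obtain ⟨j₀, -⟩ := hk
  obtain ⟨c, hc⟩ := hu.exists_left_inv
  obtain ⟨V, hV, hxV, w, hw⟩ := E.exists_lift c hx
  have hwu : IsUnit w := by
    refine E.isUnit_of_isUnit_proj ?_
    rw [hw]
    exact (IsUnit.of_mul_eq_one u hc).map _
  let m : Fin ch.k → E.Sec V := fun j =>
    Pi.mulSingle (M := fun _ => E.Sec V) j₀ w j * E.sRes hV (H.coord j)
  -- Components that do not meet the chart get the equation `1`, which leaves the product unchanged.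
  let g : ι → E.Sec V := Function.extend ch.c m 1
  have hgc : ∀ j, g (ch.c j) = m j := fun j => ch.c.injective.extend_apply _ _ _
  have hg1 : ∀ i, i ∉ Set.range ch.c → g i = 1 := fun i hi => Function.extend_apply' _ _ _ hi
  have hprod : ∏ i, g i = E.eps V := by
    rw [ch.prod_extend m g hgc hg1, Finset.prod_mul_distrib, Finset.prod_pi_mulSingle',
      if_pos (Finset.mem_univ _), ← map_prod]
    have e₁ : (E.sRes hV (∏ j, H.coord j)).fst = 0 :=
      (congrArg (fRes X hV) H.prod_coord_fst).trans (map_zero _)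
    have e₂ : (E.sRes hV (∏ j, H.coord j)).snd = E.incl V (fRes X hV u) :=
      (congrArg (secRes E.F hV) H.prod_coord_snd).trans (E.secRes_incl hV u)
    refine SqZero.ext ?_ ?_
    · rw [SqZero.mul_fst, e₁, mul_zero]
      rfl
    · rw [SqZero.mul_snd, e₁, e₂, zero_smul, add_zero]
      refine ((E.incl V).map_smul _ _).symm.trans (congrArg (E.incl V) ?_)
      refine (congrArg (· * fRes X hV u) hw).trans ?_
      rw [← map_mul, hc, map_one]
  refine ⟨V, hV, hxV, ⟨⟨g, ch.isGen_of_prod_eq hV (fun i => ?_) hprod, hprod⟩⟩⟩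
  by_cases hi : i ∈ Set.range ch.c
  · obtain ⟨j, rfl⟩ := hi
    refine ⟨E.proj V (Pi.mulSingle (M := fun _ => E.Sec V) j₀ w j), IsUnit.map _ ?_, ?_⟩
    · by_cases hj : j = j₀
      · subst hj
        rwa [Pi.mulSingle_eq_same]
      · rw [Pi.mulSingle_eq_of_ne hj]
        exact isUnit_one
    · rw [hgc, map_mul, ch.y_c]
      rfl
  · refine ⟨1, isUnit_one, ?_⟩
    rw [hg1 i hi, ch.y_of_notMem hi, map_one, map_one, one_mul]

end Chart

/-- A nowhere vanishing class: locally, `ε` is the product of equations of the components. -/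
lemma CotangentExtension.exists_localEqs (E : CotangentExtension X s) [Fintype ι]
    (hX : IsNormalCrossing s n C) (hξ : NowhereVanishing E.extClass) {U : X.Opens} {x : X}
    (hx : x ∈ U) :
    ∃ (V : X.Opens) (_ : V ≤ U) (_ : x ∈ V), Nonempty (E.LocalEqs C V) := by
  obtain ⟨W, ch, hW, hxW⟩ := hX.exists_chart hx
  obtain ⟨W₁, h₁, hx₁, ch₁, f₁, u₁, H₁⟩ := ch.exists_isLift E hxW
  obtain ⟨W₂, h₂, hx₂, ch₂, f₂, u₂, H₂, hu⟩ := H₁.exists_isUnit hx₁ hξ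
  obtain ⟨V, hV, hxV, h⟩ := H₂.exists_localEqs hu hx₂
  exact ⟨V, hV.trans (h₂.trans (h₁.trans hW)), hxV, h⟩

end LocalEquations

end NormalCrossing

end

/-- The basic diagram of a normal crossing variety `X` with components `C i` and a nowhere vanishing
class `ξ`; the extension `E` of class `ξ` provides the first-order deformation `𝒳_ξ`. -/
theorem mainTheorem8 (X : Scheme.{0}) (s : X ⟶ SpecC) (n : ℕ)
    {ι : Type} [Fintype ι] [LinearOrder ι] (C : ι → X.IdealSheafData)
    (hX : IsNormalCrossing s n C)
    (ξ : Abelian.Ext (Omega X s) (sheafO X) 1) (hξ : NowhereVanishing ξ)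
    (E : CotangentExtension X s) (hE : E.extClass = ξ) :
    ∃ (r : Omega X s ⟶ E.omegaRelLog C) (ρ : E.omegaRelLog C ⟶ Limits.kernel (cech2 C)),
      -- the diagram commutes
      E.inclBase ≫ E.toLog C = 0 ∧
      E.toLog C ≫ E.toRelLog C = E.toOmega ≫ r ∧
      E.inclBaseLog C ≫ E.residue C = E.residueBase ≫ toNormalization C ∧
      E.residue C ≫ Limits.kernel.lift (cech2 C) (cech1 C) (cech1_comp_cech2 C) =
        E.toRelLog C ≫ ρ ∧
      -- the rows are exact
      (∃ w, (ShortComplex.mk E.inclBase E.toOmega w).ShortExact) ∧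
      (∃ w, (ShortComplex.mk (E.inclBaseLog C) (E.toRelLog C) w).ShortExact) ∧
      (∃ w, (ShortComplex.mk (toNormalization C)
        (Limits.kernel.lift (cech2 C) (cech1 C) (cech1_comp_cech2 C)) w).ShortExact) ∧
      -- the columns are exact
      IsIso E.residueBase ∧
      (∃ w, (ShortComplex.mk (E.toLog C) (E.residue C) w).Exact) ∧ Epi (E.residue C) ∧
      (∃ w, (ShortComplex.mk r ρ w).Exact) ∧ Epi ρ := by
  subst hE
  -- The hypothesis on the class enters only through these local equations. The three rows, the
  -- residue squares and the left residue do not depend on it; the vanishing of the composite from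
  -- the base, the map `r` and the middle and right columns do.
  have hL : ∀ (U : X.Opens) (x : X), x ∈ U →
      ∃ (V : X.Opens) (_ : V ≤ U) (_ : x ∈ V), Nonempty (E.LocalEqs C V) :=
    fun U x hx => E.exists_localEqs hX hξ hx
  obtain ⟨r, hr⟩ := CotangentExtension.exists_omega_to_relLog hL
  exact ⟨r, E.residueRel C, CotangentExtension.inclBase_toLog hL, hr.symm,
    CotangentExtension.inclBaseLog_residue, CotangentExtension.toRelLog_residueRel.symm,
    ⟨_, E.shortExact_inclBase⟩, ⟨_, CotangentExtension.shortExact_inclBaseLog hX⟩,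
    ⟨_, shortExact_toNormalization hX⟩, inferInstance,
    ⟨_, CotangentExtension.exact_toLog_residue hL⟩, CotangentExtension.epi_residue hL hX,
    CotangentExtension.exact_residueRel hL hX hr, CotangentExtension.epi_residueRel hL hX⟩
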